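/- Let $(\Sigma,h)$ be a smooth finite-dimensional Riemannian manifold (not necessarily connected or complete), and consider the ultrastatic spacetime $(M,g)=(\mathbb{R}\times\Sigma,\,dt^2-h)$, time-oriented by $\partial/\partial t$. Write $\Sigma_t=\{t\}\times\Sigma$. Let $d$ be the Riemannian distance of $h$, i.e. $d(p,q)$ is the infimum of the lengths of curves from $p$ to $q$ (so $d(p,q)=\infty$ if $p,q$ lie in different components). For $K\subseteq\Sigma$ and $t\ge 0$ put $$C(K,t)=\{q\in\Sigma : d(q,K)\le t\},\qquad d(q,K)=\inf_{p\in K}d(q,p).$$ Let $\varepsilon_p\subseteq T_p\Sigma$ be the domain of the exponential map $\exp_p$ of $h$, i.e. the set of $v\in T_p\Sigma$ for which the maximal geodesic with initial velocity $v$ at $p$ is defined at time $1$, and let $\overline{B_t(0)}=\{v\in T_p\Sigma: h_p(v,v)^{1/2}\le t\}$. For $A\subseteq M$ let $J(A)=J^+(A)\cup J^-(A)$, where $J^{+}(A)$ (resp. $J^-(A)$) consists of $A$ together with all end points (resp. starting points) of smooth future-pointing causal curves $\gamma:[a,b]\to M$, $a<b$, that start (resp. end) in $A$. Let $K\subseteq\Sigma$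 be compact, identified with $\{0\}\times K\subseteq\Sigma_0$, and let $t\ge 0$. Then the following statements are equivalent: 1. $C(K,t)$ is compact; 2. $\overline{B_t(0)}\subseteq\varepsilon_p$ for all $p\in K$; 3. $J(K)\cap\Sigma_t$ is compact. If these statements hold, then, identifying $\Sigma_t$ with $\Sigma$ through $(t,x)\mapsto x$, $$C(K,t)=\bigcup_{p\in K}\exp_p\big[\overline{B_t(0)}\big]=J(K)\cap\Sigma_t .$$ -/

import Mathlib

open Bundle
open scoped Manifold ContDiff Topology

noncomputable section

namespace Ultrastatic

section Riemannian

variable {E : Type*} [NormedAddCommGroup E] [NormedSpace ℝ E]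
  {S : Type*} [TopologicalSpace S] [ChartedSpace E S]
  [RiemannianBundle (fun x : S => TangentSpace 𝓘(ℝ, E) x)]

/-- The closed `t`-neighbourhood `C(K,t) = {q | d(q,K) ≤ t}` of `K`, where
`d(q,K) = inf_{p ∈ K} d(q,p)` and `d` is the Riemannian distance. The distance takes values in
`[0,∞]`: it is `∞` between different connected components, and `d(q,∅) = ∞`. -/
def closedNeighborhood (K : Set S) (t : ℝ) : Set S :=
  {q | (⨅ p ∈ K, Manifold.riemannianEDist 𝓘(ℝ, E) q p) ≤ ENNReal.ofReal t}

/-- The Riemannian metric in the chart `φ` around `x₀`: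
`G_y(u,v) = h_{φ⁻¹(y)}(Dφ⁻¹(y) u, Dφ⁻¹(y) v)` for `y` in the target of `φ`. -/
def chartMetric (x₀ : S) (y u v : E) : ℝ :=
  inner ℝ
    (mfderiv 𝓘(ℝ, E) 𝓘(ℝ, E) (extChartAt 𝓘(ℝ, E) x₀).symm y u :
      TangentSpace 𝓘(ℝ, E) ((extChartAt 𝓘(ℝ, E) x₀).symm y))
    (mfderiv 𝓘(ℝ, E) 𝓘(ℝ, E) (extChartAt 𝓘(ℝ, E) x₀).symm y v :
      TangentSpace 𝓘(ℝ, E) ((extChartAt 𝓘(ℝ, E) x₀).symm y))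

/-- The Christoffel symbols of the first kind of the Levi-Civita connection in the chart around
`x₀`: `Γ_y(u,v,w) = (∂_u G(v,w) + ∂_v G(u,w) - ∂_w G(u,v)) / 2 = G(∇_u v, w)` for constant vector
fields `u, v, w` in the chart. -/
def christoffel (x₀ : S) (y u v w : E) : ℝ :=
  (fderiv ℝ (fun z : E => chartMetric x₀ z v w) y u
    + fderiv ℝ (fun z : E => chartMetric x₀ z u w) y v
    - fderiv ℝ (fun z : E => chartMetric x₀ z u v) y w) / 2

/-- `γ` is a geodesic on the open set `J ⊆ ℝ`: it is smooth there, and in every chart, `c = φ ∘ γ`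
satisfies the geodesic equation `∇_{c'} c' = 0`. As the metric is nondegenerate, the equation
is stated after pairing with an arbitrary vector `w`: `G_c(c'', w) + Γ_c(c', c', w) = 0`. -/
def IsGeodesicOn (γ : ℝ → S) (J : Set ℝ) : Prop :=
  ContMDiffOn 𝓘(ℝ, ℝ) 𝓘(ℝ, E) ∞ γ J ∧
    ∀ x₀ : S, ∀ s ∈ J, γ s ∈ (extChartAt 𝓘(ℝ, E) x₀).source →
      ∀ w : E,
        chartMetric x₀ (extChartAt 𝓘(ℝ, E) x₀ (γ s))
            (deriv (deriv fun r => extChartAt 𝓘(ℝ, E) x₀ (γ r)) s) w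
          + christoffel x₀ (extChartAt 𝓘(ℝ, E) x₀ (γ s))
            (deriv (fun r => extChartAt 𝓘(ℝ, E) x₀ (γ r)) s)
            (deriv (fun r => extChartAt 𝓘(ℝ, E) x₀ (γ r)) s) w = 0

/-- `γ` is a geodesic with `γ(0) = p` and `γ'(0) = v`, defined on an open interval that contains
both `0` and `1`. -/
def IsGeodesicFrom (p : S) (v : TangentSpace 𝓘(ℝ, E) p) (γ : ℝ → S) : Prop :=
  ∃ J : Set ℝ, IsOpen J ∧ J.OrdConnected ∧ 0 ∈ J ∧ 1 ∈ J ∧ IsGeodesicOn (E := E) γ J ∧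
    (⟨γ 0, mfderiv 𝓘(ℝ, ℝ) 𝓘(ℝ, E) γ 0 (1 : ℝ)⟩ : TangentBundle 𝓘(ℝ, E) S) = ⟨p, v⟩

/-- The domain `ε_p ⊆ T_p S` of the exponential map: the `v` for which the maximal geodesic with
initial velocity `v` at `p` is defined at time `1`. -/
def expDomain (p : S) : Set (TangentSpace 𝓘(ℝ, E) p) :=
  {v | ∃ γ : ℝ → S, IsGeodesicFrom p v γ}

open Classical in
/-- The exponential map: `exp_p v = γ(1)` for the geodesic `γ` with initial velocity `v ∈ ε_p`
(independent of the choice of `γ`, as geodesics are determined by their initial data). Outside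
`ε_p` the value is the placeholder `p`. -/
def expMap (p : S) (v : TangentSpace 𝓘(ℝ, E) p) : S :=
  if h : ∃ γ : ℝ → S, IsGeodesicFrom p v γ then h.choose 1 else p

end Riemannian

section Spacetime

variable {E : Type*} [NormedAddCommGroup E] [NormedSpace ℝ E]
  {S : Type*} [TopologicalSpace S] [ChartedSpace E S]
  [RiemannianBundle (fun x : S => TangentSpace 𝓘(ℝ, E) x)]

/-- The component `Dπ₁(u) ∈ ℝ` of a tangent vector `u` of `ℝ × S`. -/
def timePart (m : ℝ × S) (u : TangentSpace (𝓘(ℝ, ℝ).prod 𝓘(ℝ, E)) m) : ℝ :=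
  mfderiv (𝓘(ℝ, ℝ).prod 𝓘(ℝ, E)) 𝓘(ℝ, ℝ) (Prod.fst : ℝ × S → ℝ) m u

/-- The component `Dπ₂(u) ∈ T_x S` of a tangent vector `u` of `ℝ × S` at `m = (t,x)`. -/
def spacePart (m : ℝ × S) (u : TangentSpace (𝓘(ℝ, ℝ).prod 𝓘(ℝ, E)) m) :
    TangentSpace 𝓘(ℝ, E) m.2 :=
  mfderiv (𝓘(ℝ, ℝ).prod 𝓘(ℝ, E)) 𝓘(ℝ, E) (Prod.snd : ℝ × S → S) m u

/-- The Lorentzian metric `g = π₁^*(dt ⊗ dt) - π₂^* h` on `ℝ × S`. -/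
def lorentz (m : ℝ × S) (u v : TangentSpace (𝓘(ℝ, ℝ).prod 𝓘(ℝ, E)) m) : ℝ :=
  timePart m u * timePart m v - inner ℝ (spacePart m u) (spacePart m v)

variable (E) in
/-- The vector field `∂/∂t` on `ℝ × S`, i.e. the velocity of `τ ↦ (τ, x)`; it fixes the time
orientation. -/
def timeField (m : ℝ × S) : TangentSpace (𝓘(ℝ, ℝ).prod 𝓘(ℝ, E)) m :=
  mfderiv 𝓘(ℝ, ℝ) (𝓘(ℝ, ℝ).prod 𝓘(ℝ, E)) (fun τ : ℝ => (τ, m.2)) m.1 (1 : ℝ)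

variable (E) in
/-- `γ : [a,b] → ℝ × S` is a smooth future-pointing causal curve: `g(γ', γ') ≥ 0` and
`g(γ', ∂/∂t) > 0` (in particular `γ' ≠ 0`) at every time in `[a,b]`. -/
def IsFutureCausalCurve (γ : ℝ → ℝ × S) (a b : ℝ) : Prop :=
  a < b ∧ ContMDiffOn 𝓘(ℝ, ℝ) (𝓘(ℝ, ℝ).prod 𝓘(ℝ, E)) ∞ γ (Set.Icc a b) ∧
    ∀ s ∈ Set.Icc a b,
      0 ≤ lorentz (E := E) (γ s)
        (mfderivWithin 𝓘(ℝ, ℝ) (𝓘(ℝ, ℝ).prod 𝓘(ℝ, E)) γ (Set.Icc a b) s (1 : ℝ))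
        (mfderivWithin 𝓘(ℝ, ℝ) (𝓘(ℝ, ℝ).prod 𝓘(ℝ, E)) γ (Set.Icc a b) s (1 : ℝ)) ∧
      0 < lorentz (E := E) (γ s)
        (mfderivWithin 𝓘(ℝ, ℝ) (𝓘(ℝ, ℝ).prod 𝓘(ℝ, E)) γ (Set.Icc a b) s (1 : ℝ))
        (timeField E (γ s))

variable (E) in
/-- The causal future `J⁺(A)`, which contains `A` by convention. -/
def causalFuture (A : Set (ℝ × S)) : Set (ℝ × S) :=
  A ∪ {q | ∃ p ∈ A, ∃ (γ : ℝ → ℝ × S) (a b : ℝ),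
    IsFutureCausalCurve E γ a b ∧ γ a = p ∧ γ b = q}

variable (E) in
/-- The causal past `J⁻(A)`, which contains `A` by convention. -/
def causalPast (A : Set (ℝ × S)) : Set (ℝ × S) :=
  A ∪ {q | ∃ p ∈ A, ∃ (γ : ℝ → ℝ × S) (a b : ℝ),
    IsFutureCausalCurve E γ a b ∧ γ a = q ∧ γ b = p}

variable (E) in
/-- `J(A) = J⁺(A) ∪ J⁻(A)`. -/
def causalInfluence (A : Set (ℝ × S)) : Set (ℝ × S) :=
  causalFuture E A ∪ causalPast E A

/-- The slice `Σ_t = {t} × S` of the spacetime. -/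
def timeSlice (S : Type*) (t : ℝ) : Set (ℝ × S) := {t} ×ˢ (Set.univ : Set S)

end Spacetime

end Ultrastatic

end

/-!
The equivalence is a local version of the Hopf–Rinow theorem. For a causal curve of `dt² - h` the
time difference bounds the length of its projection to `S`, and a geodesic with initial velocity
of norm at most `t` lifts to a causal curve of duration `t`. Geodesics from `K` of length at most
`t` therefore stay in `C(K,t)`, and also in the projection of `J(K) ∩ Σ_t`; if one of these is
compact, they can be extended up to time `1`, because initial velocities in a compact set share a
minimal time of existence.

Conversely, let `exp` be defined on the closed `t`-balls over `K`, and let `d(p,q) = r ≤ t` with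
`p ∈ K`. A geodesic that starts at `p` towards the point nearest to `q` on a small sphere around
`p` satisfies `d(γ(s), q) = (1 - s) r` at a small time `s > 0`. This persists up to `s = 1`, since
short minimizing paths are geodesics and have no corners, so `q = γ(1)`. Hence `C(K,t)` is the
image of a compact set under the continuous map `exp`.

Short geodesics minimize because the energy density of the metric is strictly convex up to an error
that is small for slow curves. The convexity also shows that an almost minimizing path stays near
the geodesic, so minimizers are unique. This avoids normal coordinates and the Gauss lemma.
-/

noncomputable section

namespace Ultrastatic

set_option maxSynthPendingDepth 3

open Set

section Calculus

variable {E : Type*} [NormedAddCommGroup E] [NormedSpace ℝ E]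

lemma abs_clm_apply_apply_le (B : E →L[ℝ] E →L[ℝ] ℝ) (u v : E) : |B u v| ≤ ‖B‖ * ‖u‖ * ‖v‖ :=
  B.le_opNorm₂ u v

lemma isCoercive_of_pos [FiniteDimensional ℝ E] {B : E →L[ℝ] E →L[ℝ] ℝ}
    (hB : ∀ u, u ≠ 0 → 0 < B u u) : IsCoercive B := by
  rcases subsingleton_or_nontrivial E with hE | hE
  · exact ⟨1, one_pos, fun u => by simp [Subsingleton.elim u 0]⟩
  have hcont : Continuous fun u => B u u := B.continuous.clm_apply continuous_id
  obtain ⟨u₀, hu₀, hmin⟩ := (isCompact_sphere (0 : E) 1).exists_isMinOn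
    (NormedSpace.sphere_nonempty.2 zero_le_one) hcont.continuousOn
  refine ⟨B u₀ u₀, hB u₀ (ne_zero_of_mem_unit_sphere ⟨u₀, hu₀⟩), fun u => ?_⟩
  rcases eq_or_ne u 0 with rfl | hu
  · simp
  have hu' : ‖u‖ ≠ 0 := norm_ne_zero_iff.2 hu
  have hle : B u₀ u₀ ≤ B (‖u‖⁻¹ • u) (‖u‖⁻¹ • u) := hmin (by simp [norm_smul, hu'])
  calc B u₀ u₀ * ‖u‖ * ‖u‖ ≤ B (‖u‖⁻¹ • u) (‖u‖⁻¹ • u) * ‖u‖ * ‖u‖ := by gcongr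
    _ = B u u := by
      simp only [map_smul, smul_apply, smul_eq_mul]
      field_simp

lemma exists_eventually_coercive {X : Type*} [TopologicalSpace X] {B : X → E →L[ℝ] E →L[ℝ] ℝ}
    {x₀ : X} (hB : ContinuousAt B x₀) (hx₀ : IsCoercive (B x₀)) :
    ∃ l > 0, ∀ᶠ x in 𝓝 x₀, ∀ u, l * ‖u‖ ^ 2 ≤ B x u u := by
  obtain ⟨l, hl, hco⟩ := hx₀
  refine ⟨l / 2, by positivity, ?_⟩
  filter_upwards [Metric.continuousAt_iff'.1 hB (l / 2) (by positivity)] with x hx u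
  rw [dist_eq_norm] at hx
  have hdiff : |B x u u - B x₀ u u| ≤ l / 2 * ‖u‖ * ‖u‖ :=
    (abs_clm_apply_apply_le (B x - B x₀) u u).trans (by gcongr)
  linarith [(abs_le.1 hdiff).1, hco u]

lemma norm_sub_sub_fderiv_le_of_lipschitzOnWith {F : Type*} [NormedAddCommGroup F]
    [NormedSpace ℝ F] {f : E → F} {f' : E → E →L[ℝ] F} {s : Set E} {D : NNReal}
    (hs : Convex ℝ s) (hf : ∀ x ∈ s, HasFDerivWithinAt f (f' x) s x)
    (hf' : LipschitzOnWith D f' s) {x y : E} (hx : x ∈ s) (hy : y ∈ s) :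
    ‖f y - f x - f' x (y - x)‖ ≤ D * ‖y - x‖ ^ 2 := by
  have hconv : Convex ℝ (s ∩ Metric.closedBall x ‖y - x‖) := hs.inter (convex_closedBall _ _)
  have hbound : ∀ z ∈ s ∩ Metric.closedBall x ‖y - x‖, ‖f' z - f' x‖ ≤ D * ‖y - x‖ := by
    intro z hz
    refine (hf'.norm_sub_le hz.1 hx).trans ?_
    gcongr
    exact mem_closedBall_iff_norm.1 hz.2
  rw [pow_two, ← mul_assoc]
  exact hconv.norm_image_sub_le_of_norm_hasFDerivWithin_le'
    (fun z hz => (hf z hz.1).mono inter_subset_left) hbound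
    ⟨hx, Metric.mem_closedBall_self (norm_nonneg _)⟩ ⟨hy, mem_closedBall_iff_norm.2 le_rfl⟩

lemma exists_mem_closedBall_eq_of_approximatesLinearOn_id [CompleteSpace E] {f : E → E}
    {c : NNReal} {ρ : ℝ} (hρ : 0 ≤ ρ)
    (hf : ApproximatesLinearOn f (ContinuousLinearMap.id ℝ E) (Metric.closedBall 0 ρ) c)
    {y : E} (hy : y ∈ Metric.closedBall (f 0) ((1 - c) * ρ)) :
    ∃ u ∈ Metric.closedBall 0 ρ, f u = y := by
  let inv : (ContinuousLinearMap.id ℝ E).NonlinearRightInverse :=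
    { toFun := id, nnnorm := 1, bound' := by simp, right_inv' := by simp }
  exact hf.surjOn_closedBall_of_nonlinearRightInverse inv hρ subset_rfl (by simpa [inv] using hy)

lemma norm_sub_le_of_hasDerivAt_unitInterval {f f' : ℝ → E} {C : ℝ}
    (hf : ∀ s ∈ Icc (0 : ℝ) 1, HasDerivAt f (f' s) s) (hC : ∀ s ∈ Icc (0 : ℝ) 1, ‖f' s‖ ≤ C)
    {s : ℝ} (hs : s ∈ Icc (0 : ℝ) 1) : ‖f s - f 0‖ ≤ C := by
  have hC₀ : 0 ≤ C := (norm_nonneg _).trans (hC s hs)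
  calc ‖f s - f 0‖ ≤ C * (s - 0) := norm_image_sub_le_of_norm_deriv_le_segment'
        (fun x hx => (hf x hx).hasDerivWithinAt) (fun x hx => hC x (Ico_subset_Icc_self hx)) s hs
    _ ≤ C := mul_le_of_le_one_right hC₀ (by linarith [hs.2])

lemma norm_endpoint_sub_le {c₁ v₁ a₁ c₂ v₂ a₂ : ℝ → E} {κ : ℝ} (hκ₀ : 0 ≤ κ) (hκ : κ ≤ 1 / 8)
    (hc₁ : ∀ s ∈ Icc (0 : ℝ) 1, HasDerivAt c₁ (v₁ s) s)
    (hv₁ : ∀ s ∈ Icc (0 : ℝ) 1, HasDerivAt v₁ (a₁ s) s)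
    (hc₂ : ∀ s ∈ Icc (0 : ℝ) 1, HasDerivAt c₂ (v₂ s) s)
    (hv₂ : ∀ s ∈ Icc (0 : ℝ) 1, HasDerivAt v₂ (a₂ s) s)
    (h₀ : c₁ 0 = c₂ 0)
    (ha : ∀ s ∈ Icc (0 : ℝ) 1, ‖a₁ s - a₂ s‖ ≤ κ * max ‖c₁ s - c₂ s‖ ‖v₁ s - v₂ s‖) :
    ‖c₁ 1 - c₂ 1 - (v₁ 0 - v₂ 0)‖ ≤ 1 / 4 * ‖v₁ 0 - v₂ 0‖ := by
  have hc (s : ℝ) (hs : s ∈ Icc (0 : ℝ) 1) := (hc₁ s hs).sub (hc₂ s hs)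
  have hv (s : ℝ) (hs : s ∈ Icc (0 : ℝ) 1) := (hv₁ s hs).sub (hv₂ s hs)
  obtain ⟨m, hm, hmax⟩ := isCompact_Icc.exists_isMaxOn (nonempty_Icc.2 zero_le_one)
    (fun s hs => (hv s hs).continuousAt.norm.continuousWithinAt :
      ContinuousOn (fun s => ‖v₁ s - v₂ s‖) (Icc 0 1))
  set M := ‖v₁ m - v₂ m‖
  have velocity_le : ∀ s ∈ Icc (0 : ℝ) 1, ‖v₁ s - v₂ s‖ ≤ M := fun s hs => hmax hs
  have position_le : ∀ s ∈ Icc (0 : ℝ) 1, ‖c₁ s - c₂ s‖ ≤ M := fun s hs => by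
    simpa [h₀] using norm_sub_le_of_hasDerivAt_unitInterval hc velocity_le hs
  have velocity_change_le : ∀ s ∈ Icc (0 : ℝ) 1, ‖v₁ s - v₂ s - (v₁ 0 - v₂ 0)‖ ≤ κ * M :=
    fun s hs => norm_sub_le_of_hasDerivAt_unitInterval hv (fun r hr => (ha r hr).trans
      (mul_le_mul_of_nonneg_left (max_le (position_le r hr) (velocity_le r hr)) hκ₀)) hs
  have endpoint_le : ‖c₁ 1 - c₂ 1 - (v₁ 0 - v₂ 0)‖ ≤ κ * M := by
    have hlin (s : ℝ) : HasDerivAt (fun r : ℝ => r • (v₁ 0 - v₂ 0)) (v₁ 0 - v₂ 0) s := by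
      simpa using (hasDerivAt_id s).smul_const (v₁ 0 - v₂ 0)
    simpa [h₀] using norm_sub_le_of_hasDerivAt_unitInterval
      (fun s hs => (hc s hs).sub (hlin s)) velocity_change_le (right_mem_Icc.2 zero_le_one)
  have hM : M ≤ ‖v₁ 0 - v₂ 0‖ + κ * M :=
    (norm_le_norm_add_norm_sub' _ _).trans (by gcongr; exact velocity_change_le m hm)
  nlinarith [norm_nonneg (v₁ 0 - v₂ 0), norm_nonneg (v₁ m - v₂ m)]

lemma sq_intervalIntegral_le {f : ℝ → ℝ} (hf : ContinuousOn f (Icc 0 1)) :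
    (∫ s in (0 : ℝ)..1, f s) ^ 2 ≤ ∫ s in (0 : ℝ)..1, f s ^ 2 := by
  set m := ∫ s in (0 : ℝ)..1, f s with hm
  have hnonneg : 0 ≤ ∫ s in (0 : ℝ)..1, (f s - m) ^ 2 :=
    intervalIntegral.integral_nonneg zero_le_one fun s _ => sq_nonneg _
  have hexpand : ∫ s in (0 : ℝ)..1, (f s - m) ^ 2 = (∫ s in (0 : ℝ)..1, f s ^ 2) - m ^ 2 := by
    have hpt (s : ℝ) : (f s - m) ^ 2 = f s ^ 2 - (2 * m) * f s + m ^ 2 := by ring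
    simp only [hpt]
    rw [intervalIntegral.integral_add, intervalIntegral.integral_sub,
      intervalIntegral.integral_const_mul, ← hm, intervalIntegral.integral_const]
    · simp only [sub_zero, one_smul]
      ring
    all_goals exact ContinuousOn.intervalIntegrable_of_Icc zero_le_one (by fun_prop)
  linarith

/-- `b` is a `C¹` path `[0,1] → B` with derivative `b'`. The derivative is required only at interior
times: at the end points it is determined by continuity of `b'`. -/
structure IsC1PathIn (B : Set E) (b b' : ℝ → E) : Prop where
  continuousOn : ContinuousOn b (Icc 0 1)
  continuousOn_deriv : ContinuousOn b' (Icc 0 1)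
  hasDerivAt : ∀ s ∈ Ioo (0 : ℝ) 1, HasDerivAt b (b' s) s
  mem : ∀ s ∈ Icc (0 : ℝ) 1, b s ∈ B

namespace IsC1PathIn

variable {B : Set E} {b b' : ℝ → E}

lemma integral_deriv [CompleteSpace E] (hb : IsC1PathIn B b b') {s : ℝ} (hs : s ∈ Icc (0 : ℝ) 1) :
    ∫ r in (0 : ℝ)..s, b' r = b s - b 0 := by
  have hsub : Icc 0 s ⊆ Icc (0 : ℝ) 1 := Icc_subset_Icc_right hs.2
  exact intervalIntegral.integral_eq_sub_of_hasDerivAt_of_le hs.1 (hb.continuousOn.mono hsub)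
    (fun r hr => hb.hasDerivAt r (Ioo_subset_Ioo_right hs.2 hr))
    ((hb.continuousOn_deriv.mono hsub).intervalIntegrable_of_Icc hs.1)

lemma norm_sub_sq_le_integral [CompleteSpace E] (hb : IsC1PathIn B b b') {s : ℝ}
    (hs : s ∈ Icc (0 : ℝ) 1) : ‖b s - b 0‖ ^ 2 ≤ ∫ r in (0 : ℝ)..1, ‖b' r‖ ^ 2 := by
  refine le_trans ?_ (sq_intervalIntegral_le hb.continuousOn_deriv.norm)
  gcongr
  calc ‖b s - b 0‖ = ‖∫ r in (0 : ℝ)..s, b' r‖ := by rw [hb.integral_deriv hs]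
    _ ≤ ∫ r in (0 : ℝ)..s, ‖b' r‖ := intervalIntegral.norm_integral_le_integral_norm hs.1
    _ ≤ ∫ r in (0 : ℝ)..1, ‖b' r‖ := intervalIntegral.integral_mono_interval le_rfl hs.1 hs.2
        (.of_forall fun r => norm_nonneg _)
        (hb.continuousOn_deriv.norm.intervalIntegrable_of_Icc zero_le_one)

lemma sub {B₂ : Set E} {c c' : ℝ → E} (hb : IsC1PathIn B b b') (hc : IsC1PathIn B₂ c c') :
    IsC1PathIn univ (fun s => b s - c s) (fun s => b' s - c' s) where
  continuousOn := hb.continuousOn.sub hc.continuousOn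
  continuousOn_deriv := hb.continuousOn_deriv.sub hc.continuousOn_deriv
  hasDerivAt s hs := (hb.hasDerivAt s hs).sub (hc.hasDerivAt s hs)
  mem _ _ := mem_univ _

lemma comp (hb : IsC1PathIn B b b') {σ σ' : ℝ → ℝ} (hσ : IsC1PathIn (Icc 0 1) σ σ')
    (hσI : MapsTo σ (Ioo 0 1) (Ioo 0 1)) :
    IsC1PathIn B (fun s => b (σ s)) (fun s => σ' s • b' (σ s)) where
  continuousOn := hb.continuousOn.comp hσ.continuousOn hσ.mem
  continuousOn_deriv :=
    hσ.continuousOn_deriv.smul (hb.continuousOn_deriv.comp hσ.continuousOn hσ.mem)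
  hasDerivAt s hs := (hb.hasDerivAt _ (hσI hs)).scomp s (hσ.hasDerivAt s hs)
  mem s hs := hb.mem _ (hσ.mem s hs)

end IsC1PathIn

lemma exists_orderIso_hasDerivAt_inv {θ θ' : ℝ → ℝ} {δ : ℝ} (hδ : 0 < δ)
    (hθ : ∀ s, HasDerivAt θ (θ' s) s) (hδθ : ∀ s, δ ≤ θ' s) :
    ∃ σ : ℝ ≃o ℝ, (∀ s, σ (θ s) = s) ∧ ∀ t, HasDerivAt σ (θ' (σ t))⁻¹ t := by
  have hpos (s : ℝ) : 0 < θ' s := hδ.trans_le (hδθ s)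
  have hmono : Monotone fun s => θ s - δ * s :=
    monotone_of_hasDerivAt_nonneg (f' := fun s => θ' s - δ)
      (fun s => (hθ s).sub (by simpa using (hasDerivAt_id s).const_mul δ))
      (fun s => sub_nonneg.2 (hδθ s))
  have htop : Filter.Tendsto θ Filter.atTop Filter.atTop := by
    refine Filter.tendsto_atTop_mono' _ ?_ (Filter.tendsto_atTop_add_const_left _ (θ 0)
      (Filter.tendsto_id.const_mul_atTop hδ))
    filter_upwards [Filter.eventually_ge_atTop 0] with s hs
    have := hmono hs
    simp only [mul_zero, sub_zero, id] at this ⊢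
    linarith
  have hbot : Filter.Tendsto θ Filter.atBot Filter.atBot := by
    refine Filter.tendsto_atBot_mono' _ ?_ (Filter.tendsto_atBot_add_const_left _ (θ 0)
      (Filter.tendsto_id.const_mul_atBot hδ))
    filter_upwards [Filter.eventually_le_atBot 0] with s hs
    have := hmono hs
    simp only [mul_zero, sub_zero, id] at this ⊢
    linarith
  have hsurj : Function.Surjective θ :=
    (continuous_iff_continuousAt.2 fun s => (hθ s).continuousAt).surjective htop hbot
  let e := (strictMono_of_hasDerivAt_pos hθ hpos).orderIsoOfSurjective θ hsurj
  exact ⟨e.symm, e.symm_apply_apply, fun t => HasDerivAt.of_local_left_inverse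
    e.symm.continuous.continuousAt (hθ _) (hpos _).ne' (.of_forall e.apply_symm_apply)⟩

/-- Reparametrization by (almost) arc length: `q` is the speed of a curve, `σ` the new parameter. -/
lemma exists_reparam_mul_deriv_le {q : ℝ → ℝ} (hq : ContinuousOn q (Icc 0 1))
    (hq₀ : ∀ s ∈ Icc (0 : ℝ) 1, 0 ≤ q s) {Λ : ℝ} (hΛ : ∫ s in (0 : ℝ)..1, q s < Λ) :
    ∃ σ σ' : ℝ → ℝ, IsC1PathIn (Icc 0 1) σ σ' ∧ MapsTo σ (Ioo 0 1) (Ioo 0 1) ∧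
      SurjOn σ (Icc 0 1) (Icc 0 1) ∧ σ 0 = 0 ∧ σ 1 = 1 ∧
      ∀ s ∈ Icc (0 : ℝ) 1, 0 ≤ σ' s ∧ q (σ s) * σ' s ≤ Λ := by
  set L := ∫ s in (0 : ℝ)..1, q s
  have hL₀ : 0 ≤ L := intervalIntegral.integral_nonneg zero_le_one hq₀
  have hΛ₀ : 0 < Λ := hL₀.trans_lt hΛ
  have hε : 0 < Λ - L := sub_pos.2 hΛ
  let p : ℝ → ℝ := fun s => q (projIcc 0 1 zero_le_one s)
  have hp : Continuous p := hq.comp_continuous (by fun_prop) fun s => (projIcc 0 1 _ s).2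
  have hp₀ (s : ℝ) : 0 ≤ p s := hq₀ _ (projIcc 0 1 _ s).2
  have hpq : ∀ s ∈ Icc (0 : ℝ) 1, p s = q s := fun s hs => by simp [p, projIcc_of_mem _ hs]
  let θ' : ℝ → ℝ := fun s => (p s + (Λ - L)) / Λ
  have hθ' : Continuous θ' := by fun_prop
  have hθ'₀ (s : ℝ) : 0 < θ' s := div_pos (add_pos_of_nonneg_of_pos (hp₀ s) hε) hΛ₀
  let θ : ℝ → ℝ := fun s => ∫ r in (0 : ℝ)..s, θ' r
  have hθ₁ : θ 1 = 1 := by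
    have hpL : ∫ s in (0 : ℝ)..1, p s = L :=
      intervalIntegral.integral_congr fun s hs => hpq s (by rwa [uIcc_of_le zero_le_one] at hs)
    simp only [θ, θ']
    rw [intervalIntegral.integral_div, intervalIntegral.integral_add
      (hp.intervalIntegrable _ _) (by simp), hpL, intervalIntegral.integral_const]
    simp [hΛ₀.ne']
  obtain ⟨σ, hσθ, hσ⟩ := exists_orderIso_hasDerivAt_inv (θ := θ) (div_pos hε hΛ₀)
    (fun s => (hθ'.integral_hasStrictDerivAt 0 s).hasDerivAt)
    (fun s => div_le_div_of_nonneg_right (by linarith [hp₀ s]) hΛ₀.le)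
  have hσ₀ : σ 0 = 0 := by simpa [θ] using hσθ 0
  have hσ₁ : σ 1 = 1 := by simpa [hθ₁] using hσθ 1
  have hσcont : Continuous σ := σ.continuous
  have himage : σ '' Icc 0 1 = Icc 0 1 := by rw [σ.image_Icc, hσ₀, hσ₁]
  refine ⟨σ, fun s => (θ' (σ s))⁻¹, ⟨hσcont.continuousOn, ?_, fun s _ => hσ s,
    fun s hs => himage ▸ mem_image_of_mem σ hs⟩, fun s hs => ?_, himage.ge, hσ₀, hσ₁,
    fun s hs => ⟨(inv_pos.2 (hθ'₀ _)).le, ?_⟩⟩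
  · exact ((hθ'.comp hσcont).inv₀ fun s => (hθ'₀ _).ne').continuousOn
  · exact ⟨hσ₀ ▸ σ.strictMono hs.1, hσ₁ ▸ σ.strictMono hs.2⟩
  · have hσs : σ s ∈ Icc (0 : ℝ) 1 := himage ▸ mem_image_of_mem σ hs
    rw [← div_eq_mul_inv, div_le_iff₀ (hθ'₀ _), mul_div_cancel₀ _ hΛ₀.ne', hpq _ hσs]
    linarith

lemma exists_local_flow [CompleteSpace E] {f : E → E} {z₀ : E} (hf : ContDiffAt ℝ 1 f z₀)
    {U : Set E} (hU : U ∈ 𝓝 z₀) :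
    ∃ r > (0 : ℝ), ∃ ε > (0 : ℝ), ∃ α : E × ℝ → E,
      (∀ z ∈ Metric.closedBall z₀ r, α (z, 0) = z ∧ ∀ s ∈ Ioo (-ε) ε,
        α (z, s) ∈ U ∧ HasDerivAt (fun s => α (z, s)) (f (α (z, s))) s) ∧
      ContinuousOn α (Metric.closedBall z₀ r ×ˢ Ioo (-ε) ε) := by
  obtain ⟨ε, hε, a, r, L, K, hr, hP⟩ := IsPicardLindelof.of_contDiffAt_one hf
  obtain ⟨α, hα, hcont⟩ := (hP 0).exists_forall_mem_closedBall_eq_hasDerivWithinAt_continuousOn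
  simp only [zero_sub, zero_add] at hα hcont
  have hr' : (0 : ℝ) < r := hr
  have hat : ContinuousAt α (z₀, 0) := hcont.continuousAt
    (prod_mem_nhds (Metric.closedBall_mem_nhds _ hr') (Icc_mem_nhds (by linarith) hε))
  have hU' : α ⁻¹' U ∈ 𝓝 (z₀, (0 : ℝ)) :=
    hat (by rwa [(hα z₀ (Metric.mem_closedBall_self hr'.le)).1])
  obtain ⟨δ, hδ, hball⟩ := Metric.nhds_basis_closedBall.mem_iff.1 hU'
  have hr_sub : Metric.closedBall z₀ (min r δ) ⊆ Metric.closedBall z₀ r :=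
    Metric.closedBall_subset_closedBall (min_le_left _ _)
  have hε_sub : Ioo (-(min ε δ)) (min ε δ) ⊆ Ioo (-ε) ε :=
    Ioo_subset_Ioo (by linarith [min_le_left ε δ]) (min_le_left _ _)
  refine ⟨min r δ, lt_min hr' hδ, min ε δ, lt_min hε hδ, α, fun z hz =>
    ⟨(hα z (hr_sub hz)).1, fun s hs => ⟨hball (a := (z, s)) ?_, ?_⟩⟩,
    hcont.mono (prod_mono hr_sub (hε_sub.trans Ioo_subset_Icc_self))⟩
  · rw [← closedBall_prod_same]
    refine ⟨Metric.closedBall_subset_closedBall (min_le_right _ _) hz, ?_⟩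
    rw [mem_closedBall_zero_iff, Real.norm_eq_abs, abs_le]
    exact ⟨by linarith [hs.1, min_le_right ε δ], by linarith [hs.2, min_le_right ε δ]⟩
  · exact ((hα z (hr_sub hz)).2 s (Ioo_subset_Icc_self (hε_sub hs))).hasDerivAt
      (Icc_mem_nhds (hε_sub hs).1 (hε_sub hs).2)

end Calculus

/-- A smooth Riemannian metric `form` on an open subset `dom` of a vector space; this is what a
chart of a Riemannian manifold produces, and the values of `form` outside `dom` are arbitrary. -/
structure LocalMetric (E : Type*) [NormedAddCommGroup E] [NormedSpace ℝ E] where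
  dom : Set E
  form : E → E →L[ℝ] E →L[ℝ] ℝ
  isOpen_dom : IsOpen dom
  contDiffOn_form : ContDiffOn ℝ ∞ form dom
  symm : ∀ y ∈ dom, ∀ u v, form y u v = form y v u
  pos : ∀ y ∈ dom, ∀ u, u ≠ 0 → 0 < form y u u

namespace LocalMetric

variable {E : Type*} [NormedAddCommGroup E] [NormedSpace ℝ E]

section Spray

variable (G : LocalMetric E)

/-- The functional `w ↦ Γ_y(u,u,w)` given by the Christoffel symbols of the first kind. -/
def lowerChristoffel (y u : E) : E →L[ℝ] ℝ :=
  fderiv ℝ G.form y u u - (1 / 2 : ℝ) •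
    (ContinuousLinearMap.apply ℝ ℝ u ∘L ContinuousLinearMap.apply ℝ (E →L[ℝ] ℝ) u ∘L
      fderiv ℝ G.form y)

lemma lowerChristoffel_apply (y u w : E) :
    G.lowerChristoffel y u w
      = fderiv ℝ G.form y u u w - (1 / 2 : ℝ) * fderiv ℝ G.form y w u u := by
  simp [lowerChristoffel]

/-- The geodesic spray, obtained by raising the index of `-Γ_y(u,u,·)`: geodesics satisfy
`c'' = spray c c'`. -/
def spray (y u : E) : E := -(G.form y).inverse (G.lowerChristoffel y u)

variable {G}

lemma contDiffAt_form {y : E} (hy : y ∈ G.dom) : ContDiffAt ℝ ∞ G.form y :=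
  G.contDiffOn_form.contDiffAt (G.isOpen_dom.mem_nhds hy)

lemma hasFDerivAt_form {y : E} (hy : y ∈ G.dom) :
    HasFDerivAt G.form (fderiv ℝ G.form y) y :=
  ((contDiffAt_form hy).differentiableAt (by simp)).hasFDerivAt

lemma contDiffOn_fderiv_form : ContDiffOn ℝ ∞ (fderiv ℝ G.form) G.dom :=
  G.contDiffOn_form.fderiv_of_isOpen G.isOpen_dom (by simp)

lemma nonneg {y : E} (hy : y ∈ G.dom) (u : E) : 0 ≤ G.form y u u := by
  rcases eq_or_ne u 0 with rfl | hu
  · simp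
  · exact (G.pos y hy u hu).le

lemma lowerChristoffel_smul (y u : E) (r : ℝ) :
    G.lowerChristoffel y (r • u) = r ^ 2 • G.lowerChristoffel y u := by
  ext w
  simp only [lowerChristoffel_apply, map_smul, smul_apply, smul_eq_mul]
  ring

lemma spray_smul (y u : E) (r : ℝ) : G.spray y (r • u) = r ^ 2 • G.spray y u := by
  simp [spray, lowerChristoffel_smul]

lemma spray_zero (y : E) : G.spray y 0 = 0 := by
  simpa using G.spray_smul y 0 0

variable [FiniteDimensional ℝ E]

lemma exists_equiv_eq_form {y : E} (hy : y ∈ G.dom) :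
    ∃ e : E ≃L[ℝ] (E →L[ℝ] ℝ), (e : E →L[ℝ] (E →L[ℝ] ℝ)) = G.form y := by
  have inj : Function.Injective (G.form y : E →ₗ[ℝ] (E →L[ℝ] ℝ)) := by
    rw [← LinearMap.ker_eq_bot, LinearMap.ker_eq_bot']
    intro u hu
    by_contra hne
    have := G.pos y hy u hne
    have hzero : G.form y u = 0 := hu
    simp [hzero] at this
  have dim : Module.finrank ℝ E = Module.finrank ℝ (E →L[ℝ] ℝ) := by
    rw [← (LinearMap.toContinuousLinearMap : (E →ₗ[ℝ] ℝ) ≃ₗ[ℝ] (E →L[ℝ] ℝ)).finrank_eq]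
    exact (Subspace.dual_finrank_eq (K := ℝ) (V := E)).symm
  refine ⟨(LinearEquiv.ofInjectiveOfFinrankEq _ inj dim).toContinuousLinearEquiv, ?_⟩
  ext u v
  rfl

lemma form_spray {y : E} (hy : y ∈ G.dom) (u w : E) :
    G.form y (G.spray y u) w = -G.lowerChristoffel y u w := by
  obtain ⟨e, he⟩ := exists_equiv_eq_form hy
  rw [spray, ← he, ContinuousLinearMap.inverse_equiv]
  simp

lemma eq_spray {y : E} (hy : y ∈ G.dom) {u a : E}
    (h : ∀ w, G.form y a w + G.lowerChristoffel y u w = 0) : a = G.spray y u := by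
  have hdiff : ∀ w, G.form y (a - G.spray y u) w = 0 := fun w => by
    rw [map_sub, sub_apply, form_spray hy]
    linarith [h w]
  by_contra hne
  exact (G.pos y hy _ (sub_ne_zero.2 hne)).ne' (hdiff _)

lemma contDiffOn_lowerChristoffel :
    ContDiffOn ℝ ∞ (fun z : E × E => G.lowerChristoffel z.1 z.2) (G.dom ×ˢ univ) := by
  rw [contDiffOn_clm_apply]
  intro w
  simp only [lowerChristoffel_apply]
  have hderiv : ContDiffOn ℝ ∞ (fun z : E × E => fderiv ℝ G.form z.1) (G.dom ×ˢ univ) :=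
    contDiffOn_fderiv_form.comp contDiff_fst.contDiffOn (fun z hz => hz.1)
  have hsnd : ContDiffOn ℝ ∞ (fun z : E × E => z.2) (G.dom ×ˢ univ) := contDiff_snd.contDiffOn
  exact (((hderiv.clm_apply hsnd).clm_apply hsnd).clm_apply contDiffOn_const).sub
    (contDiffOn_const.mul (((hderiv.clm_apply contDiffOn_const).clm_apply hsnd).clm_apply hsnd))

lemma contDiffOn_spray :
    ContDiffOn ℝ ∞ (fun z : E × E => G.spray z.1 z.2) (G.dom ×ˢ univ) := by
  have hinverse : ContDiffOn ℝ ∞ (fun z : E × E => (G.form z.1).inverse) (G.dom ×ˢ univ) := by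
    intro z hz
    obtain ⟨e, he⟩ := exists_equiv_eq_form hz.1
    have hinverse_at : ContDiffAt ℝ ∞ ContinuousLinearMap.inverse (G.form z.1) := by
      rw [← he]
      exact contDiffAt_map_inverse e
    exact (hinverse_at.comp z ((contDiffAt_form hz.1).comp z contDiffAt_fst)).contDiffWithinAt
  exact (hinverse.clm_apply contDiffOn_lowerChristoffel).neg

lemma contDiffAt_spray {y : E} (hy : y ∈ G.dom) (u : E) :
    ContDiffAt ℝ ∞ (fun z : E × E => G.spray z.1 z.2) (y, u) :=
  contDiffOn_spray.contDiffAt ((G.isOpen_dom.prod isOpen_univ).mem_nhds ⟨hy, trivial⟩)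

end Spray

section Solution

/-- `c` is a geodesic of `G` with velocity `v` on `J`, written as a first-order system. -/
structure IsSolutionOn (G : LocalMetric E) (c v : ℝ → E) (J : Set ℝ) : Prop where
  mem : ∀ s ∈ J, c s ∈ G.dom
  deriv_pos : ∀ s ∈ J, HasDerivAt c (v s) s
  deriv_vel : ∀ s ∈ J, HasDerivAt v (G.spray (c s) (v s)) s

variable {G : LocalMetric E} {c v : ℝ → E} {J : Set ℝ}

lemma IsSolutionOn.mono {J' : Set ℝ} (h : G.IsSolutionOn c v J) (hJ : J' ⊆ J) :
    G.IsSolutionOn c v J' :=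
  ⟨fun s hs => h.1 s (hJ hs), fun s hs => h.2 s (hJ hs), fun s hs => h.3 s (hJ hs)⟩

lemma IsSolutionOn.congr {c' v' : ℝ → E} (h : G.IsSolutionOn c v J) (hJ : IsOpen J)
    (heq : ∀ s ∈ J, (c' s, v' s) = (c s, v s)) : G.IsSolutionOn c' v' J := by
  have hc (s) (hs : s ∈ J) : c' s = c s := congr(($(heq s hs)).1)
  have hv (s) (hs : s ∈ J) : v' s = v s := congr(($(heq s hs)).2)
  refine ⟨fun s hs => hc s hs ▸ h.mem s hs, fun s hs => ?_, fun s hs => ?_⟩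
  · rw [hv s hs]
    exact (h.deriv_pos s hs).congr_of_eventuallyEq ((hJ.eventually_mem hs).mono hc)
  · rw [hc s hs, hv s hs]
    exact (h.deriv_vel s hs).congr_of_eventuallyEq ((hJ.eventually_mem hs).mono hv)

lemma IsSolutionOn.hasDerivAt (h : G.IsSolutionOn c v J) {s : ℝ} (hs : s ∈ J) :
    HasDerivAt (fun r => (c r, v r)) (v s, G.spray (c s) (v s)) s :=
  (h.deriv_pos s hs).prodMk (h.deriv_vel s hs)

lemma isSolutionOn_const {y : E} (hy : y ∈ G.dom) (J : Set ℝ) :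
    G.IsSolutionOn (fun _ => y) (fun _ => 0) J :=
  ⟨fun _ _ => hy, fun s _ => hasDerivAt_const s y, fun s _ => by
    rw [spray_zero]; exact hasDerivAt_const s 0⟩

lemma IsSolutionOn.comp_mul (h : G.IsSolutionOn c v J) (a : ℝ) :
    G.IsSolutionOn (fun s => c (a * s)) (fun s => a • v (a * s)) ((a * ·) ⁻¹' J) := by
  have ha (s : ℝ) : HasDerivAt (fun s => a * s) a s := by
    simpa using (hasDerivAt_id s).const_mul a
  refine ⟨fun s hs => h.mem _ hs, fun s hs => ?_, fun s hs => ?_⟩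
  · exact (h.deriv_pos _ hs).scomp s (ha s)
  · rw [spray_smul, pow_two, mul_smul]
    exact ((h.deriv_vel _ hs).scomp s (ha s)).const_smul a

lemma IsSolutionOn.comp_add (h : G.IsSolutionOn c v J) (b : ℝ) :
    G.IsSolutionOn (fun s => c (s + b)) (fun s => v (s + b)) ((· + b) ⁻¹' J) :=
  ⟨fun _ hs => h.mem _ hs, fun s hs => (h.deriv_pos _ hs).comp_add_const s b,
    fun s hs => (h.deriv_vel _ hs).comp_add_const s b⟩

lemma hasDerivAt_form_apply {c v w : ℝ → E} {c' v' w' : E} {s : ℝ} (hs : c s ∈ G.dom)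
    (hc : HasDerivAt c c' s) (hv : HasDerivAt v v' s) (hw : HasDerivAt w w' s) :
    HasDerivAt (fun r => G.form (c r) (v r) (w r))
      (fderiv ℝ G.form (c s) c' (v s) (w s) + G.form (c s) v' (w s) + G.form (c s) (v s) w') s := by
  have h := ((((hasFDerivAt_form hs).comp_hasDerivAt s hc).clm_apply hv).clm_apply hw)
  simpa using h

lemma continuousOn_form_comp {X : Type*} [TopologicalSpace X] {f : X → E} {s : Set X}
    (hf : ContinuousOn f s) (hs : ∀ x ∈ s, f x ∈ G.dom) : ContinuousOn (fun x => G.form (f x)) s :=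
  G.contDiffOn_form.continuousOn.comp hf hs

variable [FiniteDimensional ℝ E]

lemma IsSolutionOn.hasDerivAt_energy (h : G.IsSolutionOn c v J) {s : ℝ} (hs : s ∈ J) :
    HasDerivAt (fun r => G.form (c r) (v r) (v r)) 0 s := by
  have henergy := hasDerivAt_form_apply (h.mem s hs) (h.deriv_pos s hs) (h.deriv_vel s hs)
    (h.deriv_vel s hs)
  convert henergy using 1
  rw [G.symm _ (h.mem s hs) (v s), form_spray (h.mem s hs), lowerChristoffel_apply]
  ring

lemma IsSolutionOn.contDiffOn (h : G.IsSolutionOn c v J) (hJ : IsOpen J) :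
    ContDiffOn ℝ ∞ (fun s => (c s, v s)) J := by
  rw [contDiffOn_infty]
  intro n
  induction n with
  | zero =>
    have hc : ContinuousOn (fun s => (c s, v s)) J :=
      fun s hs => (h.hasDerivAt hs).continuousAt.continuousWithinAt
    exact contDiffOn_zero.2 hc
  | succ n ih =>
    rw [Nat.cast_add, Nat.cast_one, contDiffOn_succ_iff_deriv_of_isOpen hJ]
    refine ⟨fun s hs => (h.hasDerivAt hs).differentiableAt.differentiableWithinAt,
      by simp, ?_⟩
    have hvelocity : ContDiffOn ℝ n (fun s => (v s, G.spray (c s) (v s))) J := by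
      refine (contDiff_snd.comp_contDiffOn ih).prodMk ?_
      exact (contDiffOn_spray.of_le (by exact_mod_cast le_top)).comp ih
        (fun s hs => ⟨h.mem s hs, trivial⟩)
    exact hvelocity.congr fun s hs => (h.hasDerivAt hs).deriv

lemma contDiffAt_vectorField {z : E × E} (hz : z.1 ∈ G.dom) :
    ContDiffAt ℝ ∞ (fun z : E × E => (z.2, G.spray z.1 z.2)) z :=
  contDiffAt_snd.prodMk (contDiffAt_spray hz z.2)

lemma IsSolutionOn.eventuallyEq {c₁ v₁ c₂ v₂ : ℝ → E} {s : ℝ} (hJ : J ∈ 𝓝 s)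
    (h₁ : G.IsSolutionOn c₁ v₁ J) (h₂ : G.IsSolutionOn c₂ v₂ J)
    (hc : c₁ s = c₂ s) (hv : v₁ s = v₂ s) :
    (fun r => (c₁ r, v₁ r)) =ᶠ[𝓝 s] fun r => (c₂ r, v₂ r) := by
  have hs := mem_of_mem_nhds hJ
  obtain ⟨K, t, ht, hK⟩ := ((contDiffAt_vectorField (G := G) (z := (c₁ s, v₁ s))
    (h₁.mem s hs)).of_le (m := 1) (by exact_mod_cast le_top)).exists_lipschitzOnWith
  refine ODE_solution_unique_of_eventually (v := fun _ z => (z.2, G.spray z.1 z.2))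
    (s := fun _ => t) (K := K) (.of_forall fun _ => hK) ?_ ?_ (by simp [hc, hv])
  · filter_upwards [hJ, (h₁.hasDerivAt hs).continuousAt ht] with r hr hr'
    exact ⟨h₁.hasDerivAt hr, hr'⟩
  · have ht' : t ∈ 𝓝 (c₂ s, v₂ s) := by rwa [← hc, ← hv]
    filter_upwards [hJ, (h₂.hasDerivAt hs).continuousAt ht'] with r hr hr'
    exact ⟨h₂.hasDerivAt hr, hr'⟩

lemma exists_flow {z₀ : E × E} (hz₀ : z₀.1 ∈ G.dom) {U : Set (E × E)} (hU : U ∈ 𝓝 z₀) :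
    ∃ r > (0 : ℝ), ∃ ε > (0 : ℝ), ∃ α : (E × E) × ℝ → E × E,
      (∀ z ∈ Metric.closedBall z₀ r, α (z, 0) = z ∧ (∀ s ∈ Ioo (-ε) ε, α (z, s) ∈ U) ∧
        G.IsSolutionOn (fun s => (α (z, s)).1) (fun s => (α (z, s)).2) (Ioo (-ε) ε)) ∧
      ContinuousOn α (Metric.closedBall z₀ r ×ˢ Ioo (-ε) ε) := by
  obtain ⟨r, hr, ε, hε, α, hα, hcont⟩ := exists_local_flow
    ((contDiffAt_vectorField (G := G) hz₀).of_le (m := 1) (by exact_mod_cast le_top))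
    (Filter.inter_mem hU (continuousAt_fst (G.isOpen_dom.mem_nhds hz₀)))
  refine ⟨r, hr, ε, hε, α, fun z hz => ⟨(hα z hz).1, fun s hs => ((hα z hz).2 s hs).1.1, ?_⟩, hcont⟩
  exact ⟨fun s hs => ((hα z hz).2 s hs).1.2, fun s hs => ((hα z hz).2 s hs).2.fst,
    fun s hs => ((hα z hz).2 s hs).2.snd⟩

end Solution

end LocalMetric

namespace LocalMetric

variable {E : Type*} [NormedAddCommGroup E] [NormedSpace ℝ E] {G : LocalMetric E}

section EnergyConvexity

/-- The energy density `(y,u) ↦ G_y(u,u)` exceeds its first order expansion by `l ‖ν‖²`, up to an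
error of `C ‖y' - y‖² ‖u‖²`. As the error is small for slow velocities `u`, this convexity makes
short geodesics minimizing. -/
def EnergyConvexOn (G : LocalMetric E) (l C : ℝ) (B : Set E) : Prop :=
  ∀ y ∈ B, ∀ y' ∈ B, ∀ u ν : E,
    G.form y u u + fderiv ℝ G.form y (y' - y) u u + 2 * G.form y u ν + l * ‖ν‖ ^ 2
      - C * ‖y' - y‖ ^ 2 * ‖u‖ ^ 2 ≤ G.form y' (u + ν) (u + ν)

lemma EnergyConvexOn.mono {l C : ℝ} {B B' : Set E} (h : G.EnergyConvexOn l C B) (hB : B' ⊆ B) :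
    G.EnergyConvexOn l C B' :=
  fun y hy y' hy' => h y (hB hy) y' (hB hy')

lemma energyConvexOn_of_lipschitzOnWith {B : Set E} (hdom : B ⊆ G.dom) (hB : Convex ℝ B) {l : ℝ}
    (hl : 0 < l) (hco : ∀ y ∈ B, ∀ u, l * ‖u‖ ^ 2 ≤ G.form y u u) {A D : NNReal}
    (hA : LipschitzOnWith A G.form B) (hD : LipschitzOnWith D (fderiv ℝ G.form) B) :
    G.EnergyConvexOn (l / 2) (D + 2 * A ^ 2 / l) B := by
  intro y hy y' hy' u ν
  have expand : G.form y' (u + ν) (u + ν)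
      = G.form y' u u + 2 * G.form y' u ν + G.form y' ν ν := by
    simp only [map_add, add_apply, G.symm y' (hdom hy') ν u]
    ring
  have taylor : |G.form y' u u - G.form y u u - fderiv ℝ G.form y (y' - y) u u|
      ≤ D * ‖y' - y‖ ^ 2 * ‖u‖ * ‖u‖ :=
    (abs_clm_apply_apply_le (G.form y' - G.form y - fderiv ℝ G.form y (y' - y)) u u).trans (by
      gcongr
      exact norm_sub_sub_fderiv_le_of_lipschitzOnWith hB
        (fun z hz => (hasFDerivAt_form (hdom hz)).hasFDerivWithinAt) hD hy hy')
  have cross : |G.form y' u ν - G.form y u ν| ≤ A * ‖y' - y‖ * ‖u‖ * ‖ν‖ :=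
    (abs_clm_apply_apply_le (G.form y' - G.form y) u ν).trans (by
      gcongr
      exact hA.norm_sub_le hy' hy)
  have amgm : 2 * (A * ‖y' - y‖ * ‖u‖ * ‖ν‖)
      ≤ l / 2 * ‖ν‖ ^ 2 + 2 * A ^ 2 / l * ‖y' - y‖ ^ 2 * ‖u‖ ^ 2 := by
    have hsq : 0 ≤ 2 / l * (l / 2 * ‖ν‖ - A * ‖y' - y‖ * ‖u‖) ^ 2 := by positivity
    have expand_sq : 2 / l * (l / 2 * ‖ν‖ - A * ‖y' - y‖ * ‖u‖) ^ 2
        = l / 2 * ‖ν‖ ^ 2 + 2 * A ^ 2 / l * ‖y' - y‖ ^ 2 * ‖u‖ ^ 2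
          - 2 * (A * ‖y' - y‖ * ‖u‖ * ‖ν‖) := by
      field_simp
      ring
    linarith
  rw [expand]
  linarith [(abs_le.1 taylor).1, (abs_le.1 cross).1, hco y' hy' ν]

lemma exists_energyConvexOn [FiniteDimensional ℝ E] {y₀ : E} (hy₀ : y₀ ∈ G.dom) :
    ∃ l > 0, ∃ C ≥ 0, ∃ B ∈ 𝓝 y₀, G.EnergyConvexOn l C B := by
  have hform := contDiffAt_form hy₀
  obtain ⟨l, hl, hco⟩ := exists_eventually_coercive hform.continuousAt
    (isCoercive_of_pos (G.pos y₀ hy₀))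
  obtain ⟨A, sA, hsA, hA⟩ :=
    (hform.of_le (m := 1) (by exact_mod_cast le_top)).exists_lipschitzOnWith
  obtain ⟨D, sD, hsD, hD⟩ := ((contDiffOn_fderiv_form.contDiffAt
    (G.isOpen_dom.mem_nhds hy₀)).of_le (m := 1) (by exact_mod_cast le_top)).exists_lipschitzOnWith
  obtain ⟨a, ha, hball⟩ := Metric.nhds_basis_closedBall.mem_iff.1 (Filter.inter_mem
    (Filter.inter_mem hco (G.isOpen_dom.mem_nhds hy₀)) (Filter.inter_mem hsA hsD))
  exact ⟨l / 2, by positivity, _, by positivity, _, Metric.closedBall_mem_nhds y₀ ha,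
    energyConvexOn_of_lipschitzOnWith (fun y hy => (hball hy).1.2) (convex_closedBall _ _) hl
      (fun y hy => (hball hy).1.1) (hA.mono fun y hy => (hball hy).2.1)
      (hD.mono fun y hy => (hball hy).2.2)⟩

end EnergyConvexity

section ShortGeodesics

/-- A geodesic on `J` that stays in `B` and has coordinate speed at most `β`. -/
structure IsSlowSolutionOn (G : LocalMetric E) (B : Set E) (β : ℝ) (c v : ℝ → E) (J : Set ℝ) :
    Prop extends G.IsSolutionOn c v J where
  mem_of_mem : ∀ s ∈ J, c s ∈ B
  norm_velocity_le : ∀ s ∈ J, ‖v s‖ ≤ β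

lemma IsSlowSolutionOn.mono {B : Set E} {β β' : ℝ} {c v : ℝ → E} {J J' : Set ℝ}
    (h : G.IsSlowSolutionOn B β c v J) (hβ : β ≤ β') (hJ : J' ⊆ J) :
    G.IsSlowSolutionOn B β' c v J' :=
  ⟨h.toIsSolutionOn.mono hJ, fun s hs => h.mem_of_mem s (hJ hs),
    fun s hs => (h.norm_velocity_le s (hJ hs)).trans hβ⟩

variable {y₀ : E} {a τ : ℝ} {K : NNReal}

lemma norm_spray_sub_le_of_slow
    (hK : LipschitzOnWith K (fun z : E × E => G.spray z.1 z.2) (Metric.closedBall (y₀, 0) a))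
    (hτ₀ : 0 < τ) (hτ₁ : τ ≤ 1) {y y' u u' : E} (hy : y ∈ Metric.closedBall y₀ a)
    (hy' : y' ∈ Metric.closedBall y₀ a) (hu : ‖u‖ ≤ τ * a) (hu' : ‖u'‖ ≤ τ * a) :
    ‖G.spray y u - G.spray y' u'‖ ≤ τ * K * max ‖y - y'‖ ‖u - u'‖ := by
  have unscale {w : E} (hw : ‖w‖ ≤ τ * a) : ∃ w₁ ∈ Metric.closedBall (0 : E) a, τ • w₁ = w := by
    refine ⟨τ⁻¹ • w, ?_, smul_inv_smul₀ hτ₀.ne' w⟩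
    rwa [mem_closedBall_zero_iff, norm_smul, norm_inv, Real.norm_of_nonneg hτ₀.le,
      inv_mul_le_iff₀ hτ₀]
  obtain ⟨w, hw, rfl⟩ := unscale hu
  obtain ⟨w', hw', rfl⟩ := unscale hu'
  rw [← closedBall_prod_same] at hK
  have lipschitz : ‖G.spray y w - G.spray y' w'‖ ≤ K * max ‖y - y'‖ ‖w - w'‖ :=
    hK.norm_sub_le (x := (y, w)) (y := (y', w')) ⟨hy, hw⟩ ⟨hy', hw'⟩
  rw [spray_smul, spray_smul, ← smul_sub, ← smul_sub, norm_smul, norm_smul, norm_pow,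
    Real.norm_of_nonneg hτ₀.le]
  calc τ ^ 2 * ‖G.spray y w - G.spray y' w'‖
      ≤ τ ^ 2 * (K * max ‖y - y'‖ ‖w - w'‖) := by gcongr
    _ = τ * K * max (τ * ‖y - y'‖) (τ * ‖w - w'‖) := by
        rw [← mul_max_of_nonneg _ _ hτ₀.le]
        ring
    _ ≤ τ * K * max ‖y - y'‖ (τ * ‖w - w'‖) := by
        gcongr
        exact mul_le_of_le_one_left (norm_nonneg _) hτ₁

lemma IsSlowSolutionOn.norm_endpoint_sub_le
    (hK : LipschitzOnWith K (fun z : E × E => G.spray z.1 z.2) (Metric.closedBall (y₀, 0) a))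
    (hτ₀ : 0 < τ) (hτ₁ : τ ≤ 1) (hτK : τ * K ≤ 1 / 8) {c₁ v₁ c₂ v₂ : ℝ → E}
    (h₁ : G.IsSlowSolutionOn (Metric.closedBall y₀ a) (τ * a) c₁ v₁ (Icc 0 1))
    (h₂ : G.IsSlowSolutionOn (Metric.closedBall y₀ a) (τ * a) c₂ v₂ (Icc 0 1))
    (h₀ : c₁ 0 = c₂ 0) : ‖c₁ 1 - c₂ 1 - (v₁ 0 - v₂ 0)‖ ≤ 1 / 4 * ‖v₁ 0 - v₂ 0‖ :=
  Ultrastatic.norm_endpoint_sub_le (by positivity) hτK h₁.deriv_pos h₁.deriv_vel h₂.deriv_pos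
    h₂.deriv_vel h₀ fun s hs => norm_spray_sub_le_of_slow hK hτ₀ hτ₁ (h₁.mem_of_mem s hs)
      (h₂.mem_of_mem s hs) (h₁.norm_velocity_le s hs) (h₂.norm_velocity_le s hs)

variable [FiniteDimensional ℝ E]

lemma exists_slow_solutions (hy₀ : y₀ ∈ G.dom) (ha : 0 < a) :
    ∃ r > 0, ∃ τ₀ > 0, ∀ τ, 0 < τ → τ ≤ τ₀ →
      ∀ x ∈ Metric.closedBall y₀ r, ∀ u ∈ Metric.closedBall (0 : E) (τ * r), ∃ c v : ℝ → E,
        G.IsSlowSolutionOn (Metric.closedBall y₀ a) (τ * a) c v (Ioo (-1) 2) ∧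
          c 0 = x ∧ v 0 = u := by
  obtain ⟨r, hr, ε, hε, α, hα, -⟩ := G.exists_flow (z₀ := (y₀, 0)) hy₀
    (U := Metric.closedBall (y₀, 0) a) (Metric.closedBall_mem_nhds _ ha)
  refine ⟨r, hr, ε / 2, by positivity, fun τ hτ hτε x hx u hu => ?_⟩
  have hz : (x, τ⁻¹ • u) ∈ Metric.closedBall (y₀, (0 : E)) r := by
    rw [← closedBall_prod_same]
    refine ⟨hx, ?_⟩
    rw [mem_closedBall_zero_iff] at hu ⊢
    rwa [norm_smul, norm_inv, Real.norm_of_nonneg hτ.le, inv_mul_le_iff₀ hτ]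
  obtain ⟨h₀, hmem, hsol⟩ := hα _ hz
  have hsub : Ioo (-1 : ℝ) 2 ⊆ (τ * ·) ⁻¹' Ioo (-ε) ε := fun s hs =>
    ⟨by nlinarith [hs.1], by nlinarith [hs.2]⟩
  have hball (s : ℝ) (hs : s ∈ Ioo (-1 : ℝ) 2) := by
    simpa only [← closedBall_prod_same, mem_prod, mem_closedBall_zero_iff]
      using hmem _ (hsub hs)
  refine ⟨_, _, ⟨(hsol.comp_mul τ).mono hsub, fun s hs => (hball s hs).1, fun s hs => ?_⟩,
    by simp [h₀], by simp [h₀, smul_smul, hτ.ne']⟩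
  rw [norm_smul, Real.norm_of_nonneg hτ.le]
  gcongr
  exact (hball s hs).2

lemma exists_slow_solution_joining (hdom : Metric.closedBall y₀ a ⊆ G.dom) (ha : 0 < a)
    (hK : LipschitzOnWith K (fun z : E × E => G.spray z.1 z.2) (Metric.closedBall (y₀, 0) a))
    {β : ℝ} (hβ : 0 < β) :
    ∃ r > 0, ∀ x ∈ Metric.closedBall y₀ r, ∀ y ∈ Metric.closedBall x r, ∃ c v : ℝ → E,
      G.IsSlowSolutionOn (Metric.closedBall y₀ a) β c v (Ioo (-1) 2) ∧ c 0 = x ∧ c 1 = y := by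
  obtain ⟨r, hr, τ₀, hτ₀, hflow⟩ :=
    exists_slow_solutions (hdom (Metric.mem_closedBall_self ha.le)) ha
  have small (M : ℝ) {δ : ℝ} (hδ : 0 < δ) : ∀ᶠ τ : ℝ in 𝓝[>] 0, τ * M ≤ δ := by
    have hlim : Filter.Tendsto (fun τ : ℝ => τ * M) (𝓝 0) (𝓝 0) :=
      (continuous_mul_const M).tendsto' 0 0 (zero_mul M)
    exact (hlim.mono_left nhdsWithin_le_nhds).eventually_le_const hδ
  obtain ⟨τ, hτ : 0 < τ, hττ₀, hτ₁, hτK, hτβ⟩ := (eventually_mem_nhdsWithin.and ((small 1 hτ₀).and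
    ((small 1 one_pos).and ((small K (by positivity : (0 : ℝ) < 1 / 8)).and (small a hβ))))).exists
  rw [mul_one] at hττ₀ hτ₁
  choose! c v hsol hc₀ hv₀ using hflow τ hτ hττ₀
  refine ⟨min r (3 / 4 * (τ * r)), by positivity, fun x hx y hy => ?_⟩
  replace hx : x ∈ Metric.closedBall y₀ r :=
    Metric.closedBall_subset_closedBall (min_le_left _ _) hx
  have hunit : Icc (0 : ℝ) 1 ⊆ Ioo (-1) 2 := Icc_subset_Ioo (by norm_num) (by norm_num)
  have approximates_id : ApproximatesLinearOn (fun u => c x u 1) (ContinuousLinearMap.id ℝ E)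
      (Metric.closedBall 0 (τ * r)) (1 / 4) := by
    intro u hu w hw
    have h := ((hsol x hx u hu).mono le_rfl hunit).norm_endpoint_sub_le hK hτ hτ₁ hτK
      ((hsol x hx w hw).mono le_rfl hunit) ((hc₀ x hx u hu).trans (hc₀ x hx w hw).symm)
    rw [hv₀ x hx u hu, hv₀ x hx w hw] at h
    simpa using h
  have endpoint_zero : c x 0 1 = x := by
    have hzero : (0 : E) ∈ Metric.closedBall (0 : E) (τ * r) :=
      Metric.mem_closedBall_self (by positivity)
    have hxa : x ∈ Metric.closedBall y₀ a :=
      hc₀ x hx 0 hzero ▸ (hsol x hx 0 hzero).mem_of_mem 0 (by norm_num)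
    have h := ((hsol x hx 0 hzero).mono le_rfl hunit).norm_endpoint_sub_le hK hτ hτ₁ hτK
      ⟨isSolutionOn_const (hdom hxa) _, fun _ _ => hxa, fun _ _ => by rw [norm_zero]; positivity⟩
      (hc₀ x hx 0 hzero)
    simpa [hv₀ x hx 0 hzero, sub_eq_zero] using h
  obtain ⟨u, hu, huy⟩ := exists_mem_closedBall_eq_of_approximatesLinearOn_id (y := y)
    (by positivity) approximates_id (by
      rw [endpoint_zero]
      refine Metric.closedBall_subset_closedBall ((min_le_right _ _).trans (le_of_eq ?_)) hy
      push_cast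
      ring)
  exact ⟨c x u, v x u, (hsol x hx u hu).mono hτβ subset_rfl, hc₀ x hx u hu, huy⟩

end ShortGeodesics

section EnergyComparison

variable {B : Set E} {l C β : ℝ} {c v b b' : ℝ → E}

lemma IsSolutionOn.isC1PathIn (hc : G.IsSolutionOn c v (Icc 0 1)) : IsC1PathIn G.dom c v where
  continuousOn s hs := (hc.deriv_pos s hs).continuousAt.continuousWithinAt
  continuousOn_deriv s hs := (hc.deriv_vel s hs).continuousAt.continuousWithinAt
  hasDerivAt s hs := hc.deriv_pos s (Ioo_subset_Icc_self hs)
  mem := hc.mem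

variable [FiniteDimensional ℝ E]

lemma IsSolutionOn.form_velocity_eq (hc : G.IsSolutionOn c v (Icc 0 1)) {s : ℝ}
    (hs : s ∈ Icc (0 : ℝ) 1) : G.form (c s) (v s) (v s) = G.form (c 0) (v 0) (v 0) :=
  constant_of_has_deriv_right_zero
    (fun _ hr => (hc.hasDerivAt_energy hr).continuousAt.continuousWithinAt)
    (fun _ hr => (hc.hasDerivAt_energy (Ico_subset_Icc_self hr)).hasDerivWithinAt) s hs

/-- The integrand is the derivative of `2 G_c(v, η)`, by the geodesic equation. -/
lemma IsSolutionOn.integral_firstVariation_eq_zero (hc : G.IsSolutionOn c v (Icc 0 1))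
    {η ν : ℝ → E} (hη : IsC1PathIn univ η ν) (h₀ : η 0 = 0) (h₁ : η 1 = 0) :
    IntervalIntegrable (fun s => fderiv ℝ G.form (c s) (η s) (v s) (v s)
        + 2 * G.form (c s) (v s) (ν s)) MeasureTheory.volume 0 1 ∧
      ∫ s in (0 : ℝ)..1, (fderiv ℝ G.form (c s) (η s) (v s) (v s)
        + 2 * G.form (c s) (v s) (ν s)) = 0 := by
  have hcc := hc.isC1PathIn.continuousOn
  have hvc := hc.isC1PathIn.continuousOn_deriv
  have hform := continuousOn_form_comp hcc hc.mem
  have hfderiv : ContinuousOn (fun s => fderiv ℝ G.form (c s)) (Icc 0 1) :=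
    contDiffOn_fderiv_form.continuousOn.comp hcc hc.mem
  have hintegrable : IntervalIntegrable (fun s => fderiv ℝ G.form (c s) (η s) (v s) (v s)
      + 2 * G.form (c s) (v s) (ν s)) MeasureTheory.volume 0 1 :=
    ((((hfderiv.clm_apply hη.continuousOn).clm_apply hvc).clm_apply hvc).add
      (continuousOn_const.mul ((hform.clm_apply hvc).clm_apply
        hη.continuousOn_deriv))).intervalIntegrable_of_Icc zero_le_one
  refine ⟨hintegrable, ?_⟩
  rw [intervalIntegral.integral_eq_sub_of_hasDerivAt_of_le zero_le_one
    (f := fun s => 2 * G.form (c s) (v s) (η s))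
    (continuousOn_const.mul ((hform.clm_apply hvc).clm_apply hη.continuousOn))
    (fun s hs => ?_) hintegrable]
  · simp only [h₀, h₁, map_zero, sub_self]
  · have hs' := Ioo_subset_Icc_self hs
    refine ((hasDerivAt_form_apply (hc.mem s hs') (hc.deriv_pos s hs') (hc.deriv_vel s hs')
      (hη.hasDerivAt s hs)).const_mul 2).congr_deriv ?_
    rw [form_spray (hc.mem s hs'), lowerChristoffel_apply]
    ring

lemma IsSlowSolutionOn.energy_add_le_integral (hB : B ⊆ G.dom) (hl : 0 < l) (hC : 0 ≤ C)
    (hβ : C * β ^ 2 ≤ l / 2) (hconv : G.EnergyConvexOn l C B)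
    (hc : G.IsSlowSolutionOn B β c v (Icc 0 1)) (hb : IsC1PathIn B b b') (h₀ : b 0 = c 0)
    (h₁ : b 1 = c 1) {s : ℝ} (hs : s ∈ Icc (0 : ℝ) 1) :
    G.form (c 0) (v 0) (v 0) + l / 2 * ‖b s - c s‖ ^ 2
      ≤ ∫ r in (0 : ℝ)..1, G.form (b r) (b' r) (b' r) := by
  have hη := hb.sub hc.toIsSolutionOn.isC1PathIn
  set η : ℝ → E := fun r => b r - c r
  set ν : ℝ → E := fun r => b' r - v r
  set P := ∫ r in (0 : ℝ)..1, ‖ν r‖ ^ 2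
  set Q := G.form (c 0) (v 0) (v 0)
  obtain ⟨hvar_int, hvar⟩ := hc.integral_firstVariation_eq_zero hη (sub_eq_zero.2 h₀)
    (sub_eq_zero.2 h₁)
  set var : ℝ → ℝ := fun r => fderiv ℝ G.form (c r) (η r) (v r) (v r) + 2 * G.form (c r) (v r) (ν r)
  have displacement_le {r : ℝ} (hr : r ∈ Icc (0 : ℝ) 1) : ‖η r‖ ^ 2 ≤ P := by
    simpa [η, h₀] using hη.norm_sub_sq_le_integral hr
  have pointwise (r : ℝ) (hr : r ∈ Icc (0 : ℝ) 1) :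
      Q - l / 2 * P + var r + l * ‖ν r‖ ^ 2 ≤ G.form (b r) (b' r) (b' r) := by
    have h := hconv _ (hc.mem_of_mem r hr) _ (hb.mem r hr) (v r) (ν r)
    rw [hc.form_velocity_eq hr, add_sub_cancel] at h
    have error_le : C * ‖η r‖ ^ 2 * ‖v r‖ ^ 2 ≤ l / 2 * P :=
      calc C * ‖η r‖ ^ 2 * ‖v r‖ ^ 2 ≤ C * ‖η r‖ ^ 2 * β ^ 2 := by
            gcongr
            exact hc.norm_velocity_le r hr
        _ = C * β ^ 2 * ‖η r‖ ^ 2 := by ring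
        _ ≤ l / 2 * P := mul_le_mul hβ (displacement_le hr) (sq_nonneg _) (by positivity)
    simp only [var]
    linarith
  have hν_int : IntervalIntegrable (fun r => l * ‖ν r‖ ^ 2) MeasureTheory.volume 0 1 :=
    (continuousOn_const.mul (hη.continuousOn_deriv.norm.pow 2)).intervalIntegrable_of_Icc
      zero_le_one
  have integrated := intervalIntegral.integral_mono_on (μ := MeasureTheory.volume) zero_le_one
    ((intervalIntegrable_const.add hvar_int).add hν_int)
    ((((continuousOn_form_comp hb.continuousOn fun r hr => hB (hb.mem r hr)).clm_apply
      hb.continuousOn_deriv).clm_apply hb.continuousOn_deriv).intervalIntegrable_of_Icc zero_le_one)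
    pointwise
  rw [intervalIntegral.integral_add (intervalIntegrable_const.add hvar_int) hν_int,
    intervalIntegral.integral_add intervalIntegrable_const hvar_int, hvar,
    intervalIntegral.integral_const, intervalIntegral.integral_const_mul, sub_zero, one_smul]
    at integrated
  linarith [mul_le_mul_of_nonneg_left (displacement_le hs) (half_pos hl).le]

lemma IsSlowSolutionOn.energy_add_le_sq_length (hB : B ⊆ G.dom) (hl : 0 < l) (hC : 0 ≤ C)
    (hβ : C * β ^ 2 ≤ l / 2) (hconv : G.EnergyConvexOn l C B)
    (hc : G.IsSlowSolutionOn B β c v (Icc 0 1)) (hb : IsC1PathIn B b b') (h₀ : b 0 = c 0)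
    (h₁ : b 1 = c 1) {s₀ : ℝ} (hs₀ : s₀ ∈ Icc (0 : ℝ) 1) :
    G.form (c 0) (v 0) (v 0) + l / 2 * Metric.infDist (b s₀) (c '' Icc 0 1) ^ 2
      ≤ (∫ s in (0 : ℝ)..1, √(G.form (b s) (b' s) (b' s))) ^ 2 := by
  set q : ℝ → ℝ := fun s => √(G.form (b s) (b' s) (b' s))
  have hq : ContinuousOn q (Icc 0 1) :=
    (((continuousOn_form_comp hb.continuousOn fun r hr => hB (hb.mem r hr)).clm_apply
      hb.continuousOn_deriv).clm_apply hb.continuousOn_deriv).sqrt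
  set L := ∫ s in (0 : ℝ)..1, q s
  have le_sq_of_lt (Λ : ℝ) (hΛ : L < Λ) : G.form (c 0) (v 0) (v 0)
      + l / 2 * Metric.infDist (b s₀) (c '' Icc 0 1) ^ 2 ≤ Λ ^ 2 := by
    obtain ⟨σ, σ', hσ, hσI, hσsurj, hσ₀, hσ₁, hspeed⟩ :=
      exists_reparam_mul_deriv_le hq (fun s _ => Real.sqrt_nonneg _) hΛ
    obtain ⟨s, hs, rfl⟩ := hσsurj hs₀
    have hbσ := hb.comp hσ hσI
    have energy_le := hc.energy_add_le_integral hB hl hC hβ hconv hbσ (by simp only [hσ₀, h₀])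
      (by simp only [hσ₁, h₁]) hs
    have energy_density_le (r : ℝ) (hr : r ∈ Icc (0 : ℝ) 1) :
        G.form (b (σ r)) (σ' r • b' (σ r)) (σ' r • b' (σ r)) ≤ Λ ^ 2 := by
      have hsq : q (σ r) ^ 2 = G.form (b (σ r)) (b' (σ r)) (b' (σ r)) :=
        Real.sq_sqrt (nonneg (hB (hb.mem _ (hσ.mem r hr))) _)
      calc G.form (b (σ r)) (σ' r • b' (σ r)) (σ' r • b' (σ r)) = (q (σ r) * σ' r) ^ 2 := by
            rw [mul_pow, hsq]
            simp only [map_smul, smul_apply, smul_eq_mul]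
            ring
        _ ≤ Λ ^ 2 := by
            gcongr
            · exact mul_nonneg (Real.sqrt_nonneg _) (hspeed r hr).1
            · exact (hspeed r hr).2
    have integral_le := intervalIntegral.integral_mono_on (μ := MeasureTheory.volume) zero_le_one
      ((((continuousOn_form_comp hbσ.continuousOn fun r hr => hB (hbσ.mem r hr)).clm_apply
        hbσ.continuousOn_deriv).clm_apply hbσ.continuousOn_deriv).intervalIntegrable_of_Icc
          zero_le_one) intervalIntegrable_const energy_density_le
    rw [intervalIntegral.integral_const, sub_zero, one_smul] at integral_le
    have infDist_le : Metric.infDist (b (σ s)) (c '' Icc 0 1) ≤ ‖b (σ s) - c s‖ := by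
      rw [← dist_eq_norm]
      exact Metric.infDist_le_dist_of_mem (mem_image_of_mem c hs)
    refine le_trans ?_ (energy_le.trans integral_le)
    gcongr
    exact Metric.infDist_nonneg
  have hlim : Filter.Tendsto (fun Λ : ℝ => Λ ^ 2) (𝓝[>] L) (𝓝 (L ^ 2)) :=
    ((continuous_pow 2).tendsto L).mono_left nhdsWithin_le_nhds
  exact ge_of_tendsto hlim (eventually_mem_nhdsWithin.mono le_sq_of_lt)

end EnergyComparison

section MinimizingSolutions

variable [FiniteDimensional ℝ E]

lemma exists_minimizing_solution {y₀ : E} (hy₀ : y₀ ∈ G.dom) :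
    ∃ a > 0, ∃ l > 0, ∃ r > 0, Metric.closedBall y₀ a ⊆ G.dom ∧
      ∀ x ∈ Metric.closedBall y₀ r, ∀ y ∈ Metric.closedBall x r,
      ∃ c v : ℝ → E, G.IsSolutionOn c v (Ioo (-1) 2) ∧ c 0 = x ∧ c 1 = y ∧
        ∀ b b' : ℝ → E, IsC1PathIn (Metric.closedBall y₀ a) b b' → b 0 = x → b 1 = y →
          ∀ s₀ ∈ Icc (0 : ℝ) 1,
            G.form x (v 0) (v 0) + l / 2 * Metric.infDist (b s₀) (c '' Icc 0 1) ^ 2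
              ≤ (∫ s in (0 : ℝ)..1, √(G.form (b s) (b' s) (b' s))) ^ 2 := by
  obtain ⟨l, hl, C, hC, B, hB, hconv⟩ := exists_energyConvexOn hy₀
  obtain ⟨K, V, hV, hK⟩ :=
    ((contDiffAt_spray hy₀ 0).of_le (m := 1) (by exact_mod_cast le_top)).exists_lipschitzOnWith
  obtain ⟨a₁, ha₁, hball₁⟩ := Metric.nhds_basis_closedBall.mem_iff.1
    (Filter.inter_mem hB (G.isOpen_dom.mem_nhds hy₀))
  obtain ⟨a₂, ha₂, hball₂⟩ := Metric.nhds_basis_closedBall.mem_iff.1 hV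
  set a := min a₁ a₂
  have ha : 0 < a := lt_min ha₁ ha₂
  have hball : Metric.closedBall y₀ a ⊆ B ∩ G.dom :=
    (Metric.closedBall_subset_closedBall (min_le_left _ _)).trans hball₁
  have hdom := hball.trans inter_subset_right
  set β := √(l / (2 * (C + 1)))
  have hβ : C * β ^ 2 ≤ l / 2 := by
    rw [Real.sq_sqrt (by positivity), mul_div_assoc', div_le_div_iff₀ (by positivity) two_pos]
    nlinarith
  obtain ⟨r, hr, hjoin⟩ := exists_slow_solution_joining hdom ha
    (hK.mono ((Metric.closedBall_subset_closedBall (min_le_right _ _)).trans hball₂))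
    (β := β) (by positivity)
  refine ⟨a, ha, l, hl, r, hr, hdom, fun x hx y hy => ?_⟩
  obtain ⟨c, v, hc, rfl, rfl⟩ := hjoin x hx y hy
  exact ⟨c, v, hc.toIsSolutionOn, rfl, rfl, fun b b' hb h₀ h₁ s₀ hs₀ =>
    (hc.mono le_rfl (Icc_subset_Ioo (by norm_num) (by norm_num))).energy_add_le_sq_length hdom hl hC
      hβ (hconv.mono (hball.trans inter_subset_left)) hb h₀ h₁ hs₀⟩

end MinimizingSolutions

end LocalMetric

section Coordinates

variable {E : Type*} [NormedAddCommGroup E] [NormedSpace ℝ E]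
  {S : Type*} [TopologicalSpace S] [ChartedSpace E S] {x₀ : S}

/-- The coordinates on the tangent bundle induced by the chart around `x₀`. -/
def toCoord (x₀ : S) (z : TangentBundle 𝓘(ℝ, E) S) : E × E :=
  (extChartAt 𝓘(ℝ, E) x₀ z.proj, mfderiv 𝓘(ℝ, E) 𝓘(ℝ, E) (extChartAt 𝓘(ℝ, E) x₀) z.proj z.2)

/-- The tangent vector with given coordinates in the chart around `x₀`, the inverse of
`toCoord`. -/
def ofCoord (x₀ : S) (w : E × E) : TangentBundle 𝓘(ℝ, E) S :=
  ⟨(extChartAt 𝓘(ℝ, E) x₀).symm w.1,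
    mfderiv 𝓘(ℝ, E) 𝓘(ℝ, E) (extChartAt 𝓘(ℝ, E) x₀).symm w.1 w.2⟩

variable (E) in
/-- The velocity of a curve, as a point of the tangent bundle. -/
def velocity (γ : ℝ → S) (s : ℝ) : TangentBundle 𝓘(ℝ, E) S :=
  ⟨γ s, mfderiv 𝓘(ℝ, ℝ) 𝓘(ℝ, E) γ s (1 : ℝ)⟩

lemma velocity_congr {γ₁ γ₂ : ℝ → S} {s : ℝ} (h : γ₁ =ᶠ[𝓝 s] γ₂) :
    velocity E γ₁ s = velocity E γ₂ s := by
  refine TotalSpace.ext h.eq_of_nhds (heq_of_eq ?_)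
  have hmfderiv : (mfderiv 𝓘(ℝ, ℝ) 𝓘(ℝ, E) γ₁ s : ℝ →L[ℝ] E)
      = mfderiv 𝓘(ℝ, ℝ) 𝓘(ℝ, E) γ₂ s := h.mfderiv_eq
  exact congr($hmfderiv 1)

lemma velocity_comp_of_hasDerivAt {F : Type*} [NormedAddCommGroup F] [NormedSpace ℝ F] {f : F → S}
    {c : ℝ → F} {v : F} {s : ℝ} (hf : MDifferentiableAt 𝓘(ℝ, F) 𝓘(ℝ, E) f (c s))
    (hc : HasDerivAt c v s) :
    velocity E (fun r => f (c r)) s = ⟨f (c s), mfderiv 𝓘(ℝ, F) 𝓘(ℝ, E) f (c s) v⟩ := by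
  have hchain := (hf.hasMFDerivAt.comp s hc.hasFDerivAt.hasMFDerivAt).mfderiv
  refine TotalSpace.ext rfl (heq_of_eq (congr($hchain (1 : ℝ)).trans ?_))
  exact congrArg (mfderiv 𝓘(ℝ, F) 𝓘(ℝ, E) f (c s) : F → E) (one_smul ℝ v)

lemma velocity_comp_mul_add {γ : ℝ → S} {a b s : ℝ}
    (h : MDifferentiableAt 𝓘(ℝ, ℝ) 𝓘(ℝ, E) γ (a * s + b)) :
    velocity E (fun r => γ (a * r + b)) s
      = ⟨γ (a * s + b), a • (velocity E γ (a * s + b)).2⟩ := by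
  have haff : HasDerivAt (fun r : ℝ => a * r + b) (a • 1) s := by
    simpa using ((hasDerivAt_id s).const_mul a).add_const b
  rw [velocity_comp_of_hasDerivAt (c := fun r => a * r + b) h haff]
  exact congrArg _ ((mfderiv 𝓘(ℝ, ℝ) 𝓘(ℝ, E) γ (a * s + b) : ℝ →L[ℝ] E).map_smul a 1)

lemma velocity_comp_add {γ : ℝ → S} {b s : ℝ}
    (h : MDifferentiableAt 𝓘(ℝ, ℝ) 𝓘(ℝ, E) γ (s + b)) :
    velocity E (fun r => γ (r + b)) s = velocity E γ (s + b) := by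
  rw [← one_mul s] at h ⊢
  calc velocity E (fun r => γ (r + b)) (1 * s) = velocity E (fun r => γ (1 * r + b)) s := by
        simp only [one_mul]
    _ = velocity E γ (1 * s + b) := by
        rw [velocity_comp_mul_add h, one_smul]
        rfl

lemma ofCoord_eq_tangentMapWithin {w : E × E} (hw : w.1 ∈ (extChartAt 𝓘(ℝ, E) x₀).target) :
    ofCoord x₀ w = tangentMapWithin 𝓘(ℝ, E) 𝓘(ℝ, E) (extChartAt 𝓘(ℝ, E) x₀).symm
      (extChartAt 𝓘(ℝ, E) x₀).target ⟨w.1, w.2⟩ := by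
  simp only [ofCoord, tangentMapWithin,
    mfderivWithin_of_isOpen (isOpen_extChartAt_target (I := 𝓘(ℝ, E)) x₀) hw]

lemma contMDiffOn_extChartAt_source (x₀ : S) [IsManifold 𝓘(ℝ, E) ∞ S] :
    ContMDiffOn 𝓘(ℝ, E) 𝓘(ℝ, E) ∞ (extChartAt 𝓘(ℝ, E) x₀) (extChartAt 𝓘(ℝ, E) x₀).source := by
  rw [extChartAt_source]
  exact contMDiffOn_extChartAt

variable [IsManifold 𝓘(ℝ, E) ∞ S]

lemma mdifferentiableAt_chart {x : S} (hx : x ∈ (extChartAt 𝓘(ℝ, E) x₀).source) :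
    MDifferentiableAt 𝓘(ℝ, E) 𝓘(ℝ, E) (extChartAt 𝓘(ℝ, E) x₀) x :=
  mdifferentiableAt_extChartAt (by rwa [extChartAt_source] at hx)

lemma mdifferentiableAt_chart_symm {y : E} (hy : y ∈ (extChartAt 𝓘(ℝ, E) x₀).target) :
    MDifferentiableAt 𝓘(ℝ, E) 𝓘(ℝ, E) (extChartAt 𝓘(ℝ, E) x₀).symm y :=
  ((contMDiffOn_extChartAt_symm x₀).contMDiffAt
    ((isOpen_extChartAt_target x₀).mem_nhds hy)).mdifferentiableAt (n := ∞) (by simp)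

lemma mfderiv_chart_mfderiv_symm {y : E} (hy : y ∈ (extChartAt 𝓘(ℝ, E) x₀).target) (u : E) :
    mfderiv 𝓘(ℝ, E) 𝓘(ℝ, E) (extChartAt 𝓘(ℝ, E) x₀) ((extChartAt 𝓘(ℝ, E) x₀).symm y)
      (mfderiv 𝓘(ℝ, E) 𝓘(ℝ, E) (extChartAt 𝓘(ℝ, E) x₀).symm y u) = u := by
  have h := mfderiv_extChartAt_comp_mfderivWithin_extChartAt_symm (I := 𝓘(ℝ, E)) hy
  rw [ModelWithCorners.range_eq_univ, mfderivWithin_univ] at h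
  exact congr($h u)

lemma mfderiv_symm_mfderiv_chart {x : S} (hx : x ∈ (extChartAt 𝓘(ℝ, E) x₀).source)
    (u : TangentSpace 𝓘(ℝ, E) x) :
    mfderiv 𝓘(ℝ, E) 𝓘(ℝ, E) (extChartAt 𝓘(ℝ, E) x₀).symm (extChartAt 𝓘(ℝ, E) x₀ x)
      (mfderiv 𝓘(ℝ, E) 𝓘(ℝ, E) (extChartAt 𝓘(ℝ, E) x₀) x u) = u := by
  have h := mfderivWithin_extChartAt_symm_comp_mfderiv_extChartAt' (I := 𝓘(ℝ, E)) hx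
  rw [ModelWithCorners.range_eq_univ, mfderivWithin_univ] at h
  exact congr($h u)

lemma ofCoord_toCoord {z : TangentBundle 𝓘(ℝ, E) S}
    (hz : z.proj ∈ (extChartAt 𝓘(ℝ, E) x₀).source) : ofCoord x₀ (toCoord x₀ z) = z :=
  TotalSpace.ext ((extChartAt 𝓘(ℝ, E) x₀).left_inv hz)
    (heq_of_eq (mfderiv_symm_mfderiv_chart hz z.2))

lemma continuousOn_toCoord (x₀ : S) :
    ContinuousOn (toCoord x₀) (TotalSpace.proj ⁻¹' (extChartAt 𝓘(ℝ, E) x₀).source :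
      Set (TangentBundle 𝓘(ℝ, E) S)) := by
  have hopen := isOpen_extChartAt_source (I := 𝓘(ℝ, E)) x₀
  have htangent := (contMDiffOn_extChartAt_source x₀).continuousOn_tangentMapWithin (by simp)
    hopen.uniqueMDiffOn
  refine ((tangentBundleModelSpaceHomeomorph 𝓘(ℝ, E)).continuous.comp_continuousOn htangent).congr
    fun z hz => ?_
  simp only [toCoord, Function.comp_apply, tangentMapWithin, mfderivWithin_of_isOpen hopen hz]
  rfl

lemma continuousOn_ofCoord (x₀ : S) :
    ContinuousOn (ofCoord x₀ : E × E → TangentBundle 𝓘(ℝ, E) S)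
      ((extChartAt 𝓘(ℝ, E) x₀).target ×ˢ univ) := by
  have htangent := (contMDiffOn_extChartAt_symm (I := 𝓘(ℝ, E)) (n := ∞)
    x₀).continuousOn_tangentMapWithin (by simp) (isOpen_extChartAt_target x₀).uniqueMDiffOn
  exact (htangent.comp (tangentBundleModelSpaceHomeomorph 𝓘(ℝ, E)).symm.continuous.continuousOn
    fun w hw => hw.1).congr fun w hw => ofCoord_eq_tangentMapWithin hw.1

lemma contMDiffOn_ofCoord_const (x₀ : S) (u : E) :
    ContMDiffOn 𝓘(ℝ, E) 𝓘(ℝ, E).tangent ∞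
      (fun y => (ofCoord x₀ (y, u) : TangentBundle 𝓘(ℝ, E) S))
      (extChartAt 𝓘(ℝ, E) x₀).target := by
  have htangent := (contMDiffOn_extChartAt_symm (I := 𝓘(ℝ, E)) (n := ∞)
    x₀).contMDiffOn_tangentMapWithin (m := ∞) (by simp) (isOpen_extChartAt_target x₀).uniqueMDiffOn
  have hconst : ContMDiffOn 𝓘(ℝ, E) 𝓘(ℝ, E).tangent ∞
      (fun y : E => (⟨y, u⟩ : TangentBundle 𝓘(ℝ, E) E)) (extChartAt 𝓘(ℝ, E) x₀).target :=
    contMDiffOn_vectorSpace_iff_contDiffOn.2 contDiffOn_const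
  exact (htangent.comp hconst fun y hy => hy).congr fun y hy => ofCoord_eq_tangentMapWithin hy

lemma toCoord_velocity {γ : ℝ → S} {s : ℝ} (hγ : MDifferentiableAt 𝓘(ℝ, ℝ) 𝓘(ℝ, E) γ s)
    (hs : γ s ∈ (extChartAt 𝓘(ℝ, E) x₀).source) :
    toCoord x₀ (velocity E γ s) = (extChartAt 𝓘(ℝ, E) x₀ (γ s),
      deriv (fun r => extChartAt 𝓘(ℝ, E) x₀ (γ r)) s) := by
  have hchain := mfderiv_comp s (mdifferentiableAt_chart hs) hγ
  rw [mfderiv_eq_fderiv] at hchain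
  rw [← fderiv_apply_one_eq_deriv]
  exact Prod.ext rfl congr($hchain (1 : ℝ)).symm

lemma velocity_chart_symm {c : ℝ → E} {v : E} {s : ℝ} (hc : HasDerivAt c v s)
    (hs : c s ∈ (extChartAt 𝓘(ℝ, E) x₀).target) :
    velocity E (fun r => (extChartAt 𝓘(ℝ, E) x₀).symm (c r)) s = ofCoord x₀ (c s, v) :=
  velocity_comp_of_hasDerivAt (mdifferentiableAt_chart_symm hs) hc

end Coordinates

section ChartMetric

variable {E : Type*} [NormedAddCommGroup E] [NormedSpace ℝ E]
  {S : Type*} [TopologicalSpace S] [ChartedSpace E S]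
  [RiemannianBundle (fun x : S => TangentSpace 𝓘(ℝ, E) x)]

/-- The metric `chartMetric x₀` as a family of continuous bilinear forms. -/
def chartForm (x₀ : S) (y : E) : E →L[ℝ] E →L[ℝ] ℝ :=
  let D := mfderiv 𝓘(ℝ, E) 𝓘(ℝ, E) (extChartAt 𝓘(ℝ, E) x₀).symm y
  (innerSL ℝ (E := TangentSpace 𝓘(ℝ, E) ((extChartAt 𝓘(ℝ, E) x₀).symm y))).bilinearComp D D

lemma chartForm_self_eq_norm_sq (x₀ : S) (y u : E) :
    chartForm x₀ y u u = ‖(ofCoord x₀ (y, u)).2‖ ^ 2 :=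
  real_inner_self_eq_norm_sq (ofCoord x₀ (y, u)).2

variable [IsManifold 𝓘(ℝ, E) ∞ S]

lemma chartForm_self_pos {x₀ : S} {y : E} (hy : y ∈ (extChartAt 𝓘(ℝ, E) x₀).target) {u : E}
    (hu : u ≠ 0) : 0 < chartForm x₀ y u u := by
  rw [chartForm_self_eq_norm_sq, sq_pos_iff, norm_ne_zero_iff]
  intro (hzero : mfderiv 𝓘(ℝ, E) 𝓘(ℝ, E) (extChartAt 𝓘(ℝ, E) x₀).symm y u = 0)
  have hsymm := mfderiv_chart_mfderiv_symm hy u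
  rw [hzero, map_zero] at hsymm
  exact hu hsymm.symm

variable [IsContMDiffRiemannianBundle 𝓘(ℝ, E) ∞ E (fun x : S => TangentSpace 𝓘(ℝ, E) x)]

lemma contDiffOn_chartMetric (x₀ : S) (u v : E) :
    ContDiffOn ℝ ∞ (fun y => chartMetric x₀ y u v) (extChartAt 𝓘(ℝ, E) x₀).target :=
  contMDiffOn_iff_contDiffOn.1 <| ContMDiffOn.inner_bundle (contMDiffOn_ofCoord_const x₀ u)
    (contMDiffOn_ofCoord_const x₀ v)

variable [FiniteDimensional ℝ E]

/-- The metric in the chart around `x₀`, on the target of the chart. -/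
def chartLocalMetric (x₀ : S) : LocalMetric E where
  dom := (extChartAt 𝓘(ℝ, E) x₀).target
  form := chartForm x₀
  isOpen_dom := isOpen_extChartAt_target x₀
  contDiffOn_form := contDiffOn_clm_apply.2 fun u =>
    contDiffOn_clm_apply.2 fun v => contDiffOn_chartMetric x₀ u v
  symm y _ u v := real_inner_comm (ofCoord x₀ (y, v)).2 (ofCoord x₀ (y, u)).2
  pos _ hy _ hu := chartForm_self_pos hy hu

end ChartMetric

namespace LocalMetric

section Isometry

variable {E : Type*} [NormedAddCommGroup E] [NormedSpace ℝ E] {G G' : LocalMetric E}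
  {ψ : E → E} {U : Set E} {y : E}

/-- `ψ` is a smooth isometry from the metric `G` on the open set `U` into `G'`. -/
structure IsIsometryOn (G G' : LocalMetric E) (ψ : E → E) (U : Set E) : Prop where
  isOpen : IsOpen U
  subset_dom : U ⊆ G.dom
  contDiffOn : ContDiffOn ℝ ∞ ψ U
  mapsTo : MapsTo ψ U G'.dom
  form_self_eq : ∀ y ∈ U, ∀ u, G.form y u u = G'.form (ψ y) (fderiv ℝ ψ y u) (fderiv ℝ ψ y u)

lemma fderiv_form_apply (hy : y ∈ G.dom) (k u w : E) :
    fderiv ℝ (fun z => G.form z u w) y k = fderiv ℝ G.form y k u w := by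
  have hform := ((hasFDerivAt_form hy).clm_apply (hasFDerivAt_const u y)).clm_apply
    (hasFDerivAt_const w y)
  rw [hform.fderiv]
  simp

lemma IsIsometryOn.hasFDerivAt (h : G.IsIsometryOn G' ψ U) (hy : y ∈ U) :
    HasFDerivAt ψ (fderiv ℝ ψ y) y :=
  ((h.contDiffOn.contDiffAt (h.isOpen.mem_nhds hy)).differentiableAt (by simp)).hasFDerivAt

lemma IsIsometryOn.hasFDerivAt_fderiv (h : G.IsIsometryOn G' ψ U) (hy : y ∈ U) :
    HasFDerivAt (fderiv ℝ ψ) (fderiv ℝ (fderiv ℝ ψ) y) y :=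
  (((h.contDiffOn.fderiv_of_isOpen h.isOpen (m := ∞) (by simp)).contDiffAt
    (h.isOpen.mem_nhds hy)).differentiableAt (by simp)).hasFDerivAt

lemma IsIsometryOn.form_eq (h : G.IsIsometryOn G' ψ U) (hy : y ∈ U) (u w : E) :
    G.form y u w = G'.form (ψ y) (fderiv ℝ ψ y u) (fderiv ℝ ψ y w) := by
  have polar := h.form_self_eq y hy (u + w)
  simp only [map_add, add_apply] at polar
  rw [h.form_self_eq y hy u, h.form_self_eq y hy w, G.symm y (h.subset_dom hy) w u,
    G'.symm _ (h.mapsTo hy) (fderiv ℝ ψ y w) (fderiv ℝ ψ y u)] at polar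
  linarith

lemma IsIsometryOn.fderiv_form_eq (h : G.IsIsometryOn G' ψ U) (hy : y ∈ U) (k u w : E) :
    fderiv ℝ G.form y k u w
      = fderiv ℝ G'.form (ψ y) (fderiv ℝ ψ y k) (fderiv ℝ ψ y u) (fderiv ℝ ψ y w)
        + G'.form (ψ y) (fderiv ℝ (fderiv ℝ ψ) y k u) (fderiv ℝ ψ y w)
        + G'.form (ψ y) (fderiv ℝ ψ y u) (fderiv ℝ (fderiv ℝ ψ) y k w) := by
  have hDψ (u : E) := (h.hasFDerivAt_fderiv hy).clm_apply (hasFDerivAt_const u y)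
  have htarget := (((hasFDerivAt_form (h.mapsTo hy)).comp y (h.hasFDerivAt hy)).clm_apply
    (hDψ u)).clm_apply (hDψ w)
  have hagree : (fun z => G.form z u w) =ᶠ[𝓝 y]
      fun z => G'.form (ψ z) (fderiv ℝ ψ z u) (fderiv ℝ ψ z w) :=
    (h.isOpen.eventually_mem hy).mono fun z hz => h.form_eq hz u w
  rw [← fderiv_form_apply (h.subset_dom hy), (htarget.congr_of_eventuallyEq hagree).fderiv]
  simp only [add_apply, ContinuousLinearMap.comp_apply, ContinuousLinearMap.flip_apply,
    Function.comp_apply, zero_apply, map_zero, zero_add]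
  ring

lemma IsIsometryOn.lowerChristoffel_eq (h : G.IsIsometryOn G' ψ U) (hy : y ∈ U) (u w : E) :
    G.lowerChristoffel y u w = G'.lowerChristoffel (ψ y) (fderiv ℝ ψ y u) (fderiv ℝ ψ y w)
      + G'.form (ψ y) (fderiv ℝ (fderiv ℝ ψ) y u u) (fderiv ℝ ψ y w) := by
  have hsymm : fderiv ℝ (fderiv ℝ ψ) y w u = fderiv ℝ (fderiv ℝ ψ) y u w :=
    ((h.contDiffOn.contDiffAt (h.isOpen.mem_nhds hy)).isSymmSndFDerivAt
      (by rw [minSmoothness_of_isRCLikeNormedField]; exact WithTop.coe_le_coe.2 le_top)) w u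
  rw [lowerChristoffel_apply, lowerChristoffel_apply, h.fderiv_form_eq hy, h.fderiv_form_eq hy,
    hsymm, G'.symm _ (h.mapsTo hy) (fderiv ℝ (fderiv ℝ ψ) y u w)]
  ring

variable [FiniteDimensional ℝ E]

lemma IsIsometryOn.surjective_fderiv (h : G.IsIsometryOn G' ψ U) (hy : y ∈ U) :
    Function.Surjective (fderiv ℝ ψ y) := by
  suffices Function.Injective (fderiv ℝ ψ y : E →ₗ[ℝ] E) from
    LinearMap.injective_iff_surjective.1 this
  refine (injective_iff_map_eq_zero _).2 fun u (hu : fderiv ℝ ψ y u = 0) => ?_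
  by_contra hne
  have hpos := G.pos y (h.subset_dom hy) u hne
  rw [h.form_self_eq y hy, hu, map_zero] at hpos
  exact hpos.false

lemma IsSolutionOn.form_deriv_deriv_comp_isometry {c v : ℝ → E} {J : Set ℝ}
    (hc : G.IsSolutionOn c v J) (hJ : IsOpen J) (hψ : G.IsIsometryOn G' ψ U) {s : ℝ} (hs : s ∈ J)
    (hcs : c s ∈ U) (w : E) :
    G'.form (ψ (c s)) (deriv (deriv fun r => ψ (c r)) s) w
      + G'.lowerChristoffel (ψ (c s)) (deriv (fun r => ψ (c r)) s) w = 0 := by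
  have hvelocity : deriv (fun r => ψ (c r)) =ᶠ[𝓝 s] fun r => fderiv ℝ ψ (c r) (v r) := by
    filter_upwards [hJ.mem_nhds hs, (hc.deriv_pos s hs).continuousAt (hψ.isOpen.mem_nhds hcs)]
      with r hr hrU
    exact ((hψ.hasFDerivAt hrU).comp_hasDerivAt r (hc.deriv_pos r hr)).deriv
  have hacceleration : deriv (fun r => fderiv ℝ ψ (c r) (v r)) s
      = fderiv ℝ (fderiv ℝ ψ) (c s) (v s) (v s) + fderiv ℝ ψ (c s) (G.spray (c s) (v s)) :=
    (((hψ.hasFDerivAt_fderiv hcs).comp_hasDerivAt s (hc.deriv_pos s hs)).clm_apply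
      (hc.deriv_vel s hs)).deriv
  rw [hvelocity.deriv_eq, hvelocity.eq_of_nhds, hacceleration, map_add, add_apply]
  obtain ⟨w, rfl⟩ := hψ.surjective_fderiv hcs w
  have hspray := hψ.form_eq hcs (G.spray (c s) (v s)) w
  rw [form_spray (hc.mem s hs)] at hspray
  linarith [hψ.lowerChristoffel_eq hcs (v s) w]

end Isometry

end LocalMetric

section ChartGeodesicEquation

variable {E : Type*} [NormedAddCommGroup E] [NormedSpace ℝ E] [FiniteDimensional ℝ E]
  {S : Type*} [TopologicalSpace S] [ChartedSpace E S]
  [RiemannianBundle (fun x : S => TangentSpace 𝓘(ℝ, E) x)]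
  [IsManifold 𝓘(ℝ, E) ∞ S]
  [IsContMDiffRiemannianBundle 𝓘(ℝ, E) ∞ E (fun x : S => TangentSpace 𝓘(ℝ, E) x)]

lemma christoffel_eq_lowerChristoffel {x₀ : S} {y : E} (hy : y ∈ (extChartAt 𝓘(ℝ, E) x₀).target)
    (u w : E) : christoffel x₀ y u u w = (chartLocalMetric x₀).lowerChristoffel y u w := by
  have hfderiv (k a b : E) : fderiv ℝ (fun z => chartMetric x₀ z a b) y k
      = fderiv ℝ (chartLocalMetric x₀).form y k a b :=
    LocalMetric.fderiv_form_apply (G := chartLocalMetric x₀) hy k a b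
  rw [LocalMetric.lowerChristoffel_apply, christoffel, hfderiv, hfderiv]
  ring

lemma norm_sq_eq_form_toCoord {x₀ : S} {z : TangentBundle 𝓘(ℝ, E) S}
    (hz : z.proj ∈ (extChartAt 𝓘(ℝ, E) x₀).source) :
    ‖z.2‖ ^ 2 = (chartLocalMetric x₀).form (toCoord x₀ z).1 (toCoord x₀ z).2 (toCoord x₀ z).2 := by
  have h := chartForm_self_eq_norm_sq x₀ (toCoord x₀ z).1 (toCoord x₀ z).2
  rw [Prod.mk.eta, ofCoord_toCoord hz] at h
  exact h.symm

lemma isIsometryOn_chart_transition (x₀ x₁ : S) :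
    (chartLocalMetric x₀).IsIsometryOn (chartLocalMetric x₁)
      (fun y => extChartAt 𝓘(ℝ, E) x₁ ((extChartAt 𝓘(ℝ, E) x₀).symm y))
      ((extChartAt 𝓘(ℝ, E) x₀).target ∩
        (extChartAt 𝓘(ℝ, E) x₀).symm ⁻¹' (extChartAt 𝓘(ℝ, E) x₁).source) where
  isOpen := (continuousOn_extChartAt_symm x₀).isOpen_inter_preimage
    (isOpen_extChartAt_target x₀) (isOpen_extChartAt_source x₁)
  subset_dom := inter_subset_left
  contDiffOn := contMDiffOn_iff_contDiffOn.1 <| (contMDiffOn_extChartAt_source x₁).comp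
    ((contMDiffOn_extChartAt_symm x₀).mono inter_subset_left) fun _ hy => hy.2
  mapsTo _ hy := (extChartAt 𝓘(ℝ, E) x₁).map_source hy.2
  form_self_eq y hy u := by
    have hchain := mfderiv_comp y (mdifferentiableAt_chart hy.2) (mdifferentiableAt_chart_symm hy.1)
    rw [mfderiv_eq_fderiv] at hchain
    have hcoord : toCoord x₁ (ofCoord x₀ (y, u))
        = (extChartAt 𝓘(ℝ, E) x₁ ((extChartAt 𝓘(ℝ, E) x₀).symm y),
          fderiv ℝ (fun y => extChartAt 𝓘(ℝ, E) x₁ ((extChartAt 𝓘(ℝ, E) x₀).symm y)) y u) :=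
      Prod.ext rfl congr($hchain u).symm
    have hnorm := norm_sq_eq_form_toCoord (x₀ := x₁) (z := ofCoord x₀ (y, u)) hy.2
    rw [hcoord] at hnorm
    exact (chartForm_self_eq_norm_sq x₀ y u).trans hnorm

lemma LocalMetric.IsSolutionOn.isGeodesicOn {x₀ : S} {c v : ℝ → E} {J : Set ℝ}
    (h : (chartLocalMetric x₀).IsSolutionOn c v J) (hJ : IsOpen J) :
    IsGeodesicOn (E := E) (fun s => (extChartAt 𝓘(ℝ, E) x₀).symm (c s)) J := by
  have hc : ContDiffOn ℝ ∞ c J := contDiff_fst.comp_contDiffOn (h.contDiffOn hJ)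
  refine ⟨(contMDiffOn_extChartAt_symm x₀).comp (contMDiffOn_iff_contDiffOn.2 hc) h.mem,
    fun x₁ s hs hsource w => ?_⟩
  rw [christoffel_eq_lowerChristoffel ((extChartAt 𝓘(ℝ, E) x₁).map_source hsource)]
  exact h.form_deriv_deriv_comp_isometry hJ (isIsometryOn_chart_transition x₀ x₁) hs
    ⟨h.mem s hs, hsource⟩ w

end ChartGeodesicEquation

section GeodesicLocality

variable {E : Type*} [NormedAddCommGroup E] [NormedSpace ℝ E]
  {S : Type*} [TopologicalSpace S] [ChartedSpace E S]
  [RiemannianBundle (fun x : S => TangentSpace 𝓘(ℝ, E) x)] {γ : ℝ → S} {J : Set ℝ}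

lemma IsGeodesicOn.mono {J' : Set ℝ} (h : IsGeodesicOn (E := E) γ J) (hJ : J' ⊆ J) :
    IsGeodesicOn (E := E) γ J' :=
  ⟨h.1.mono hJ, fun x₀ s hs => h.2 x₀ s (hJ hs)⟩

lemma isGeodesicOn_of_forall_eventuallyEq
    (h : ∀ s ∈ J, ∃ (γ' : ℝ → S) (U : Set ℝ), IsOpen U ∧ s ∈ U ∧ IsGeodesicOn (E := E) γ' U ∧
      γ =ᶠ[𝓝 s] γ') : IsGeodesicOn (E := E) γ J := by
  constructor
  · intro s hs
    obtain ⟨γ', U, hU, hsU, hγ', heq⟩ := h s hs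
    exact ((hγ'.1.contMDiffAt (hU.mem_nhds hsU)).congr_of_eventuallyEq heq).contMDiffWithinAt
  · intro x₀ s hs hsource w
    obtain ⟨γ', U, -, hsU, hγ', heq⟩ := h s hs
    have hcoord : (fun r => extChartAt 𝓘(ℝ, E) x₀ (γ r)) =ᶠ[𝓝 s]
        fun r => extChartAt 𝓘(ℝ, E) x₀ (γ' r) := heq.fun_comp _
    rw [hcoord.deriv.deriv_eq, hcoord.deriv_eq, heq.eq_of_nhds]
    exact hγ'.2 x₀ s hsU (heq.eq_of_nhds ▸ hsource) w

lemma IsGeodesicOn.mdifferentiableAt (h : IsGeodesicOn (E := E) γ J) (hJ : IsOpen J) {s : ℝ}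
    (hs : s ∈ J) : MDifferentiableAt 𝓘(ℝ, ℝ) 𝓘(ℝ, E) γ s :=
  (h.1.contMDiffAt (hJ.mem_nhds hs)).mdifferentiableAt (by simp)

lemma IsGeodesicOn.isOpen_inter_source (h : IsGeodesicOn (E := E) γ J) (hJ : IsOpen J) (x₀ : S) :
    IsOpen (J ∩ γ ⁻¹' (extChartAt 𝓘(ℝ, E) x₀).source) :=
  h.1.continuousOn.isOpen_inter_preimage hJ (isOpen_extChartAt_source x₀)

end GeodesicLocality

section Geodesic

variable {E : Type*} [NormedAddCommGroup E] [NormedSpace ℝ E] [FiniteDimensional ℝ E]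
  {S : Type*} [TopologicalSpace S] [ChartedSpace E S]
  [RiemannianBundle (fun x : S => TangentSpace 𝓘(ℝ, E) x)]
  [IsManifold 𝓘(ℝ, E) ∞ S]
  [IsContMDiffRiemannianBundle 𝓘(ℝ, E) ∞ E (fun x : S => TangentSpace 𝓘(ℝ, E) x)]
  {γ γ₁ γ₂ : ℝ → S} {J : Set ℝ}

lemma IsGeodesicOn.isSolutionOn (h : IsGeodesicOn (E := E) γ J) (hJ : IsOpen J) (x₀ : S) :
    (chartLocalMetric x₀).IsSolutionOn (fun s => (toCoord x₀ (velocity E γ s)).1)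
      (fun s => (toCoord x₀ (velocity E γ s)).2) (J ∩ γ ⁻¹' (extChartAt 𝓘(ℝ, E) x₀).source) := by
  have hJ' := h.isOpen_inter_source hJ x₀
  set J' := J ∩ γ ⁻¹' (extChartAt 𝓘(ℝ, E) x₀).source
  set c : ℝ → E := fun r => extChartAt 𝓘(ℝ, E) x₀ (γ r)
  have hmem (r) (hr : r ∈ J') : c r ∈ (chartLocalMetric x₀).dom :=
    (extChartAt 𝓘(ℝ, E) x₀).map_source hr.2
  have hsmooth : ContDiffOn ℝ ∞ c J' := contMDiffOn_iff_contDiffOn.1 <|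
    (contMDiffOn_extChartAt_source x₀).comp (h.1.mono inter_subset_left) fun r hr => hr.2
  have hasDerivAt (f : ℝ → E) (hf : ContDiffOn ℝ ∞ f J') (r) (hr : r ∈ J') :
      HasDerivAt f (deriv f r) r :=
    ((hf.contDiffAt (hJ'.mem_nhds hr)).differentiableAt (by simp)).hasDerivAt
  have hsolution : (chartLocalMetric x₀).IsSolutionOn c (deriv c) J' := by
    refine ⟨hmem, hasDerivAt c hsmooth, fun s hs => ?_⟩
    refine (hasDerivAt _ (hsmooth.deriv_of_isOpen hJ' (by simp)) s hs).congr_deriv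
      (LocalMetric.eq_spray (hmem s hs) fun w => ?_)
    rw [← christoffel_eq_lowerChristoffel (hmem s hs)]
    exact h.2 x₀ s hs.1 hs.2 w
  exact hsolution.congr hJ' fun s hs => toCoord_velocity (h.mdifferentiableAt hJ hs.1) hs.2

lemma IsGeodesicOn.comp_mul_add (h : IsGeodesicOn (E := E) γ J) (hJ : IsOpen J) (a b : ℝ) :
    IsGeodesicOn (E := E) (fun s => γ (a * s + b)) ((fun s => a * s + b) ⁻¹' J) := by
  refine isGeodesicOn_of_forall_eventuallyEq fun s hs => ?_
  set x₀ := γ (a * s + b)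
  have hsolution := ((h.isSolutionOn hJ x₀).comp_add b).comp_mul a
  have hs' : a * s + b ∈ J ∩ γ ⁻¹' (extChartAt 𝓘(ℝ, E) x₀).source :=
    ⟨hs, mem_extChartAt_source x₀⟩
  have hopen := (h.isOpen_inter_source hJ x₀).preimage (f := fun s : ℝ => a * s + b) (by fun_prop)
  refine ⟨_, _, hopen, hs', hsolution.isGeodesicOn hopen, ?_⟩
  filter_upwards [hopen.mem_nhds hs'] with r hr
  exact ((extChartAt 𝓘(ℝ, E) x₀).left_inv hr.2).symm

lemma IsGeodesicOn.continuousAt_toCoord (h : IsGeodesicOn (E := E) γ J) (hJ : IsOpen J) {s : ℝ}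
    (hs : s ∈ J) {x₀ : S} (hx₀ : γ s ∈ (extChartAt 𝓘(ℝ, E) x₀).source) :
    ContinuousAt (fun r => toCoord x₀ (velocity E γ r)) s :=
  ((h.isSolutionOn hJ x₀).hasDerivAt ⟨hs, hx₀⟩).continuousAt

lemma IsGeodesicOn.continuousOn_velocity (h : IsGeodesicOn (E := E) γ J) (hJ : IsOpen J) :
    ContinuousOn (velocity E γ) J := by
  intro s hs
  have hsource := mem_extChartAt_source (I := 𝓘(ℝ, E)) (γ s)
  have hcoord : velocity E γ =ᶠ[𝓝 s] fun r => ofCoord (γ s) (toCoord (γ s) (velocity E γ r)) := by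
    filter_upwards [(h.isOpen_inter_source hJ (γ s)).mem_nhds ⟨hs, hsource⟩] with r hr
    exact (ofCoord_toCoord (z := velocity E γ r) hr.2).symm
  have hofCoord := (continuousOn_ofCoord (γ s)).continuousAt (x := toCoord (γ s) (velocity E γ s))
    (prod_mem_nhds ((isOpen_extChartAt_target (I := 𝓘(ℝ, E)) (γ s)).mem_nhds
      ((extChartAt 𝓘(ℝ, E) _).map_source hsource)) Filter.univ_mem)
  exact ((hofCoord.comp_of_eq (h.continuousAt_toCoord hJ hs hsource) rfl).congr
    hcoord.symm).continuousWithinAt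

lemma IsGeodesicOn.eventuallyEq (h₁ : IsGeodesicOn (E := E) γ₁ J)
    (h₂ : IsGeodesicOn (E := E) γ₂ J) (hJ : IsOpen J) {s : ℝ} (hs : s ∈ J)
    (hv : velocity E γ₁ s = velocity E γ₂ s) : γ₁ =ᶠ[𝓝 s] γ₂ := by
  have hsource₁ := mem_extChartAt_source (I := 𝓘(ℝ, E)) (γ₁ s)
  have hsource₂ : γ₂ s ∈ (extChartAt 𝓘(ℝ, E) (γ₁ s)).source :=
    (show γ₁ s = γ₂ s from congrArg TotalSpace.proj hv) ▸ hsource₁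
  have hU := Filter.inter_mem ((h₁.isOpen_inter_source hJ _).mem_nhds ⟨hs, hsource₁⟩)
    ((h₂.isOpen_inter_source hJ _).mem_nhds ⟨hs, hsource₂⟩)
  have hcoord := LocalMetric.IsSolutionOn.eventuallyEq hU
    ((h₁.isSolutionOn hJ (γ₁ s)).mono inter_subset_left)
    ((h₂.isSolutionOn hJ (γ₁ s)).mono inter_subset_right) (by rw [hv]) (by rw [hv])
  filter_upwards [hcoord, hU] with r hr hrU
  exact (extChartAt 𝓘(ℝ, E) (γ₁ s)).injOn hrU.1.2 hrU.2.2 congr(($hr).1)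

lemma IsGeodesicOn.eventuallyEq_of_frequently [T2Space S] (h₁ : IsGeodesicOn (E := E) γ₁ J)
    (h₂ : IsGeodesicOn (E := E) γ₂ J) (hJ : IsOpen J) {s : ℝ} (hs : s ∈ J)
    (h : ∃ᶠ r in 𝓝 s, γ₁ =ᶠ[𝓝 r] γ₂) : γ₁ =ᶠ[𝓝 s] γ₂ := by
  have hγ : γ₁ s = γ₂ s := tendsto_nhds_unique_of_frequently_eq
    (h₁.1.continuousOn.continuousAt (hJ.mem_nhds hs))
    (h₂.1.continuousOn.continuousAt (hJ.mem_nhds hs)) (h.mono fun _ hr => hr.eq_of_nhds)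
  have hsource₁ := mem_extChartAt_source (I := 𝓘(ℝ, E)) (γ₁ s)
  have hsource₂ : γ₂ s ∈ (extChartAt 𝓘(ℝ, E) (γ₁ s)).source := hγ ▸ hsource₁
  have hcoord : toCoord (γ₁ s) (velocity E γ₁ s) = toCoord (γ₁ s) (velocity E γ₂ s) :=
    tendsto_nhds_unique_of_frequently_eq (h₁.continuousAt_toCoord hJ hs hsource₁)
      (h₂.continuousAt_toCoord hJ hs hsource₂) (h.mono fun _ hr => by rw [velocity_congr hr])
  refine h₁.eventuallyEq h₂ hJ hs ?_
  rw [← ofCoord_toCoord (z := velocity E γ₁ s) hsource₁, hcoord,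
    ofCoord_toCoord (z := velocity E γ₂ s) hsource₂]

lemma IsGeodesicOn.eqOn_velocity [T2Space S] (h₁ : IsGeodesicOn (E := E) γ₁ J)
    (h₂ : IsGeodesicOn (E := E) γ₂ J) (hJ : IsOpen J) (hJc : J.OrdConnected) {s : ℝ} (hs : s ∈ J)
    (hv : velocity E γ₁ s = velocity E γ₂ s) : EqOn (velocity E γ₁) (velocity E γ₂) J := by
  have hsubset : J ⊆ {r | γ₁ =ᶠ[𝓝 r] γ₂} := by
    refine hJc.isPreconnected.subset_of_closure_inter_subset
      (isOpen_iff_mem_nhds.2 fun r hr => hr.eventuallyEq_nhds)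
      ⟨s, hs, h₁.eventuallyEq h₂ hJ hs hv⟩ ?_
    rintro r ⟨hr, hrJ⟩
    exact h₁.eventuallyEq_of_frequently h₂ hJ hrJ (mem_closure_iff_frequently.1 hr)
  exact fun r hr => velocity_congr (hsubset hr)

lemma IsGeodesicOn.norm_velocity_eq (h : IsGeodesicOn (E := E) γ J) (hJ : IsOpen J)
    (hJc : J.OrdConnected) {s r : ℝ} (hs : s ∈ J) (hr : r ∈ J) :
    ‖(velocity E γ s).2‖ = ‖(velocity E γ r).2‖ := by
  have hderiv (q : ℝ) (hq : q ∈ J) : HasDerivAt (fun q => ‖(velocity E γ q).2‖ ^ 2) 0 q := by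
    have hq' : q ∈ J ∩ γ ⁻¹' (extChartAt 𝓘(ℝ, E) (γ q)).source := ⟨hq, mem_extChartAt_source _⟩
    refine ((h.isSolutionOn hJ (γ q)).hasDerivAt_energy hq').congr_of_eventuallyEq ?_
    filter_upwards [(h.isOpen_inter_source hJ (γ q)).mem_nhds hq'] with q' hq'
    exact norm_sq_eq_form_toCoord hq'.2
  have hsq := hJ.is_const_of_deriv_eq_zero hJc.isPreconnected
    (fun q hq => (hderiv q hq).differentiableAt.differentiableWithinAt)
    (fun q hq => (hderiv q hq).deriv) hs hr
  exact (sq_eq_sq₀ (norm_nonneg _) (norm_nonneg _)).1 hsq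

lemma expMap_eq [T2Space S] {p : S} {v : TangentSpace 𝓘(ℝ, E) p} (h : IsGeodesicFrom p v γ) :
    expMap p v = γ 1 := by
  have hex : ∃ γ : ℝ → S, IsGeodesicFrom p v γ := ⟨γ, h⟩
  rw [expMap, dif_pos hex]
  obtain ⟨J₁, hJ₁, hJc₁, zero_mem₁, one_mem₁, hγ₁, hv₁⟩ := hex.choose_spec
  obtain ⟨J₂, hJ₂, hJc₂, zero_mem₂, one_mem₂, hγ₂, hv₂⟩ := h
  exact congrArg TotalSpace.proj <| (hγ₁.mono inter_subset_left).eqOn_velocity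
    (hγ₂.mono inter_subset_right) (hJ₁.inter hJ₂) (hJc₁.inter hJc₂) ⟨zero_mem₁, zero_mem₂⟩
    (hv₁.trans hv₂.symm) ⟨one_mem₁, one_mem₂⟩

end Geodesic

section Flow

variable {E : Type*} [NormedAddCommGroup E] [NormedSpace ℝ E]
  {S : Type*} [TopologicalSpace S] [ChartedSpace E S]
  [RiemannianBundle (fun x : S => TangentSpace 𝓘(ℝ, E) x)]

/-- `γ` is a geodesic with initial velocity `z`, defined on the open interval `J ∋ 0`. -/
structure IsGeodesicWith (z : TangentBundle 𝓘(ℝ, E) S) (γ : ℝ → S) (J : Set ℝ) : Prop where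
  isOpen : IsOpen J
  ordConnected : J.OrdConnected
  zero_mem : 0 ∈ J
  isGeodesicOn : IsGeodesicOn (E := E) γ J
  velocity_zero : velocity E γ 0 = z

variable {z : TangentBundle 𝓘(ℝ, E) S} {γ : ℝ → S} {J : Set ℝ}

lemma isGeodesicFrom_iff {p : S} {v : TangentSpace 𝓘(ℝ, E) p} :
    IsGeodesicFrom p v γ ↔ ∃ J, IsGeodesicWith ⟨p, v⟩ γ J ∧ 1 ∈ J :=
  ⟨fun ⟨J, isOpen, ordConnected, zero_mem, one_mem, isGeodesicOn, velocity_zero⟩ =>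
      ⟨J, ⟨isOpen, ordConnected, zero_mem, isGeodesicOn, velocity_zero⟩, one_mem⟩,
    fun ⟨J, h, one_mem⟩ => ⟨J, h.isOpen, h.ordConnected, h.zero_mem, one_mem, h.isGeodesicOn,
      h.velocity_zero⟩⟩

lemma IsGeodesicWith.mono {J' : Set ℝ} (h : IsGeodesicWith z γ J) (hJ' : IsOpen J')
    (hJ'c : J'.OrdConnected) (h0 : 0 ∈ J') (hsubset : J' ⊆ J) : IsGeodesicWith z γ J' :=
  ⟨hJ', hJ'c, h0, h.isGeodesicOn.mono hsubset, h.velocity_zero⟩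

lemma IsGeodesicWith.apply_zero (h : IsGeodesicWith z γ J) : γ 0 = z.proj :=
  congrArg TotalSpace.proj h.velocity_zero

variable [IsManifold 𝓘(ℝ, E) ∞ S]

/-- The geodesics with initial velocity near `z₀` exist up to time `s`, and their velocity at
time `s` tends to `w₀` as the initial velocity tends to `z₀`. -/
def GeodesicFlowTendsto (z₀ w₀ : TangentBundle 𝓘(ℝ, E) S) (s : ℝ) : Prop :=
  ∀ N ∈ 𝓝 w₀, ∀ᶠ z in 𝓝 z₀, ∃ γ J, IsGeodesicWith z γ J ∧ s ∈ J ∧ velocity E γ s ∈ N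

variable
  [IsContMDiffRiemannianBundle 𝓘(ℝ, E) ∞ E (fun x : S => TangentSpace 𝓘(ℝ, E) x)]

variable (E S) in
lemma isContinuousRiemannianBundle :
    IsContinuousRiemannianBundle E (fun x : S => TangentSpace 𝓘(ℝ, E) x) := by
  obtain ⟨g, hg, h⟩ := IsContMDiffRiemannianBundle.exists_contMDiff (IB := 𝓘(ℝ, E)) (n := ∞)
    (F := E) (E := fun x : S => TangentSpace 𝓘(ℝ, E) x)
  exact ⟨g, hg.continuous, h⟩

lemma continuous_norm_tangent : Continuous fun z : TangentBundle 𝓘(ℝ, E) S => ‖z.2‖ := by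
  have := isContinuousRiemannianBundle E S
  have hinner : Continuous fun z : TangentBundle 𝓘(ℝ, E) S => inner ℝ z.2 z.2 :=
    Continuous.inner_bundle (F := E) (b := TotalSpace.proj) (v := fun z => z.2)
      (w := fun z => z.2) continuous_id continuous_id
  simpa only [norm_eq_sqrt_real_inner] using hinner.sqrt

variable [FiniteDimensional ℝ E]

lemma IsGeodesicWith.norm_velocity (h : IsGeodesicWith z γ J) {s : ℝ} (hs : s ∈ J) :
    ‖(velocity E γ s).2‖ = ‖z.2‖ := by
  rw [h.isGeodesicOn.norm_velocity_eq h.isOpen h.ordConnected hs h.zero_mem, h.velocity_zero]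

lemma exists_flow_box (z₀ : TangentBundle 𝓘(ℝ, E) S) :
    ∃ U ∈ 𝓝 z₀, ∃ δ > (0 : ℝ), ∃ Γ : TangentBundle 𝓘(ℝ, E) S → ℝ → S,
      (∀ z ∈ U, IsGeodesicWith z (Γ z) (Ioo (-δ) δ)) ∧
      ContinuousOn (fun q : TangentBundle 𝓘(ℝ, E) S × ℝ => velocity E (Γ q.1) q.2)
        (U ×ˢ Ioo (-δ) δ) := by
  set x₀ := z₀.proj
  set φ := extChartAt 𝓘(ℝ, E) x₀
  have hsource : x₀ ∈ φ.source := mem_extChartAt_source x₀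
  obtain ⟨r, hr, ε, hε, α, hα, hα_cont⟩ := LocalMetric.exists_flow (G := chartLocalMetric x₀)
    (z₀ := toCoord x₀ z₀) (φ.map_source hsource) Filter.univ_mem
  have hsource_nhds : TotalSpace.proj ⁻¹' φ.source ∈ 𝓝 z₀ :=
    ((isOpen_extChartAt_source x₀).preimage (FiberBundle.continuous_proj E _)).mem_nhds hsource
  set U := TotalSpace.proj ⁻¹' φ.source ∩ toCoord x₀ ⁻¹' Metric.closedBall (toCoord x₀ z₀) r
  have hvelocity (z) (hz : z ∈ U) (s) (hs : s ∈ Ioo (-ε) ε) :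
      velocity E (fun s => φ.symm (α (toCoord x₀ z, s)).1) s = ofCoord x₀ (α (toCoord x₀ z, s)) :=
    velocity_chart_symm ((hα _ hz.2).2.2.deriv_pos s hs) ((hα _ hz.2).2.2.mem s hs)
  have zero_mem : (0 : ℝ) ∈ Ioo (-ε) ε := ⟨neg_lt_zero.2 hε, hε⟩
  have hU : U ∈ 𝓝 z₀ := Filter.inter_mem hsource_nhds
    (((continuousOn_toCoord x₀).continuousAt hsource_nhds) (Metric.closedBall_mem_nhds _ hr))
  refine ⟨U, hU, ε, hε, fun z s => φ.symm (α (toCoord x₀ z, s)).1, fun z hz =>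
    ⟨isOpen_Ioo, ordConnected_Ioo, zero_mem, (hα _ hz.2).2.2.isGeodesicOn isOpen_Ioo, ?_⟩, ?_⟩
  · rw [hvelocity z hz 0 zero_mem, (hα _ hz.2).1, ofCoord_toCoord hz.1]
  · have htoCoord : ContinuousOn (fun q : TangentBundle 𝓘(ℝ, E) S × ℝ => (toCoord x₀ q.1, q.2))
        (U ×ˢ Ioo (-ε) ε) :=
      (((continuousOn_toCoord x₀).mono inter_subset_left).comp continuousOn_fst
        fun q hq => hq.1).prodMk continuousOn_snd
    exact ((continuousOn_ofCoord x₀).comp (hα_cont.comp htoCoord fun q hq => ⟨hq.1.2, hq.2⟩)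
      fun q hq => ⟨(hα _ hq.1.2).2.2.mem _ hq.2, trivial⟩).congr
      fun q hq => hvelocity q.1 hq.1 q.2 hq.2

lemma exists_uniform_time {Z : Set (TangentBundle 𝓘(ℝ, E) S)} (hZ : IsCompact Z) :
    ∃ δ > (0 : ℝ), ∀ z ∈ Z, ∃ γ, IsGeodesicWith z γ (Ioo (-δ) δ) := by
  have hanti {ε δ : ℝ} {z : TangentBundle 𝓘(ℝ, E) S} (hε : 0 < ε) (hεδ : ε ≤ δ) :
      (∃ γ, IsGeodesicWith z γ (Ioo (-δ) δ)) → ∃ γ, IsGeodesicWith z γ (Ioo (-ε) ε) :=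
    fun ⟨γ, hγ⟩ => ⟨γ, hγ.mono isOpen_Ioo ordConnected_Ioo ⟨neg_lt_zero.2 hε, hε⟩
      (Ioo_subset_Ioo (neg_le_neg hεδ) hεδ)⟩
  refine hZ.induction_on (p := fun A => ∃ δ > (0 : ℝ), ∀ z ∈ A, ∃ γ, IsGeodesicWith z γ
    (Ioo (-δ) δ)) ⟨1, one_pos, fun z hz => hz.elim⟩ ?mono ?union ?nhds
  case mono =>
    rintro A B hAB ⟨δ, hδ, h⟩
    exact ⟨δ, hδ, fun z hz => h z (hAB hz)⟩
  case union =>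
    rintro A B ⟨δ, hδ, hA⟩ ⟨δ', hδ', hB⟩
    have hmin : 0 < min δ δ' := lt_min hδ hδ'
    exact ⟨min δ δ', hmin, fun z hz => hz.elim (fun hz => hanti hmin (min_le_left _ _) (hA z hz))
      fun hz => hanti hmin (min_le_right _ _) (hB z hz)⟩
  case nhds =>
    intro z₀ _
    obtain ⟨U, hU, δ, hδ, Γ, hΓ, -⟩ := exists_flow_box z₀
    exact ⟨U, mem_nhdsWithin_of_mem_nhds hU, δ, hδ, fun z hz => ⟨_, hΓ z hz⟩⟩

lemma exists_compact_ball_bundle (x₀ : S) (R : ℝ) :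
    ∃ N ∈ 𝓝 x₀, ∃ C : Set (TangentBundle 𝓘(ℝ, E) S), IsCompact C ∧
      ∀ z : TangentBundle 𝓘(ℝ, E) S, z.proj ∈ N → ‖z.2‖ ≤ R → z ∈ C := by
  set φ := extChartAt 𝓘(ℝ, E) x₀
  have hdom : φ x₀ ∈ (chartLocalMetric (E := E) x₀).dom :=
    φ.map_source (mem_extChartAt_source x₀)
  obtain ⟨l, hl, hcoercive⟩ := exists_eventually_coercive
    (LocalMetric.contDiffAt_form hdom).continuousAt
    (isCoercive_of_pos ((chartLocalMetric x₀).pos _ hdom))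
  obtain ⟨a, ha, hball⟩ := Metric.nhds_basis_closedBall.mem_iff.1
    (Filter.inter_mem ((chartLocalMetric x₀).isOpen_dom.mem_nhds hdom) hcoercive)
  refine ⟨φ.source ∩ φ ⁻¹' Metric.closedBall (φ x₀) a,
    Filter.inter_mem (extChartAt_source_mem_nhds x₀)
      ((continuousAt_extChartAt x₀) (Metric.closedBall_mem_nhds _ ha)),
    ofCoord x₀ '' (Metric.closedBall (φ x₀) a ×ˢ Metric.closedBall 0 (|R| / √l)),
    ((isCompact_closedBall _ _).prod (isCompact_closedBall _ _)).image_of_continuousOn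
      ((continuousOn_ofCoord x₀).mono (prod_mono (hball.trans inter_subset_left) (subset_univ _))),
    fun z hz hzR => ⟨toCoord x₀ z, ⟨hz.2, ?_⟩, ofCoord_toCoord hz.1⟩⟩
  have hnorm : l * ‖(toCoord x₀ z).2‖ ^ 2 ≤ R ^ 2 := calc
    l * ‖(toCoord x₀ z).2‖ ^ 2 ≤ ‖z.2‖ ^ 2 :=
      ((hball hz.2).2 _).trans_eq (norm_sq_eq_form_toCoord hz.1).symm
    _ ≤ R ^ 2 := by gcongr
  rw [mem_closedBall_zero_iff, le_div_iff₀ (by positivity)]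
  refine (abs_le_of_sq_le_sq' ?_ (abs_nonneg R)).2
  rwa [mul_pow, Real.sq_sqrt hl.le, sq_abs, mul_comm]

lemma IsGeodesicOn.comp_add (h : IsGeodesicOn (E := E) γ J) (hJ : IsOpen J) (b : ℝ) :
    IsGeodesicOn (E := E) (fun s => γ (s + b)) ((· + b) ⁻¹' J) := by
  simpa only [one_mul] using h.comp_mul_add hJ 1 b

lemma IsGeodesicWith.comp_add (h : IsGeodesicWith z γ J) {s : ℝ} (hs : s ∈ J) :
    IsGeodesicWith (velocity E γ s) (fun r => γ (r + s)) ((· + s) ⁻¹' J) where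
  isOpen := h.isOpen.preimage (by fun_prop)
  ordConnected := h.ordConnected.preimage_mono fun _ _ h => by gcongr
  zero_mem := by simpa using hs
  isGeodesicOn := h.isGeodesicOn.comp_add h.isOpen s
  velocity_zero := by
    have hderiv := h.isGeodesicOn.mdifferentiableAt h.isOpen (s := 0 + s) (by rwa [zero_add])
    rw [velocity_comp_add hderiv, zero_add]

lemma IsGeodesicWith.comp_mul (h : IsGeodesicWith z γ J) {a : ℝ} (ha : 0 ≤ a) :
    IsGeodesicWith ⟨z.proj, a • z.2⟩ (fun s => γ (a * s)) ((a * ·) ⁻¹' J) where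
  isOpen := h.isOpen.preimage (by fun_prop)
  ordConnected := h.ordConnected.preimage_mono fun _ _ h => mul_le_mul_of_nonneg_left h ha
  zero_mem := by simpa using h.zero_mem
  isGeodesicOn := by simpa only [add_zero] using h.isGeodesicOn.comp_mul_add h.isOpen a 0
  velocity_zero := by
    obtain rfl := h.velocity_zero
    have hderiv := h.isGeodesicOn.mdifferentiableAt h.isOpen (s := a * 0 + 0)
      (by simpa using h.zero_mem)
    have hvelocity := velocity_comp_mul_add hderiv
    simp only [add_zero] at hvelocity
    exact hvelocity.trans (congrArg
      (fun u => (⟨γ u, a • (velocity E γ u).2⟩ : TangentBundle 𝓘(ℝ, E) S)) (by simp))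

variable [T2Space S]

lemma IsGeodesicWith.eqOn_velocity {γ' : ℝ → S} {J' : Set ℝ} (h : IsGeodesicWith z γ J)
    (h' : IsGeodesicWith z γ' J') : EqOn (velocity E γ) (velocity E γ') (J ∩ J') :=
  (h.isGeodesicOn.mono inter_subset_left).eqOn_velocity (h'.isGeodesicOn.mono inter_subset_right)
    (h.isOpen.inter h'.isOpen) (h.ordConnected.inter h'.ordConnected) ⟨h.zero_mem, h'.zero_mem⟩
    (h.velocity_zero.trans h'.velocity_zero.symm)

lemma isCompact_ball_bundle {K : Set S} (hK : IsCompact K) (R : ℝ) :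
    IsCompact {z : TangentBundle 𝓘(ℝ, E) S | z.proj ∈ K ∧ ‖z.2‖ ≤ R} := by
  obtain ⟨C, hC, hsubset⟩ : ∃ C : Set (TangentBundle 𝓘(ℝ, E) S), IsCompact C ∧
      ∀ z : TangentBundle 𝓘(ℝ, E) S, z.proj ∈ K → ‖z.2‖ ≤ R → z ∈ C := by
    refine hK.induction_on (p := fun A => ∃ C : Set (TangentBundle 𝓘(ℝ, E) S), IsCompact C ∧
      ∀ z : TangentBundle 𝓘(ℝ, E) S, z.proj ∈ A → ‖z.2‖ ≤ R → z ∈ C)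
      ⟨∅, isCompact_empty, fun z hz => hz.elim⟩ ?mono ?union ?nhds
    case mono =>
      rintro A B hAB ⟨C, hC, h⟩
      exact ⟨C, hC, fun z hz => h z (hAB hz)⟩
    case union =>
      rintro A B ⟨C, hC, hA⟩ ⟨C', hC', hB⟩
      exact ⟨C ∪ C', hC.union hC', fun z hz hR => hz.imp (hA z · hR) (hB z · hR)⟩
    case nhds =>
      intro x _
      obtain ⟨N, hN, h⟩ := exists_compact_ball_bundle (E := E) x R
      exact ⟨N, mem_nhdsWithin_of_mem_nhds hN, h⟩
  exact hC.of_isClosed_subset ((hK.isClosed.preimage (FiberBundle.continuous_proj E _)).inter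
    (isClosed_le continuous_norm_tangent continuous_const)) fun z hz => hsubset z hz.1 hz.2

lemma IsGeodesicOn.glue {γ₁ γ₂ : ℝ → S} {J₁ J₂ : Set ℝ} (h₁ : IsGeodesicOn (E := E) γ₁ J₁)
    (h₂ : IsGeodesicOn (E := E) γ₂ J₂) (hJ₁ : IsOpen J₁) (hJ₂ : IsOpen J₂)
    (hc₁ : J₁.OrdConnected) (hc₂ : J₂.OrdConnected) {s : ℝ} (hs₁ : s ∈ J₁) (hs₂ : s ∈ J₂)
    (hv : velocity E γ₁ s = velocity E γ₂ s) :
    ∃ γ : ℝ → S, IsGeodesicOn (E := E) γ (J₁ ∪ J₂) ∧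
      EqOn (velocity E γ) (velocity E γ₁) J₁ ∧ EqOn (velocity E γ) (velocity E γ₂) J₂ := by
  classical
  have heqOn := (h₁.mono inter_subset_left).eqOn_velocity (h₂.mono inter_subset_right)
    (hJ₁.inter hJ₂) (hc₁.inter hc₂) ⟨hs₁, hs₂⟩ hv
  set γ := J₁.piecewise γ₁ γ₂
  have hγ₁ (r) (hr : r ∈ J₁) : γ =ᶠ[𝓝 r] γ₁ :=
    (J₁.piecewise_eqOn γ₁ γ₂).eventuallyEq_of_mem (hJ₁.mem_nhds hr)
  have hγ₂ (r) (hr : r ∈ J₂) : γ =ᶠ[𝓝 r] γ₂ := by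
    filter_upwards [hJ₂.mem_nhds hr] with q hq
    by_cases hq₁ : q ∈ J₁
    · exact (J₁.piecewise_eq_of_mem γ₁ γ₂ hq₁).trans (congrArg TotalSpace.proj (heqOn ⟨hq₁, hq⟩))
    · exact J₁.piecewise_eq_of_notMem γ₁ γ₂ hq₁
  refine ⟨γ, isGeodesicOn_of_forall_eventuallyEq ?_, fun r hr => velocity_congr (hγ₁ r hr),
    fun r hr => velocity_congr (hγ₂ r hr)⟩
  rintro r (hr | hr)
  · exact ⟨γ₁, J₁, hJ₁, hr, h₁, hγ₁ r hr⟩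
  · exact ⟨γ₂, J₂, hJ₂, hr, h₂, hγ₂ r hr⟩

lemma IsGeodesicWith.extend {γ' : ℝ → S} {J' : Set ℝ} {s : ℝ} (h : IsGeodesicWith z γ J)
    (hs : s ∈ J) (h' : IsGeodesicWith (velocity E γ s) γ' J') :
    ∃ η, IsGeodesicWith z η (J ∪ (· + -s) ⁻¹' J') ∧ EqOn (velocity E η) (velocity E γ) J ∧
      ∀ r, r + -s ∈ J' → velocity E η r = velocity E γ' (r + -s) := by
  have hopen : IsOpen ((· + -s) ⁻¹' J') := h'.isOpen.preimage (by fun_prop)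
  have hconn : ((· + -s) ⁻¹' J').OrdConnected :=
    h'.ordConnected.preimage_mono fun _ _ h => by gcongr
  have hmem : s ∈ (· + -s) ⁻¹' J' := by simpa using h'.zero_mem
  have hvelocity (r) (hr : r + -s ∈ J') :=
    velocity_comp_add (h'.isGeodesicOn.mdifferentiableAt h'.isOpen hr)
  obtain ⟨η, hη, hηγ, hηγ'⟩ := h.isGeodesicOn.glue (h'.isGeodesicOn.comp_add h'.isOpen (-s))
    h.isOpen hopen h.ordConnected hconn hs hmem
    (by rw [hvelocity s hmem, add_neg_cancel, h'.velocity_zero])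
  refine ⟨η, ⟨h.isOpen.union hopen, ?_, .inl h.zero_mem, hη,
    (hηγ h.zero_mem).trans h.velocity_zero⟩, hηγ, fun r hr => (hηγ' hr).trans (hvelocity r hr)⟩
  exact (IsPreconnected.union s hs hmem h.ordConnected.isPreconnected
    hconn.isPreconnected).ordConnected

lemma mem_expDomain_of_forall_extend {p : S} {v : TangentSpace 𝓘(ℝ, E) p} {δ : ℝ} (hδ : 0 < δ)
    (h : ∀ γ J, IsGeodesicWith ⟨p, v⟩ γ J → ∀ s ∈ J, 0 ≤ s → s ≤ 1 →
      ∃ γ', IsGeodesicWith (velocity E γ s) γ' (Ioo (-δ) δ)) : v ∈ expDomain p := by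
  have hexists (n : ℕ) : ∃ γ J, IsGeodesicWith ⟨p, v⟩ γ J ∧ min (n * (δ / 2)) 1 ∈ J := by
    induction n with
    | zero =>
      obtain ⟨U, hU, ε, -, Γ, hΓ, -⟩ := exists_flow_box (⟨p, v⟩ : TangentBundle 𝓘(ℝ, E) S)
      have hgeodesic := hΓ _ (mem_of_mem_nhds hU)
      exact ⟨_, _, hgeodesic, by simpa using hgeodesic.zero_mem⟩
    | succ n ih =>
      obtain ⟨γ, J, hγ, hn⟩ := ih
      obtain ⟨γ', hγ'⟩ := h γ J hγ _ hn (by positivity) (min_le_right _ _)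
      obtain ⟨η, hη, -⟩ := hγ.extend hn hγ'
      refine ⟨η, _, hη, .inr ?_⟩
      push_cast
      constructor <;> grind
  obtain ⟨n, hn⟩ := exists_nat_gt (1 / (δ / 2))
  obtain ⟨γ, J, hγ, hnJ⟩ := hexists n
  rw [div_lt_iff₀ (by positivity)] at hn
  rw [min_eq_right hn.le] at hnJ
  exact ⟨γ, isGeodesicFrom_iff.2 ⟨J, hγ, hnJ⟩⟩

lemma mem_expDomain_of_forall_mem {B : Set S} (hB : IsCompact B) {p : S}
    {v : TangentSpace 𝓘(ℝ, E) p}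
    (h : ∀ γ J, IsGeodesicWith ⟨p, v⟩ γ J → ∀ s ∈ J, 0 ≤ s → s ≤ 1 → γ s ∈ B) :
    v ∈ expDomain p := by
  obtain ⟨δ, hδ, hextend⟩ := exists_uniform_time (isCompact_ball_bundle (E := E) hB ‖v‖)
  exact mem_expDomain_of_forall_extend hδ fun γ J hγ s hs hs0 hs1 =>
    hextend _ ⟨h γ J hγ s hs hs0 hs1, (hγ.norm_velocity hs).le⟩

lemma GeodesicFlowTendsto.trans {z w w' : TangentBundle 𝓘(ℝ, E) S} {s r : ℝ}
    (hs : GeodesicFlowTendsto z w s) (hr : GeodesicFlowTendsto w w' r) :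
    GeodesicFlowTendsto z w' (s + r) := by
  intro N hN
  filter_upwards [hs _ (hr N hN)] with z' ⟨γ, J, hγ, hsJ, γ', J', hγ', hrJ', hN'⟩
  have hsr : s + r + -s = r := by ring
  obtain ⟨η, hη, -, hηγ'⟩ := hγ.extend hsJ hγ'
  refine ⟨η, _, hη, .inr ?_, ?_⟩
  · rwa [mem_preimage, hsr]
  · rwa [hηγ' _ (by rwa [hsr]), hsr]

lemma exists_geodesicFlowTendsto (z₀ : TangentBundle 𝓘(ℝ, E) S) :
    ∃ δ > (0 : ℝ), ∀ᶠ z in 𝓝 z₀, ∀ γ J, IsGeodesicWith z γ J → ∀ s ∈ J, s ∈ Ioo (-δ) δ →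
      GeodesicFlowTendsto z (velocity E γ s) s := by
  obtain ⟨U, hU, δ, hδ, Γ, hΓ, hcont⟩ := exists_flow_box z₀
  refine ⟨δ, hδ, ?_⟩
  filter_upwards [eventually_mem_nhds_iff.2 hU] with z hz γ J hγ s hsJ hs N hN
  have hbox := hΓ z (mem_of_mem_nhds hz)
  have hvelocity : velocity E γ s = velocity E (Γ z) s := hγ.eqOn_velocity hbox ⟨hsJ, hs⟩
  have hat : ContinuousAt (fun w => velocity E (Γ w) s) z :=
    (hcont.continuousAt (x := (z, s)) (prod_mem_nhds hz (isOpen_Ioo.mem_nhds hs))).comp_of_eq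
      (Continuous.prodMk_left s).continuousAt rfl
  filter_upwards [hz, hat (hvelocity ▸ hN)] with w hw hwN
  exact ⟨Γ w, _, hΓ w hw, hs, hwN⟩

lemma IsGeodesicWith.geodesicFlowTendsto (h : IsGeodesicWith z γ J) {s : ℝ} (hs : s ∈ J) :
    GeodesicFlowTendsto z (velocity E γ s) s := by
  suffices GeodesicFlowTendsto (velocity E γ 0) (velocity E γ s) (s - 0) by
    rwa [h.velocity_zero, sub_zero] at this
  refine h.ordConnected.isPreconnected.induction₂'
    (fun a b => GeodesicFlowTendsto (velocity E γ a) (velocity E γ b) (b - a)) (fun a ha => ?_)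
    (fun a b c _ _ _ hab hbc => ?_) h.zero_mem hs
  · obtain ⟨δ, hδ, hlocal⟩ := exists_geodesicFlowTendsto (velocity E γ a)
    have hstep (b) (hb : b ∈ J) (c) (hc : c ∈ J) (hbc : c - b ∈ Ioo (-δ) δ)
        (hflow : ∀ γ' J', IsGeodesicWith (velocity E γ b) γ' J' → ∀ s ∈ J', s ∈ Ioo (-δ) δ →
          GeodesicFlowTendsto (velocity E γ b) (velocity E γ' s) s) :
        GeodesicFlowTendsto (velocity E γ b) (velocity E γ c) (c - b) := by
      have hcb : c - b + b ∈ J := by rwa [sub_add_cancel]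
      have hflow_c := hflow _ _ (h.comp_add hb) (c - b) hcb hbc
      rwa [velocity_comp_add (h.isGeodesicOn.mdifferentiableAt h.isOpen hcb), sub_add_cancel]
        at hflow_c
    filter_upwards [self_mem_nhdsWithin,
      (h.isGeodesicOn.continuousOn_velocity h.isOpen a ha).eventually hlocal,
      mem_nhdsWithin_of_mem_nhds (Ioo_mem_nhds (sub_lt_self a hδ) (lt_add_of_pos_right a hδ))]
      with b hb hflow hba
    exact ⟨hstep a ha b hb ⟨by linarith [hba.1], by linarith [hba.2]⟩ hlocal.self_of_nhds,
      hstep b hb a ha ⟨by linarith [hba.2], by linarith [hba.1]⟩ hflow⟩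
  · rw [← sub_add_sub_cancel' b a c]
    exact hab.trans hbc

lemma continuousOn_expMap :
    ContinuousOn (fun z : TangentBundle 𝓘(ℝ, E) S => expMap z.proj z.2)
      {z | z.2 ∈ expDomain z.proj} := by
  rintro z₀ ⟨γ₀, hγ₀⟩
  obtain ⟨J₀, h₀, one_mem⟩ := isGeodesicFrom_iff.1 hγ₀
  refine ContinuousAt.continuousWithinAt fun N hN => ?_
  rw [expMap_eq hγ₀] at hN
  change ∀ᶠ z in 𝓝 z₀, expMap z.proj z.2 ∈ N
  filter_upwards [h₀.geodesicFlowTendsto one_mem _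
    ((FiberBundle.continuous_proj E _).continuousAt (x := velocity E γ₀ 1) hN)]
    with z ⟨γ, J, hγ, hJ, hNz⟩
  rw [expMap_eq (isGeodesicFrom_iff.2 ⟨J, hγ, hJ⟩)]
  exact hNz

end Flow

open Manifold

lemma t3Space_of_chartedSpace (E S : Type*) [NormedAddCommGroup E] [NormedSpace ℝ E]
    [FiniteDimensional ℝ E] [TopologicalSpace S] [T2Space S] [ChartedSpace E S] : T3Space S := by
  have : ProperSpace E := FiniteDimensional.proper ℝ E
  have : LocallyCompactSpace S := ChartedSpace.locallyCompactSpace E S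
  infer_instance

section PathLength

variable {E : Type*} [NormedAddCommGroup E] [NormedSpace ℝ E]
  {S : Type*} [TopologicalSpace S] [ChartedSpace E S]

lemma continuous_velocity [IsManifold 𝓘(ℝ, E) 1 S] {β : ℝ → S}
    (hβ : ContMDiff 𝓘(ℝ, ℝ) 𝓘(ℝ, E) 1 β) : Continuous (velocity E β) := by
  have continuous_unit : Continuous fun s : ℝ => (⟨s, (1 : ℝ)⟩ : TangentBundle 𝓘(ℝ, ℝ) ℝ) :=
    (tangentBundleModelSpaceHomeomorph 𝓘(ℝ, ℝ)).symm.continuous.comp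
      (continuous_id.prodMk continuous_const)
  exact (hβ.continuous_tangentMap le_rfl).comp continuous_unit

lemma isC1PathIn_chart [IsManifold 𝓘(ℝ, E) ∞ S] {β : ℝ → S}
    (hβ : ContMDiff 𝓘(ℝ, ℝ) 𝓘(ℝ, E) 1 β) {x₀ : S} {B : Set E}
    (hB : MapsTo β (Icc 0 1) ((extChartAt 𝓘(ℝ, E) x₀).source ∩ extChartAt 𝓘(ℝ, E) x₀ ⁻¹' B)) :
    IsC1PathIn B (fun s => extChartAt 𝓘(ℝ, E) x₀ (β s))
      (fun s => (toCoord x₀ (velocity E β s)).2) := by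
  have hcoord : ContinuousOn (fun s => toCoord x₀ (velocity E β s)) (Icc 0 1) :=
    (continuousOn_toCoord x₀).comp (continuous_velocity hβ).continuousOn fun s hs => (hB hs).1
  refine ⟨hcoord.fst, hcoord.snd, fun s hs => ?_, fun s hs => (hB hs).2⟩
  have hsource := (hB (Ioo_subset_Icc_self hs)).1
  have hβs := hβ.mdifferentiable one_ne_zero s
  rw [toCoord_velocity hβs hsource]
  exact ((mdifferentiableAt_chart hsource).comp s hβs).differentiableAt.hasDerivAt

variable [RiemannianBundle (fun x : S => TangentSpace 𝓘(ℝ, E) x)]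

lemma exists_path_through {x y z : S} {L : ENNReal}
    (h : riemannianEDist 𝓘(ℝ, E) x y + riemannianEDist 𝓘(ℝ, E) y z < L) :
    ∃ β : ℝ → S, ContMDiff 𝓘(ℝ, ℝ) 𝓘(ℝ, E) 1 β ∧ β 0 = x ∧ β (1 / 2) = y ∧ β 1 = z ∧
      pathELength 𝓘(ℝ, E) β 0 1 < L := by
  obtain ⟨u, hu, v, hv, huv⟩ := ENNReal.exists_add_lt_of_add_lt h
  obtain ⟨β₁, hβ₁_start, hβ₁_end, hβ₁, hβ₁_length, -, hβ₁_const⟩ :=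
    exists_lt_locally_constant_of_riemannianEDist_lt hu (show (0 : ℝ) < 1 / 2 by norm_num)
  obtain ⟨β₂, -, hβ₂_end, hβ₂, hβ₂_length, hβ₂_const, -⟩ :=
    exists_lt_locally_constant_of_riemannianEDist_lt hv (show (1 / 2 : ℝ) < 1 by norm_num)
  classical
  refine ⟨piecewise (Iic (1 / 2)) β₁ β₂,
    .piecewise_Iic hβ₁ hβ₂ (hβ₁_const.trans hβ₂_const.symm), ?_, ?_, ?_, ?_⟩
  · rw [piecewise_eq_of_mem _ _ _ (by norm_num), hβ₁_start]
  · rw [piecewise_eq_of_mem _ _ _ self_mem_Iic, hβ₁_end]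
  · rw [piecewise_eq_of_notMem _ _ _ (by norm_num), hβ₂_end]
  rw [← pathELength_add (show (0 : ℝ) ≤ 1 / 2 by norm_num) (show (1 / 2 : ℝ) ≤ 1 by norm_num)]
  refine lt_trans (ENNReal.add_lt_add ?_ ?_) huv
  · rwa [pathELength_congr fun s hs => piecewise_eq_of_mem (Iic (1 / 2)) β₁ β₂ hs.2]
  · rwa [pathELength_congr_Ioo fun s hs =>
      piecewise_eq_of_notMem (Iic (1 / 2)) β₁ β₂ (not_le.2 hs.1)]

lemma riemannianEDist_le_ofReal_add {x y z : S} {a b : ℝ} (ha : 0 ≤ a) (hb : 0 ≤ b)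
    (hxy : riemannianEDist 𝓘(ℝ, E) x y ≤ ENNReal.ofReal a)
    (hyz : riemannianEDist 𝓘(ℝ, E) y z ≤ ENNReal.ofReal b) :
    riemannianEDist 𝓘(ℝ, E) x z ≤ ENNReal.ofReal (a + b) := by
  rw [ENNReal.ofReal_add ha hb]
  exact riemannianEDist_triangle.trans (add_le_add hxy hyz)

lemma ofReal_le_riemannianEDist_of_add_le {x y z : S} {a b : ℝ} (ha : 0 ≤ a) (hb : 0 ≤ b)
    (hxy : riemannianEDist 𝓘(ℝ, E) x y ≤ ENNReal.ofReal a)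
    (hxz : ENNReal.ofReal (a + b) ≤ riemannianEDist 𝓘(ℝ, E) x z) :
    ENNReal.ofReal b ≤ riemannianEDist 𝓘(ℝ, E) y z := by
  rw [ENNReal.ofReal_add ha hb] at hxz
  exact (ENNReal.add_le_add_iff_left ENNReal.ofReal_ne_top).1
    (hxz.trans (riemannianEDist_triangle.trans (add_le_add hxy le_rfl)))

lemma le_sq_riemannianEDist_of_between {x y z : S} {U : Set S} {ρ m : ℝ}
    (hU : ∀ y, riemannianEDist 𝓘(ℝ, E) x y < ENNReal.ofReal ρ → y ∈ U)
    (hz : riemannianEDist 𝓘(ℝ, E) x z < ENNReal.ofReal ρ)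
    (hy : riemannianEDist 𝓘(ℝ, E) x y + riemannianEDist 𝓘(ℝ, E) y z ≤ riemannianEDist 𝓘(ℝ, E) x z)
    (hm : ∀ β : ℝ → S, ContMDiff 𝓘(ℝ, ℝ) 𝓘(ℝ, E) 1 β → MapsTo β (Icc 0 1) U →
      β 0 = x → β (1 / 2) = y → β 1 = z → m ≤ (pathELength 𝓘(ℝ, E) β 0 1).toReal ^ 2) :
    m ≤ (riemannianEDist 𝓘(ℝ, E) x z).toReal ^ 2 := by
  set D := (riemannianEDist 𝓘(ℝ, E) x z).toReal
  have hlim : Filter.Tendsto (fun L : ℝ => L ^ 2) (𝓝[>] D) (𝓝 (D ^ 2)) :=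
    ((continuous_pow 2).tendsto D).mono_left nhdsWithin_le_nhds
  refine ge_of_tendsto hlim ?_
  filter_upwards [Ioo_mem_nhdsGT (ENNReal.toReal_lt_of_lt_ofReal hz)] with L ⟨hDL, hLρ⟩
  have hL : riemannianEDist 𝓘(ℝ, E) x z < ENNReal.ofReal L :=
    (ENNReal.lt_ofReal_iff_toReal_lt hz.ne_top).2 hDL
  obtain ⟨β, hβ, rfl, rfl, rfl, hβL⟩ := exists_path_through (hy.trans_lt hL)
  have hβU : MapsTo β (Icc 0 1) U := fun s hs => hU _ (calc
    riemannianEDist 𝓘(ℝ, E) (β 0) (β s)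
    _ ≤ pathELength 𝓘(ℝ, E) β 0 s := riemannianEDist_le_pathELength hβ.contMDiffOn rfl rfl hs.1
    _ ≤ pathELength 𝓘(ℝ, E) β 0 1 := pathELength_mono le_rfl hs.2
    _ < ENNReal.ofReal ρ := hβL.trans_le (ENNReal.ofReal_le_ofReal hLρ.le))
  refine (hm β hβ hβU rfl rfl rfl).trans ?_
  gcongr
  exact (ENNReal.toReal_lt_of_lt_ofReal hβL).le

end PathLength

section Distance

variable {E : Type*} [NormedAddCommGroup E] [NormedSpace ℝ E]
  {S : Type*} [TopologicalSpace S] [ChartedSpace E S]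
  [RiemannianBundle (fun x : S => TangentSpace 𝓘(ℝ, E) x)]
  [IsManifold 𝓘(ℝ, E) ∞ S]
  [IsContMDiffRiemannianBundle 𝓘(ℝ, E) ∞ E (fun x : S => TangentSpace 𝓘(ℝ, E) x)]

lemma pathELength_eq_integral {β : ℝ → S} (hβ : ContMDiff 𝓘(ℝ, ℝ) 𝓘(ℝ, E) 1 β) {a b : ℝ}
    (hab : a ≤ b) :
    pathELength 𝓘(ℝ, E) β a b = ENNReal.ofReal (∫ s in a..b, ‖(velocity E β s).2‖) := by
  have hc : Continuous fun s => ‖(velocity E β s).2‖ :=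
    continuous_norm_tangent.comp (continuous_velocity hβ)
  rw [intervalIntegral.integral_of_le hab, ← MeasureTheory.integral_Icc_eq_integral_Ioc,
    MeasureTheory.ofReal_integral_eq_lintegral_ofReal hc.continuousOn.integrableOn_Icc
      (.of_forall fun s => norm_nonneg _), pathELength_eq_lintegral_mfderiv_Icc]
  simp only [ofReal_norm]
  rfl

variable [FiniteDimensional ℝ E]

lemma IsGeodesicWith.riemannianEDist_le {z : TangentBundle 𝓘(ℝ, E) S} {γ : ℝ → S} {J : Set ℝ}
    (h : IsGeodesicWith z γ J) {a b : ℝ} (ha : a ∈ J) (hb : b ∈ J) (hab : a ≤ b) :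
    riemannianEDist 𝓘(ℝ, E) (γ a) (γ b) ≤ ENNReal.ofReal ((b - a) * ‖z.2‖) := by
  have hsub : Icc a b ⊆ J := h.ordConnected.out ha hb
  have speed_eq : ∀ s ∈ Icc a b,
      ‖mfderiv 𝓘(ℝ, ℝ) 𝓘(ℝ, E) γ s (1 : ℝ)‖ₑ = ENNReal.ofReal ‖z.2‖ := fun s hs => by
    rw [← h.norm_velocity (hsub hs), ofReal_norm]
    rfl
  calc riemannianEDist 𝓘(ℝ, E) (γ a) (γ b)
    _ ≤ pathELength 𝓘(ℝ, E) γ a b := riemannianEDist_le_pathELength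
        ((h.isGeodesicOn.1.mono hsub).of_le (by exact_mod_cast le_top)) rfl rfl hab
    _ = ENNReal.ofReal ((b - a) * ‖z.2‖) := by
        rw [pathELength_eq_lintegral_mfderiv_Icc]
        refine (MeasureTheory.setLIntegral_congr_fun measurableSet_Icc speed_eq).trans ?_
        rw [MeasureTheory.setLIntegral_const, Real.volume_Icc,
          ENNReal.ofReal_mul (sub_nonneg.2 hab), mul_comm]

lemma toReal_pathELength_eq_integral_sqrt_form {β : ℝ → S}
    (hβ : ContMDiff 𝓘(ℝ, ℝ) 𝓘(ℝ, E) 1 β) {x₀ : S}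
    (hsource : MapsTo β (Icc 0 1) (extChartAt 𝓘(ℝ, E) x₀).source) :
    (pathELength 𝓘(ℝ, E) β 0 1).toReal =
      ∫ s in (0 : ℝ)..1, √((chartLocalMetric x₀).form (extChartAt 𝓘(ℝ, E) x₀ (β s))
        (toCoord x₀ (velocity E β s)).2 (toCoord x₀ (velocity E β s)).2) := by
  rw [pathELength_eq_integral hβ zero_le_one, ENNReal.toReal_ofReal
    (intervalIntegral.integral_nonneg zero_le_one fun s _ => norm_nonneg _)]
  refine intervalIntegral.integral_congr fun s hs => ?_
  rw [uIcc_of_le zero_le_one] at hs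
  rw [← Real.sqrt_sq (norm_nonneg (velocity E β s).2),
    norm_sq_eq_form_toCoord (z := velocity E β s) (hsource hs)]
  rfl

/- The defect `δ` measures how far a path from `x` to `z` strays from the geodesic `c`; it forces
almost minimizing paths to stay close to `c`. -/
lemma exists_geodesic_sq_norm_add_le (x₀ : S) :
    ∃ U ∈ 𝓝 x₀, ∃ N ∈ 𝓝 x₀, ∀ x ∈ N, ∀ z ∈ N,
      ∃ (c : ℝ → S) (w : TangentBundle 𝓘(ℝ, E) S) (δ : S → ℝ),
        IsGeodesicWith w c (Ioo (-1) 2) ∧ c 0 = x ∧ c 1 = z ∧ (∀ y, 0 ≤ δ y) ∧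
        (∀ y ∈ U, δ y = 0 → ∃ s ∈ Icc (0 : ℝ) 1, y = c s) ∧
        ∀ β : ℝ → S, ContMDiff 𝓘(ℝ, ℝ) 𝓘(ℝ, E) 1 β → MapsTo β (Icc 0 1) U → β 0 = x → β 1 = z →
          ∀ s ∈ Icc (0 : ℝ) 1,
            ‖w.2‖ ^ 2 + δ (β s) ≤ (pathELength 𝓘(ℝ, E) β 0 1).toReal ^ 2 := by
  set φ := extChartAt 𝓘(ℝ, E) x₀
  have hy₀ : φ x₀ ∈ (chartLocalMetric (E := E) x₀).dom :=
    φ.map_source (mem_extChartAt_source x₀)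
  obtain ⟨a, ha, l, hl, r, hr, -, hmin⟩ := LocalMetric.exists_minimizing_solution hy₀
  have mem_nhds (R : ℝ) (hR : 0 < R) : φ.source ∩ φ ⁻¹' Metric.closedBall (φ x₀) R ∈ 𝓝 x₀ :=
    Filter.inter_mem (extChartAt_source_mem_nhds x₀)
      ((continuousAt_extChartAt x₀) (Metric.closedBall_mem_nhds _ hR))
  refine ⟨_, mem_nhds a ha, _, mem_nhds (r / 2) (by positivity), fun x hx z hz => ?_⟩
  have hxz : φ z ∈ Metric.closedBall (φ x) r :=
    (dist_triangle_right _ _ (φ x₀)).trans (by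
      linarith [Metric.mem_closedBall.1 hx.2, Metric.mem_closedBall.1 hz.2])
  obtain ⟨c, v, hsol, hc_start, hc_end, hlength⟩ := hmin (φ x)
    (Metric.closedBall_subset_closedBall (by linarith) hx.2) (φ z) hxz
  have h0 : (0 : ℝ) ∈ Ioo (-1 : ℝ) 2 := by norm_num
  have hc : ContinuousOn c (Icc 0 1) := fun s hs =>
    (hsol.deriv_pos s ⟨by linarith [hs.1], by linarith [hs.2]⟩).continuousAt.continuousWithinAt
  have hclosed : IsClosed (c '' Icc 0 1) := (isCompact_Icc.image_of_continuousOn hc).isClosed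
  refine ⟨fun s => φ.symm (c s), ofCoord x₀ (c 0, v 0),
    fun y => l / 2 * Metric.infDist (φ y) (c '' Icc 0 1) ^ 2,
    ⟨isOpen_Ioo, ordConnected_Ioo, h0, hsol.isGeodesicOn isOpen_Ioo,
      velocity_chart_symm (hsol.deriv_pos 0 h0) (hsol.mem 0 h0)⟩,
    by simp only [hc_start, φ.left_inv hx.1], by simp only [hc_end, φ.left_inv hz.1],
    fun y => by positivity, fun y hy hδ => ?_, fun β hβ hβU hβ_start hβ_end s hs => ?_⟩
  · have hinfDist : Metric.infDist (φ y) (c '' Icc 0 1) = 0 := by simpa [hl.ne'] using hδ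
    obtain ⟨s, hs, hsy⟩ := (hclosed.mem_iff_infDist_zero
      ((nonempty_Icc.2 zero_le_one).image c)).2 hinfDist
    exact ⟨s, hs, by simp only [hsy, φ.left_inv hy.1]⟩
  · rw [← chartForm_self_eq_norm_sq,
      toReal_pathELength_eq_integral_sqrt_form hβ fun s hs => (hβU hs).1, hc_start]
    exact hlength _ _ (isC1PathIn_chart hβ hβU) (by rw [hβ_start]) (by rw [hβ_end]) s hs

variable [T2Space S]

variable (E) in
lemma exists_riemannianEDist_ball_subset {x : S} {N : Set S} (hN : N ∈ 𝓝 x) :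
    ∃ ρ > (0 : ℝ), ∀ y, riemannianEDist 𝓘(ℝ, E) x y < ENNReal.ofReal ρ → y ∈ N := by
  have := isContinuousRiemannianBundle E S
  have := t3Space_of_chartedSpace E S
  obtain ⟨ρ, hρ, hsub⟩ := setOfPred_riemannianEDist_lt_subset_nhds 𝓘(ℝ, E) hN
  exact ⟨ρ, hρ, fun y hy => hsub (by simpa using hy)⟩

variable (E) in
lemma continuous_riemannianEDist :
    Continuous fun q : S × S => riemannianEDist 𝓘(ℝ, E) q.1 q.2 := by
  have := isContinuousRiemannianBundle E S
  have := t3Space_of_chartedSpace E S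
  let : PseudoEMetricSpace S := .ofRiemannianMetric 𝓘(ℝ, E) S
  exact continuous_edist

variable (E) in
lemma eq_of_riemannianEDist_eq_zero {x y : S} (h : riemannianEDist 𝓘(ℝ, E) x y = 0) : x = y := by
  have := isContinuousRiemannianBundle E S
  have := t3Space_of_chartedSpace E S
  let : EMetricSpace S := .ofRiemannianMetric 𝓘(ℝ, E) S
  exact eq_of_edist_eq_zero h

lemma IsGeodesicWith.apply_eq_of_riemannianEDist_le {w : TangentBundle 𝓘(ℝ, E) S} {c : ℝ → S}
    {J : Set ℝ} (h : IsGeodesicWith w c J) (h1 : 1 ∈ J)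
    (hw : ENNReal.ofReal ‖w.2‖ = riemannianEDist 𝓘(ℝ, E) (c 0) (c 1)) {s σ : ℝ}
    (hs : s ∈ Icc (0 : ℝ) 1) (hσ : σ ∈ Icc (0 : ℝ) 1)
    (hstart : riemannianEDist 𝓘(ℝ, E) (c 0) (c s) ≤ ENNReal.ofReal (σ * ‖w.2‖))
    (hend : riemannianEDist 𝓘(ℝ, E) (c s) (c 1) ≤ ENNReal.ofReal ((1 - σ) * ‖w.2‖)) :
    c s = c σ := by
  have hJ : Icc 0 1 ⊆ J := h.ordConnected.out h.zero_mem h1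
  have norm_le {a b : ℝ} (ha : 0 ≤ a) (hb : 0 ≤ b)
      (hsa : riemannianEDist 𝓘(ℝ, E) (c 0) (c s) ≤ ENNReal.ofReal (a * ‖w.2‖))
      (hsb : riemannianEDist 𝓘(ℝ, E) (c s) (c 1) ≤ ENNReal.ofReal (b * ‖w.2‖)) :
      ‖w.2‖ ≤ a * ‖w.2‖ + b * ‖w.2‖ :=
    (ENNReal.ofReal_le_ofReal_iff (by positivity)).1
      (hw.trans_le (riemannianEDist_le_ofReal_add (by positivity) (by positivity) hsa hsb))
  have hsσ : s * ‖w.2‖ = σ * ‖w.2‖ := by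
    linarith [norm_le (sub_nonneg.2 hs.1) (sub_nonneg.2 hσ.2)
        (h.riemannianEDist_le h.zero_mem (hJ hs) hs.1) hend,
      norm_le hσ.1 (sub_nonneg.2 hs.2) hstart (h.riemannianEDist_le (hJ hs) h1 hs.2)]
  obtain rfl | hw0 := mul_eq_mul_right_iff.1 hsσ
  · rfl
  have eq_start {r : ℝ} (hr : r ∈ Icc (0 : ℝ) 1) : c 0 = c r :=
    eq_of_riemannianEDist_eq_zero E (by
      simpa [hw0] using h.riemannianEDist_le h.zero_mem (hJ hr) hr.1)
  rw [← eq_start hs, ← eq_start hσ]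

lemma exists_geodesic_sq_norm_add_le_sq_riemannianEDist (x₀ : S) :
    ∃ ρ > (0 : ℝ), ∀ x z : S, riemannianEDist 𝓘(ℝ, E) x₀ x < ENNReal.ofReal ρ →
      riemannianEDist 𝓘(ℝ, E) x z < ENNReal.ofReal ρ →
      ∃ (c : ℝ → S) (w : TangentBundle 𝓘(ℝ, E) S) (δ : S → ℝ),
        IsGeodesicWith w c (Ioo (-1) 2) ∧ c 0 = x ∧ c 1 = z ∧ (∀ y, 0 ≤ δ y) ∧
        ∀ y, riemannianEDist 𝓘(ℝ, E) x y + riemannianEDist 𝓘(ℝ, E) y z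
            ≤ riemannianEDist 𝓘(ℝ, E) x z →
          ‖w.2‖ ^ 2 + δ y ≤ (riemannianEDist 𝓘(ℝ, E) x z).toReal ^ 2 ∧
          (δ y = 0 → ∃ s ∈ Icc (0 : ℝ) 1, y = c s) := by
  obtain ⟨U, hU, N, hN, hgeodesic⟩ := exists_geodesic_sq_norm_add_le (E := E) x₀
  obtain ⟨R, hR, hball⟩ := exists_riemannianEDist_ball_subset E (Filter.inter_mem hU hN)
  refine ⟨R / 2, half_pos hR, fun x z hx hz => ?_⟩
  have hnear (y : S) (hy : riemannianEDist 𝓘(ℝ, E) x y < ENNReal.ofReal (R / 2)) :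
      y ∈ U ∩ N := by
    refine hball y (riemannianEDist_triangle.trans_lt ((ENNReal.add_lt_add hx hy).trans_eq ?_))
    rw [← ENNReal.ofReal_add (by positivity) (by positivity), add_halves]
  have hxU : x ∈ U ∩ N := hnear x (by
    rw [riemannianEDist_self]
    exact ENNReal.ofReal_pos.2 (half_pos hR))
  obtain ⟨c, w, δ, hw, hc_start, hc_end, hδ_nonneg, hδ_zero, hlength⟩ :=
    hgeodesic x hxU.2 z (hnear z hz).2
  exact ⟨c, w, δ, hw, hc_start, hc_end, hδ_nonneg, fun y hy =>
    ⟨le_sq_riemannianEDist_of_between (fun y hy => (hnear y hy).1) hz hy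
      fun β hβ hβU hβ_start hβ_mid hβ_end =>
        hβ_mid ▸ hlength β hβ hβU hβ_start hβ_end (1 / 2) (by norm_num),
    hδ_zero y (hnear y ((le_self_add.trans hy).trans_lt hz)).1⟩⟩

/-- `c` is a geodesic from `x` to `z` with initial velocity `w` whose length is the distance
`d(x,z)`, and it is the only such curve: a point that divides `d(x,z)` in the ratio `σ : 1 - σ` is
the point `c σ`. The geodesic is defined beyond `[0,1]`, so that it can be compared with other
geodesics near its end points. -/
structure IsStrictlyMinimizing (w : TangentBundle 𝓘(ℝ, E) S) (c : ℝ → S) (x z : S) : Prop where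
  isGeodesicWith : IsGeodesicWith w c (Ioo (-1) 2)
  apply_zero : c 0 = x
  apply_one : c 1 = z
  ofReal_norm : ENNReal.ofReal ‖w.2‖ = riemannianEDist 𝓘(ℝ, E) x z
  eq_apply : ∀ y, ∀ σ ∈ Icc (0 : ℝ) 1, riemannianEDist 𝓘(ℝ, E) x y ≤ ENNReal.ofReal (σ * ‖w.2‖) →
    riemannianEDist 𝓘(ℝ, E) y z ≤ ENNReal.ofReal ((1 - σ) * ‖w.2‖) → y = c σ

lemma exists_isStrictlyMinimizing (x₀ : S) :
    ∃ ρ > (0 : ℝ), ∀ x z : S, riemannianEDist 𝓘(ℝ, E) x₀ x < ENNReal.ofReal ρ →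
      riemannianEDist 𝓘(ℝ, E) x z < ENNReal.ofReal ρ →
      ∃ (w : TangentBundle 𝓘(ℝ, E) S) (c : ℝ → S), IsStrictlyMinimizing w c x z := by
  obtain ⟨ρ, hρ, hgeodesic⟩ := exists_geodesic_sq_norm_add_le_sq_riemannianEDist (E := E) x₀
  refine ⟨ρ, hρ, fun x z hx hz => ?_⟩
  obtain ⟨c, w, δ, hw, rfl, rfl, hδ_nonneg, hδ⟩ := hgeodesic x z hx hz
  set D := (riemannianEDist 𝓘(ℝ, E) (c 0) (c 1)).toReal
  have hDw : D ≤ ‖w.2‖ := ENNReal.toReal_le_of_le_ofReal (norm_nonneg _) (by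
    simpa using hw.riemannianEDist_le hw.zero_mem
      (show (1 : ℝ) ∈ Ioo (-1 : ℝ) 2 by norm_num) zero_le_one)
  have hwD : ‖w.2‖ ^ 2 ≤ D ^ 2 := by
    linarith [hδ_nonneg (c 0), (hδ (c 0) (by rw [riemannianEDist_self, zero_add])).1]
  have hnorm : ‖w.2‖ = D := (abs_le_of_sq_le_sq' hwD ENNReal.toReal_nonneg).2.antisymm hDw
  have hD : ENNReal.ofReal ‖w.2‖ = riemannianEDist 𝓘(ℝ, E) (c 0) (c 1) := by
    rw [hnorm, ENNReal.ofReal_toReal hz.ne_top]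
  refine ⟨w, c, hw, rfl, rfl, hD, fun y σ hσ hxy hyz => ?_⟩
  have hy : riemannianEDist 𝓘(ℝ, E) (c 0) y + riemannianEDist 𝓘(ℝ, E) y (c 1)
      ≤ riemannianEDist 𝓘(ℝ, E) (c 0) (c 1) := (add_le_add hxy hyz).trans_eq (by
    rw [← hD, ← ENNReal.ofReal_add (mul_nonneg hσ.1 (norm_nonneg _))
      (mul_nonneg (sub_nonneg.2 hσ.2) (norm_nonneg _)), ← add_mul, add_sub_cancel, one_mul])
  have hδy : δ y = 0 :=
    le_antisymm (by linarith [(hδ y hy).1, congr($hnorm ^ 2)]) (hδ_nonneg y)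
  obtain ⟨s, hs, rfl⟩ := (hδ y hy).2 hδy
  exact hw.apply_eq_of_riemannianEDist_le (by norm_num) hD hs hσ hxy hyz

end Distance

section HopfRinow

variable {E : Type*} [NormedAddCommGroup E] [NormedSpace ℝ E] [FiniteDimensional ℝ E]
  {S : Type*} [TopologicalSpace S] [T2Space S] [ChartedSpace E S]
  [RiemannianBundle (fun x : S => TangentSpace 𝓘(ℝ, E) x)]
  [IsManifold 𝓘(ℝ, E) ∞ S]
  [IsContMDiffRiemannianBundle 𝓘(ℝ, E) ∞ E (fun x : S => TangentSpace 𝓘(ℝ, E) x)]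

lemma exists_riemannianEDist_eq_and_lt {x q : S} {δ e : ENNReal}
    (hδ : δ ≤ riemannianEDist 𝓘(ℝ, E) x q) (h : riemannianEDist 𝓘(ℝ, E) x q < δ + e) :
    ∃ y, riemannianEDist 𝓘(ℝ, E) x y = δ ∧ riemannianEDist 𝓘(ℝ, E) y q < e := by
  have hδ_ne_top : δ ≠ ⊤ := ne_top_of_le_ne_top h.ne_top hδ
  obtain ⟨β, rfl, rfl, hβ, hlength, -⟩ :=
    exists_lt_locally_constant_of_riemannianEDist_lt h zero_lt_one
  have hcont : Continuous fun s => riemannianEDist 𝓘(ℝ, E) (β 0) (β s) :=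
    (continuous_riemannianEDist E).comp (continuous_const.prodMk hβ.continuous)
  obtain ⟨s, hs, hsδ⟩ := intermediate_value_Icc zero_le_one hcont.continuousOn
    (show δ ∈ Icc _ _ from ⟨by simp [riemannianEDist_self], hδ⟩)
  refine ⟨β s, hsδ, ?_⟩
  have hle {a b : ℝ} (hab : a ≤ b) :
      riemannianEDist 𝓘(ℝ, E) (β a) (β b) ≤ pathELength 𝓘(ℝ, E) β a b :=
    riemannianEDist_le_pathELength hβ.contMDiffOn rfl rfl hab
  rw [← pathELength_add hs.1 hs.2] at hlength
  exact (ENNReal.add_lt_add_iff_left hδ_ne_top).1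
    ((add_le_add (hsδ.symm.trans_le (hle hs.1)) (hle hs.2)).trans_lt hlength)

variable (E) in
lemma exists_step_toward (x : S) :
    ∃ ρ > (0 : ℝ), ∀ δ r : ℝ, 0 ≤ δ → δ < ρ → δ ≤ r → ∀ q,
      riemannianEDist 𝓘(ℝ, E) x q = ENNReal.ofReal r →
      ∃ y, riemannianEDist 𝓘(ℝ, E) x y = ENNReal.ofReal δ ∧
        riemannianEDist 𝓘(ℝ, E) y q ≤ ENNReal.ofReal (r - δ) := by
  have : ProperSpace E := FiniteDimensional.proper ℝ E
  have : LocallyCompactSpace S := ChartedSpace.locallyCompactSpace E S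
  obtain ⟨C, hC, hCx⟩ := exists_compact_mem_nhds x
  obtain ⟨ρ, hρ, hball⟩ := exists_riemannianEDist_ball_subset E hCx
  refine ⟨ρ, hρ, fun δ r hδ hδρ hδr q hq => ?_⟩
  set sphere := {y | riemannianEDist 𝓘(ℝ, E) x y = ENNReal.ofReal δ}
  have hδq : ENNReal.ofReal δ ≤ riemannianEDist 𝓘(ℝ, E) x q :=
    hq ▸ ENNReal.ofReal_le_ofReal hδr
  have hcompact : IsCompact sphere := hC.of_isClosed_subset
    (isClosed_eq ((continuous_riemannianEDist E).comp (Continuous.prodMk_right x))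
      continuous_const)
    fun y hy => hball y (hy.trans_lt ((ENNReal.ofReal_lt_ofReal_iff hρ).2 hδρ))
  have hnonempty : sphere.Nonempty := by
    obtain ⟨y, hy, -⟩ := exists_riemannianEDist_eq_and_lt (e := ⊤) hδq
      (by simp [hq])
    exact ⟨y, hy⟩
  obtain ⟨y, hy, hmin⟩ := hcompact.exists_isMinOn hnonempty
    ((continuous_riemannianEDist E).comp (Continuous.prodMk_left q)).continuousOn
  refine ⟨y, hy, le_of_not_gt fun hlt => ?_⟩
  have hxq : riemannianEDist 𝓘(ℝ, E) x q
      < ENNReal.ofReal δ + riemannianEDist 𝓘(ℝ, E) y q := by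
    rw [hq, ← add_sub_cancel δ r, ENNReal.ofReal_add hδ (sub_nonneg.2 hδr)]
    exact ENNReal.add_lt_add_left ENNReal.ofReal_ne_top hlt
  obtain ⟨y', hy', hy'q⟩ := exists_riemannianEDist_eq_and_lt hδq hxq
  exact (hmin hy').not_gt hy'q

variable {z w w' : TangentBundle 𝓘(ℝ, E) S} {γ c η : ℝ → S} {J : Set ℝ}

lemma IsStrictlyMinimizing.apply_one_eq {x y : S} (hc : IsStrictlyMinimizing w c x y)
    (hη : IsGeodesicWith w' η J) (h1 : 1 ∈ J) (hstart : w'.proj = x) (hnorm : ‖w'.2‖ = ‖w.2‖)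
    (hhalf : riemannianEDist 𝓘(ℝ, E) (η (1 / 2)) y ≤ ENNReal.ofReal (1 / 2 * ‖w.2‖)) :
    η 1 = y := by
  have hJ : Icc 0 1 ⊆ J := hη.ordConnected.out hη.zero_mem h1
  have eq_on_half (σ : ℝ) (hσ : σ ∈ Ioo (0 : ℝ) (1 / 2)) : c σ = η σ := by
    have hσJ : σ ∈ J := hJ ⟨hσ.1.le, by linarith [hσ.2]⟩
    refine (hc.eq_apply _ σ ⟨hσ.1.le, by linarith [hσ.2]⟩ ?_ ?_).symm
    · rw [← hstart, ← hη.apply_zero, ← hnorm]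
      simpa only [sub_zero] using hη.riemannianEDist_le hη.zero_mem hσJ hσ.1.le
    · have hadd := riemannianEDist_le_ofReal_add
        (mul_nonneg (sub_nonneg.2 hσ.2.le) (norm_nonneg w'.2)) (by positivity)
        (hη.riemannianEDist_le hσJ (hJ (by norm_num)) hσ.2.le) hhalf
      rwa [hnorm, ← add_mul, sub_add_eq_add_sub, add_halves] at hadd
  have hvelocity : velocity E c (1 / 4) = velocity E η (1 / 4) := velocity_congr
    (Filter.eventuallyEq_of_mem (Ioo_mem_nhds (by norm_num) (by norm_num)) eq_on_half)
  have heqOn := (hc.isGeodesicWith.isGeodesicOn.mono inter_subset_left).eqOn_velocity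
    (hη.isGeodesicOn.mono inter_subset_right) (isOpen_Ioo.inter hη.isOpen)
    (ordConnected_Ioo.inter hη.ordConnected) ⟨by norm_num, hJ (by norm_num)⟩ hvelocity
  rw [← hc.apply_one]
  exact (congrArg TotalSpace.proj (heqOn ⟨by norm_num, h1⟩)).symm

/- Otherwise `γ` up to time `s`, followed by a shortest curve to `y`, would be a minimizing path
with a corner at `γ s`. -/
lemma IsGeodesicWith.apply_add_eq_of_isStrictlyMinimizing (h : IsGeodesicWith z γ J) (h1 : 1 ∈ J)
    {q : S} (hq : riemannianEDist 𝓘(ℝ, E) z.proj q = ENNReal.ofReal ‖z.2‖) {s e : ℝ} (he : 0 ≤ e)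
    (hes : e ≤ s) (hse : s + e ≤ 1) {y : S}
    (hy : riemannianEDist 𝓘(ℝ, E) (γ s) y ≤ ENNReal.ofReal (e * ‖z.2‖))
    (hyq : riemannianEDist 𝓘(ℝ, E) y q ≤ ENNReal.ofReal ((1 - s - e) * ‖z.2‖))
    (hc : IsStrictlyMinimizing w c (γ (s - e)) y) : γ (s + e) = y := by
  have hJ : Icc 0 1 ⊆ J := h.ordConnected.out h.zero_mem h1
  have hr := norm_nonneg z.2
  have hsub : s - e ∈ J := hJ ⟨by linarith, by linarith⟩
  have hs : s ∈ J := hJ ⟨by linarith, by linarith⟩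
  have hle : riemannianEDist 𝓘(ℝ, E) (γ (s - e)) y ≤ ENNReal.ofReal (2 * e * ‖z.2‖) := by
    have hadd := riemannianEDist_le_ofReal_add (by rw [sub_sub_cancel]; positivity)
      (by positivity) (h.riemannianEDist_le hsub hs (by linarith)) hy
    rwa [sub_sub_cancel, ← add_mul, ← two_mul] at hadd
  have hge : ENNReal.ofReal (2 * e * ‖z.2‖) ≤ riemannianEDist 𝓘(ℝ, E) (γ (s - e)) y := by
    have hstart := h.riemannianEDist_le h.zero_mem hsub (by linarith)
    have htoward : ENNReal.ofReal ((1 - s - e) * ‖z.2‖ + 2 * e * ‖z.2‖)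
        ≤ riemannianEDist 𝓘(ℝ, E) q (γ (s - e)) := by
      rw [riemannianEDist_comm]
      refine ofReal_le_riemannianEDist_of_add_le (mul_nonneg (by linarith) hr)
        (by nlinarith) hstart ?_
      rw [h.apply_zero, hq]
      exact ENNReal.ofReal_le_ofReal (by linarith)
    rw [riemannianEDist_comm] at hyq ⊢
    exact ofReal_le_riemannianEDist_of_add_le (mul_nonneg (by linarith) hr) (by positivity)
      hyq htoward
  have hnorm : ‖w.2‖ = 2 * e * ‖z.2‖ :=
    (ENNReal.ofReal_eq_ofReal_iff (norm_nonneg _) (by positivity)).1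
      (hc.ofReal_norm.trans (hle.antisymm hge))
  have hend : 2 * e * 1 + (s - e) = s + e := by ring
  have hmid : 2 * e * (1 / 2) + (s - e) = s := by ring
  rw [← hend]
  refine hc.apply_one_eq ((h.comp_add hsub).comp_mul (a := 2 * e) (by positivity)) ?_ rfl ?_ ?_
  · exact hJ (by constructor <;> linarith)
  · rw [norm_smul, h.norm_velocity hsub, Real.norm_of_nonneg (by positivity), hnorm]
  · rw [hmid, hnorm]
    exact hy.trans_eq (by ring_nf)

lemma IsGeodesicWith.exists_extend_minimizing (h : IsGeodesicWith z γ J) (h1 : 1 ∈ J) {q : S}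
    (hq : riemannianEDist 𝓘(ℝ, E) z.proj q = ENNReal.ofReal ‖z.2‖) {s : ℝ} (hs0 : 0 < s)
    (hs1 : s < 1)
    (hs : riemannianEDist 𝓘(ℝ, E) (γ s) q ≤ ENNReal.ofReal ((1 - s) * ‖z.2‖)) :
    ∃ s' ≤ 1, s < s' ∧
      riemannianEDist 𝓘(ℝ, E) (γ s') q ≤ ENNReal.ofReal ((1 - s') * ‖z.2‖) := by
  have hJ : Icc 0 1 ⊆ J := h.ordConnected.out h.zero_mem h1
  have hr := norm_nonneg z.2
  have hsJ : s ∈ J := hJ ⟨hs0.le, hs1.le⟩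
  obtain ⟨ρ, hρ, hstep⟩ := exists_step_toward E (γ s)
  obtain ⟨ρ', hρ', hminimizing⟩ := exists_isStrictlyMinimizing (E := E) (γ s)
  have hsmall : Filter.Tendsto (fun e : ℝ => e * ‖z.2‖) (𝓝[>] 0) (𝓝 0) :=
    ((continuous_mul_const ‖z.2‖).tendsto' 0 0 (zero_mul _)).mono_left nhdsWithin_le_nhds
  obtain ⟨e, ⟨heρ, heρ'⟩, he, hes⟩ := (((hsmall.eventually_lt_const hρ).and
    (hsmall.eventually_lt_const (half_pos hρ'))).and
      (Ioc_mem_nhdsGT (lt_min hs0 (sub_pos.2 hs1)))).exists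
  rw [le_min_iff] at hes
  have hsq : riemannianEDist 𝓘(ℝ, E) (γ s) q = ENNReal.ofReal ((1 - s) * ‖z.2‖) := by
    refine hs.antisymm (ofReal_le_riemannianEDist_of_add_le (mul_nonneg (by linarith) hr)
      (mul_nonneg (by linarith) hr) (h.riemannianEDist_le h.zero_mem hsJ hs0.le) ?_)
    rw [h.apply_zero, hq]
    exact ENNReal.ofReal_le_ofReal (by linarith)
  obtain ⟨y, hy, hyq⟩ := hstep _ _ (by positivity) heρ
    (mul_le_mul_of_nonneg_right hes.2 hr) q hsq
  rw [← sub_mul] at hyq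
  have hback : riemannianEDist 𝓘(ℝ, E) (γ (s - e)) (γ s) ≤ ENNReal.ofReal (e * ‖z.2‖) := by
    simpa only [sub_sub_cancel] using h.riemannianEDist_le
      (hJ ⟨by linarith, by linarith⟩ : s - e ∈ J) hsJ (by linarith)
  have hlt {a : ℝ} (ha : a < ρ') : ENNReal.ofReal a < ENNReal.ofReal ρ' :=
    (ENNReal.ofReal_lt_ofReal_iff hρ').2 ha
  obtain ⟨w, c, hc⟩ := hminimizing (γ (s - e)) y
    ((riemannianEDist_comm.trans_le hback).trans_lt (hlt (by linarith)))
    ((riemannianEDist_le_ofReal_add (by positivity) (by positivity) hback hy.le).trans_lt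
      (hlt (by linarith)))
  refine ⟨s + e, by linarith, by linarith, ?_⟩
  rwa [h.apply_add_eq_of_isStrictlyMinimizing h1 hq he.le hes.1 (by linarith) hy.le hyq hc,
    ← sub_sub]

lemma IsGeodesicWith.apply_one_eq_of_minimizing (h : IsGeodesicWith z γ J) (h1 : 1 ∈ J) {q : S}
    (hq : riemannianEDist 𝓘(ℝ, E) z.proj q = ENNReal.ofReal ‖z.2‖) {s : ℝ}
    (hs : s ∈ Ioc (0 : ℝ) 1)
    (hsq : riemannianEDist 𝓘(ℝ, E) (γ s) q ≤ ENNReal.ofReal ((1 - s) * ‖z.2‖)) : γ 1 = q := by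
  have hcont : ContinuousOn γ (Icc 0 1) :=
    h.isGeodesicOn.1.continuousOn.mono (h.ordConnected.out h.zero_mem h1)
  set A := {s ∈ Icc (0 : ℝ) 1 |
    riemannianEDist 𝓘(ℝ, E) (γ s) q ≤ ENNReal.ofReal ((1 - s) * ‖z.2‖)}
  have hA : IsCompact A := isCompact_Icc.of_isClosed_subset
    (isClosed_Icc.isClosed_le
      ((continuous_riemannianEDist E).comp_continuousOn (hcont.prodMk continuousOn_const))
      (ENNReal.continuous_ofReal.comp (by fun_prop)).continuousOn) (sep_subset _ _)
  have hsA : s ∈ A := ⟨Ioc_subset_Icc_self hs, hsq⟩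
  obtain ⟨m, hm, hmax⟩ := hA.exists_isGreatest ⟨s, hsA⟩
  obtain rfl : m = 1 := by
    by_contra hne
    obtain ⟨s', hs'1, hms', hs'q⟩ := h.exists_extend_minimizing h1 hq
      (hs.1.trans_le (hmax hsA)) (lt_of_le_of_ne hm.1.2 hne) hm.2
    exact (hmax ⟨⟨hm.1.1.trans hms'.le, hs'1⟩, hs'q⟩).not_gt hms'
  exact eq_of_riemannianEDist_eq_zero E (by simpa using hm.2)

lemma exists_initial_direction {p q : S} {r : ℝ} (hr : 0 < r)
    (hq : riemannianEDist 𝓘(ℝ, E) p q = ENNReal.ofReal r) :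
    ∃ v : TangentSpace 𝓘(ℝ, E) p, ‖v‖ = r ∧ ∃ s ∈ Ioc (0 : ℝ) 1, ∀ γ J,
      IsGeodesicWith ⟨p, v⟩ γ J → 1 ∈ J →
        riemannianEDist 𝓘(ℝ, E) (γ s) q ≤ ENNReal.ofReal ((1 - s) * r) := by
  obtain ⟨ρ, hρ, hstep⟩ := exists_step_toward E p
  obtain ⟨ρ', hρ', hminimizing⟩ := exists_isStrictlyMinimizing (E := E) p
  obtain ⟨δ, hδ, hδ_lt⟩ := exists_between (lt_min (lt_min hρ hρ') hr)
  obtain ⟨⟨hδρ, hδρ'⟩, hδr⟩ := by simpa only [lt_min_iff] using hδ_lt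
  obtain ⟨y, hy, hyq⟩ := hstep δ r hδ.le hδρ hδr.le q hq
  obtain ⟨⟨p', w⟩, c, hc⟩ := hminimizing p y
    (by rw [riemannianEDist_self]; exact ENNReal.ofReal_pos.2 hρ')
    (by rw [hy]; exact (ENNReal.ofReal_lt_ofReal_iff hρ').2 hδρ')
  obtain rfl : p' = p := hc.isGeodesicWith.apply_zero.symm.trans hc.apply_zero
  have hw : ‖w‖ = δ := (ENNReal.ofReal_eq_ofReal_iff (norm_nonneg _) hδ.le).1
    (hc.ofReal_norm.trans hy)
  refine ⟨(r / δ) • w, ?_, δ / r, ⟨by positivity, (div_le_one hr).2 hδr.le⟩,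
    fun γ J hγ h1 => ?_⟩
  · rw [norm_smul, hw, Real.norm_of_nonneg (by positivity), div_mul_cancel₀ r hδ.ne']
  have hrescaled := hγ.comp_mul (a := δ / r) (by positivity)
  simp only [smul_smul, div_mul_div_cancel₀ hr.ne', div_self hδ.ne', one_smul] at hrescaled
  have hmem : δ / r * 1 ∈ J := hγ.ordConnected.out hγ.zero_mem h1
    ⟨by positivity, by rw [mul_one]; exact (div_le_one hr).2 hδr.le⟩
  have hγy : γ (δ / r * 1) = y := hc.apply_one ▸ (congrArg TotalSpace.proj
    (hc.isGeodesicWith.eqOn_velocity hrescaled ⟨by norm_num, hmem⟩)).symm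
  rw [mul_one] at hγy
  rwa [hγy, sub_mul, one_mul, div_mul_cancel₀ δ hr.ne']

lemma exists_expMap_eq {p q : S} {t : ℝ} (ht : 0 ≤ t)
    (hball : Metric.closedBall (0 : TangentSpace 𝓘(ℝ, E) p) t ⊆ expDomain p)
    (hq : riemannianEDist 𝓘(ℝ, E) p q ≤ ENNReal.ofReal t) :
    ∃ v ∈ Metric.closedBall (0 : TangentSpace 𝓘(ℝ, E) p) t, expMap p v = q := by
  obtain ⟨r, hr0, hrt, hr⟩ :
      ∃ r : ℝ, 0 ≤ r ∧ r ≤ t ∧ riemannianEDist 𝓘(ℝ, E) p q = ENNReal.ofReal r :=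
    ⟨_, ENNReal.toReal_nonneg, ENNReal.toReal_le_of_le_ofReal ht hq,
      (ENNReal.ofReal_toReal (ne_top_of_le_ne_top ENNReal.ofReal_ne_top hq)).symm⟩
  obtain ⟨v, hv, hreach⟩ : ∃ v : TangentSpace 𝓘(ℝ, E) p, ‖v‖ = r ∧
      ∀ γ J, IsGeodesicWith ⟨p, v⟩ γ J → 1 ∈ J → γ 1 = q := by
    obtain rfl | hrpos := hr0.eq_or_lt
    · obtain rfl := eq_of_riemannianEDist_eq_zero E (hr.trans ENNReal.ofReal_zero)
      refine ⟨0, norm_zero, fun γ J hγ h1 => ?_⟩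
      have hconst := hγ.riemannianEDist_le hγ.zero_mem h1 zero_le_one
      rw [hγ.apply_zero, norm_zero, mul_zero, ENNReal.ofReal_zero, nonpos_iff_eq_zero] at hconst
      exact (eq_of_riemannianEDist_eq_zero E hconst).symm
    · obtain ⟨v, hv, s, hs, hsq⟩ := exists_initial_direction hrpos hr
      refine ⟨v, hv, fun γ J hγ h1 => ?_⟩
      subst hv
      exact hγ.apply_one_eq_of_minimizing h1 hr hs (hsq γ J hγ h1)
  have hvt : v ∈ Metric.closedBall 0 t := mem_closedBall_zero_iff.2 (hv.trans_le hrt)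
  obtain ⟨γ, hγ⟩ := hball hvt
  obtain ⟨J, hJ, h1⟩ := isGeodesicFrom_iff.1 hγ
  exact ⟨v, hvt, (expMap_eq hγ).trans (hreach γ J hJ h1)⟩

end HopfRinow

section Causal

variable {E : Type*} [NormedAddCommGroup E] [NormedSpace ℝ E]
  {S : Type*} [TopologicalSpace S] [ChartedSpace E S]

lemma timePart_mfderivWithin {γ : ℝ → ℝ × S} {A : Set ℝ} {s : ℝ} (hA : UniqueDiffWithinAt ℝ A s)
    (hγ : MDifferentiableWithinAt 𝓘(ℝ, ℝ) (𝓘(ℝ, ℝ).prod 𝓘(ℝ, E)) γ A s) :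
    timePart (γ s) (mfderivWithin 𝓘(ℝ, ℝ) (𝓘(ℝ, ℝ).prod 𝓘(ℝ, E)) γ A s (1 : ℝ))
      = derivWithin (fun r => (γ r).1) A s := by
  have hcomp := mfderiv_comp_mfderivWithin s (mdifferentiableAt_fst (I' := 𝓘(ℝ, E))) hγ
    (uniqueMDiffWithinAt_iff_uniqueDiffWithinAt.2 hA)
  rw [mfderivWithin_eq_fderivWithin] at hcomp
  rw [← fderivWithin_derivWithin]
  exact congr($hcomp (1 : ℝ)).symm

lemma spacePart_mfderivWithin {γ : ℝ → ℝ × S} {A : Set ℝ} {s : ℝ} (hA : UniqueDiffWithinAt ℝ A s)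
    (hγ : MDifferentiableWithinAt 𝓘(ℝ, ℝ) (𝓘(ℝ, ℝ).prod 𝓘(ℝ, E)) γ A s) :
    spacePart (γ s) (mfderivWithin 𝓘(ℝ, ℝ) (𝓘(ℝ, ℝ).prod 𝓘(ℝ, E)) γ A s (1 : ℝ))
      = mfderivWithin 𝓘(ℝ, ℝ) 𝓘(ℝ, E) (fun r => (γ r).2) A s (1 : ℝ) := by
  have hcomp := mfderiv_comp_mfderivWithin s (mdifferentiableAt_snd (I := 𝓘(ℝ, ℝ))) hγ
    (uniqueMDiffWithinAt_iff_uniqueDiffWithinAt.2 hA)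
  exact congr($hcomp (1 : ℝ)).symm

lemma mdifferentiableAt_prodMk_const (m : ℝ × S) :
    MDifferentiableAt 𝓘(ℝ, ℝ) (𝓘(ℝ, ℝ).prod 𝓘(ℝ, E)) (fun τ : ℝ => (τ, m.2)) m.1 :=
  mdifferentiableAt_id.prodMk mdifferentiableAt_const

lemma timePart_timeField (m : ℝ × S) : timePart m (timeField E m) = 1 := by
  have hcomp := mfderiv_comp m.1 (mdifferentiableAt_fst (x := (m.1, m.2)) (I' := 𝓘(ℝ, E)))
    (mdifferentiableAt_prodMk_const m)
  refine (congr($hcomp (1 : ℝ)).symm).trans ?_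
  change (mfderiv 𝓘(ℝ, ℝ) 𝓘(ℝ, ℝ) (fun τ : ℝ => τ) m.1 : ℝ →L[ℝ] ℝ) 1 = 1
  rw [mfderiv_eq_fderiv, fderiv_fun_id]
  rfl

lemma spacePart_timeField (m : ℝ × S) : spacePart m (timeField E m) = 0 := by
  have hcomp := mfderiv_comp m.1 (mdifferentiableAt_snd (x := (m.1, m.2)) (I := 𝓘(ℝ, ℝ)))
    (mdifferentiableAt_prodMk_const (E := E) m)
  refine (congr($hcomp (1 : ℝ)).symm).trans ?_
  change (mfderiv 𝓘(ℝ, ℝ) 𝓘(ℝ, E) (fun _ : ℝ => m.2) m.1 : ℝ →L[ℝ] E) 1 = 0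
  rw [mfderiv_const]
  rfl

variable [RiemannianBundle (fun x : S => TangentSpace 𝓘(ℝ, E) x)]

lemma isFutureCausalCurve_iff {γ : ℝ → ℝ × S} {a b : ℝ} :
    IsFutureCausalCurve E γ a b ↔ a < b ∧
      ContMDiffOn 𝓘(ℝ, ℝ) (𝓘(ℝ, ℝ).prod 𝓘(ℝ, E)) ∞ γ (Icc a b) ∧
      ∀ s ∈ Icc a b, 0 < derivWithin (fun r => (γ r).1) (Icc a b) s ∧
        ‖(mfderivWithin 𝓘(ℝ, ℝ) 𝓘(ℝ, E) (fun r => (γ r).2) (Icc a b) s (1 : ℝ) :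
          TangentSpace 𝓘(ℝ, E) (γ s).2)‖ ≤ derivWithin (fun r => (γ r).1) (Icc a b) s := by
  refine and_congr_right fun hab => and_congr_right fun hγ => forall₂_congr fun s hs => ?_
  have hunique := uniqueDiffOn_Icc hab s hs
  have hdiff := (hγ s hs).mdifferentiableWithinAt (n := ∞) (by simp)
  rw [lorentz, lorentz, timePart_timeField, spacePart_timeField,
    timePart_mfderivWithin hunique hdiff, spacePart_mfderivWithin hunique hdiff, inner_zero_right,
    real_inner_self_eq_norm_sq, mul_one, sub_zero, and_comm]
  refine and_congr_right fun hpos => ?_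
  rw [sub_nonneg, ← pow_two]
  exact sq_le_sq₀ (norm_nonneg _) hpos.le

lemma IsFutureCausalCurve.riemannianEDist_le {γ : ℝ → ℝ × S} {a b : ℝ}
    (h : IsFutureCausalCurve E γ a b) :
    riemannianEDist 𝓘(ℝ, E) (γ a).2 (γ b).2 ≤ ENNReal.ofReal ((γ b).1 - (γ a).1) := by
  obtain ⟨hab, hγ, hcausal⟩ := isFutureCausalCurve_iff.1 h
  have htime : ContDiffOn ℝ 1 (fun r => (γ r).1) (Icc a b) :=
    (contMDiffOn_iff_contDiffOn.1 (contMDiff_fst.comp_contMDiffOn hγ)).of_le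
      (by exact_mod_cast le_top)
  have hspace : ContMDiffOn 𝓘(ℝ, ℝ) 𝓘(ℝ, E) 1 (fun r => (γ r).2) (Icc a b) :=
    (contMDiff_snd.comp_contMDiffOn hγ).of_le (by exact_mod_cast le_top)
  refine (riemannianEDist_le_pathELength hspace rfl rfl hab.le).trans ?_
  rw [pathELength_eq_lintegral_mfderivWithin_Icc,
    ← intervalIntegral.integral_derivWithin_Icc_of_contDiffOn_Icc htime hab.le,
    intervalIntegral.integral_of_le hab.le, ← MeasureTheory.integral_Icc_eq_integral_Ioc,
    MeasureTheory.ofReal_integral_eq_lintegral_ofReal]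
  · refine MeasureTheory.setLIntegral_mono' measurableSet_Icc fun s hs => ?_
    rw [← ofReal_norm]
    exact ENNReal.ofReal_le_ofReal (hcausal s hs).2
  · exact (htime.continuousOn_derivWithin (uniqueDiffOn_Icc hab) le_rfl).integrableOn_Icc
  · filter_upwards [MeasureTheory.ae_restrict_mem measurableSet_Icc] with s hs
    exact (hcausal s hs).1.le

variable {K : Set S} {t : ℝ}

lemma mem_closedNeighborhood_of_le {p q : S} (hp : p ∈ K)
    (h : riemannianEDist 𝓘(ℝ, E) p q ≤ ENNReal.ofReal t) :
    q ∈ closedNeighborhood (E := E) K t :=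
  (iInf₂_le (f := fun p _ => riemannianEDist 𝓘(ℝ, E) q p) p hp).trans
    (riemannianEDist_comm.trans_le h)

lemma subset_closedNeighborhood : K ⊆ closedNeighborhood (E := E) K t := fun _ hq =>
  mem_closedNeighborhood_of_le hq (riemannianEDist_self.trans_le zero_le)

lemma causalInfluence_inter_timeSlice_subset (ht : 0 ≤ t) :
    causalInfluence E (({0} : Set ℝ) ×ˢ K) ∩ timeSlice S t
      ⊆ ({t} : Set ℝ) ×ˢ closedNeighborhood (E := E) K t := by
  rintro ⟨τ, q⟩ ⟨hJ, hτ, -⟩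
  obtain rfl : τ = t := hτ
  refine ⟨rfl, ?_⟩
  rcases hJ with (hself | ⟨⟨_, p⟩, ⟨rfl, hp⟩, γ, a, b, hγ, ha, hb⟩) |
    (hself | ⟨⟨_, p⟩, ⟨rfl, hp⟩, γ, a, b, hγ, ha, hb⟩)
  · exact subset_closedNeighborhood hself.2
  · have hle := hγ.riemannianEDist_le
    rw [ha, hb, sub_zero] at hle
    exact mem_closedNeighborhood_of_le hp hle
  · exact subset_closedNeighborhood hself.2
  · have hle := hγ.riemannianEDist_le
    rw [ha, hb, riemannianEDist_comm, zero_sub] at hle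
    exact mem_closedNeighborhood_of_le hp
      (hle.trans (ENNReal.ofReal_le_ofReal (by linarith)))

end Causal

section ClosedNeighborhood

variable {E : Type*} [NormedAddCommGroup E] [NormedSpace ℝ E] [FiniteDimensional ℝ E]
  {S : Type*} [TopologicalSpace S] [ChartedSpace E S]
  [RiemannianBundle (fun x : S => TangentSpace 𝓘(ℝ, E) x)]
  [IsManifold 𝓘(ℝ, E) ∞ S]
  [IsContMDiffRiemannianBundle 𝓘(ℝ, E) ∞ E (fun x : S => TangentSpace 𝓘(ℝ, E) x)]
  {K : Set S} {t : ℝ} {z : TangentBundle 𝓘(ℝ, E) S} {γ : ℝ → S} {J : Set ℝ}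

lemma IsGeodesicWith.riemannianEDist_proj_le (h : IsGeodesicWith z γ J) (hz : ‖z.2‖ ≤ t) {s : ℝ}
    (hs : s ∈ J) (hs01 : s ∈ Icc 0 1) :
    riemannianEDist 𝓘(ℝ, E) z.proj (γ s) ≤ ENNReal.ofReal t := by
  have hle := h.riemannianEDist_le h.zero_mem hs hs01.1
  rw [h.apply_zero, sub_zero] at hle
  refine hle.trans (ENNReal.ofReal_le_ofReal ?_)
  exact (mul_le_of_le_one_left (norm_nonneg _) hs01.2).trans hz

lemma IsGeodesicWith.isFutureCausalCurve (h : IsGeodesicWith z γ J) (h1 : 1 ∈ J) (ht : 0 < t)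
    (hz : ‖z.2‖ ≤ t) : IsFutureCausalCurve E (fun σ => (t * σ, γ σ)) 0 1 := by
  have hJ : Icc 0 1 ⊆ J := h.ordConnected.out h.zero_mem h1
  have htime : ContMDiff 𝓘(ℝ, ℝ) 𝓘(ℝ, ℝ) ∞ fun σ : ℝ => t * σ :=
    contMDiff_iff_contDiff.2 (by fun_prop)
  refine isFutureCausalCurve_iff.2 ⟨zero_lt_one,
    htime.contMDiffOn.prodMk (h.isGeodesicOn.1.mono hJ), fun σ hσ => ?_⟩
  have hunique := uniqueDiffOn_Icc (zero_lt_one' ℝ) σ hσ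
  have hderiv : derivWithin (fun r : ℝ => t * r) (Icc 0 1) σ = t := by
    simpa only [mul_one] using
      (((hasDerivAt_id' σ).const_mul t).hasDerivWithinAt (s := Icc 0 1)).derivWithin hunique
  have hmfderiv : mfderivWithin 𝓘(ℝ, ℝ) 𝓘(ℝ, E) γ (Icc 0 1) σ
      = mfderiv 𝓘(ℝ, ℝ) 𝓘(ℝ, E) γ σ :=
    mfderivWithin_eq_mfderiv (uniqueMDiffWithinAt_iff_uniqueDiffWithinAt.2 hunique)
      (h.isGeodesicOn.mdifferentiableAt h.isOpen (hJ hσ))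
  simp only [hderiv, hmfderiv]
  exact ⟨ht, (h.norm_velocity (hJ hσ)).trans_le hz⟩

variable [T2Space S]

lemma exists_mem_of_mem_closedNeighborhood (hK : IsCompact K) {q : S}
    (h : q ∈ closedNeighborhood (E := E) K t) :
    ∃ p ∈ K, riemannianEDist 𝓘(ℝ, E) p q ≤ ENNReal.ofReal t := by
  have hnonempty : K.Nonempty := by
    rw [nonempty_iff_ne_empty]
    rintro rfl
    simp [closedNeighborhood] at h
  obtain ⟨p, hp, hmin⟩ := hK.exists_isMinOn hnonempty
    ((continuous_riemannianEDist E).comp (Continuous.prodMk_right q)).continuousOn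
  exact ⟨p, hp, riemannianEDist_comm.trans_le ((le_iInf₂ fun _ hp' => hmin hp').trans h)⟩

lemma IsGeodesicWith.mem_causalInfluence (h : IsGeodesicWith z γ J) (hzK : z.proj ∈ K)
    (hz : ‖z.2‖ ≤ t) {s : ℝ} (hs : s ∈ J) (hs01 : s ∈ Icc 0 1) :
    (t, γ s) ∈ causalInfluence E (({0} : Set ℝ) ×ˢ K) ∩ timeSlice S t := by
  refine ⟨.inl ?_, rfl, trivial⟩
  rcases ((norm_nonneg _).trans hz).eq_or_lt with rfl | ht
  · have hle := h.riemannianEDist_proj_le hz hs hs01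
    rw [ENNReal.ofReal_zero, nonpos_iff_eq_zero] at hle
    exact .inl ⟨rfl, eq_of_riemannianEDist_eq_zero E hle ▸ hzK⟩
  · refine .inr ⟨(0, z.proj), ⟨rfl, hzK⟩, fun σ => (t * σ, γ (s * σ)), 0, 1, ?_, ?_, ?_⟩
    · refine (h.comp_mul hs01.1).isFutureCausalCurve (by simpa using hs) ht ?_
      rw [norm_smul, Real.norm_of_nonneg hs01.1]
      exact (mul_le_of_le_one_left (norm_nonneg _) hs01.2).trans hz
    · simp only [mul_zero, h.apply_zero]
    · simp only [mul_one]

lemma closedNeighborhood_eq_iUnion (hK : IsCompact K) (ht : 0 ≤ t)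
    (h : ∀ p ∈ K, Metric.closedBall (0 : TangentSpace 𝓘(ℝ, E) p) t ⊆ expDomain p) :
    closedNeighborhood (E := E) K t
      = ⋃ p ∈ K, expMap p '' Metric.closedBall (0 : TangentSpace 𝓘(ℝ, E) p) t := by
  ext q
  simp only [mem_iUnion, mem_image, exists_prop]
  constructor
  · intro hq
    obtain ⟨p, hp, hpq⟩ := exists_mem_of_mem_closedNeighborhood hK hq
    exact ⟨p, hp, exists_expMap_eq ht (h p hp) hpq⟩
  · rintro ⟨p, hp, v, hv, rfl⟩
    obtain ⟨γ, hγ⟩ := h p hp hv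
    obtain ⟨J, hJ, h1⟩ := isGeodesicFrom_iff.1 hγ
    rw [expMap_eq hγ]
    exact mem_closedNeighborhood_of_le hp
      (hJ.riemannianEDist_proj_le (mem_closedBall_zero_iff.1 hv) h1 (right_mem_Icc.2 zero_le_one))

lemma isCompact_closedNeighborhood (hK : IsCompact K) (ht : 0 ≤ t)
    (h : ∀ p ∈ K, Metric.closedBall (0 : TangentSpace 𝓘(ℝ, E) p) t ⊆ expDomain p) :
    IsCompact (closedNeighborhood (E := E) K t) := by
  have himage : closedNeighborhood (E := E) K t
      = (fun z : TangentBundle 𝓘(ℝ, E) S => expMap z.proj z.2) '' {z | z.proj ∈ K ∧ ‖z.2‖ ≤ t} := by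
    rw [closedNeighborhood_eq_iUnion hK ht h]
    ext q
    simp only [mem_iUnion, mem_image, exists_prop, mem_closedBall_zero_iff]
    exact ⟨fun ⟨p, hp, v, hv, hq⟩ => ⟨⟨p, v⟩, ⟨hp, hv⟩, hq⟩,
      fun ⟨⟨p, v⟩, ⟨hp, hv⟩, hq⟩ => ⟨p, hp, v, hv, hq⟩⟩
  rw [himage]
  exact (isCompact_ball_bundle hK t).image_of_continuousOn
    (continuousOn_expMap.mono fun z hz => h z.proj hz.1 (mem_closedBall_zero_iff.2 hz.2))

lemma prod_closedNeighborhood_eq (hK : IsCompact K) (ht : 0 ≤ t)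
    (h : ∀ p ∈ K, Metric.closedBall (0 : TangentSpace 𝓘(ℝ, E) p) t ⊆ expDomain p) :
    ({t} : Set ℝ) ×ˢ closedNeighborhood (E := E) K t
      = causalInfluence E (({0} : Set ℝ) ×ˢ K) ∩ timeSlice S t := by
  refine Subset.antisymm ?_ (causalInfluence_inter_timeSlice_subset ht)
  rintro ⟨_, q⟩ ⟨rfl, hq⟩
  obtain ⟨p, hp, hpq⟩ := exists_mem_of_mem_closedNeighborhood hK hq
  obtain ⟨v, hv, rfl⟩ := exists_expMap_eq ht (h p hp) hpq
  obtain ⟨γ, hγ⟩ := h p hp hv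
  obtain ⟨J, hJ, h1⟩ := isGeodesicFrom_iff.1 hγ
  rw [expMap_eq hγ]
  exact hJ.mem_causalInfluence hp (mem_closedBall_zero_iff.1 hv) h1 (right_mem_Icc.2 zero_le_one)

lemma subset_expDomain_of_isCompact_closedNeighborhood
    (hC : IsCompact (closedNeighborhood (E := E) K t)) {p : S} (hp : p ∈ K) :
    Metric.closedBall (0 : TangentSpace 𝓘(ℝ, E) p) t ⊆ expDomain p := fun _ hv =>
  mem_expDomain_of_forall_mem hC fun _ _ hγ _ hs hs0 hs1 => mem_closedNeighborhood_of_le hp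
    (hγ.riemannianEDist_proj_le (mem_closedBall_zero_iff.1 hv) hs ⟨hs0, hs1⟩)

lemma subset_expDomain_of_isCompact_causalInfluence
    (hC : IsCompact (causalInfluence E (({0} : Set ℝ) ×ˢ K) ∩ timeSlice S t)) {p : S}
    (hp : p ∈ K) :
    Metric.closedBall (0 : TangentSpace 𝓘(ℝ, E) p) t ⊆ expDomain p := fun _ hv =>
  mem_expDomain_of_forall_mem (hC.image continuous_snd) fun _ _ hγ _ hs hs0 hs1 =>
    ⟨_, hγ.mem_causalInfluence hp (mem_closedBall_zero_iff.1 hv) hs ⟨hs0, hs1⟩, rfl⟩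

end ClosedNeighborhood

end Ultrastatic

end

theorem mainTheorem10
    {E : Type*} [NormedAddCommGroup E] [NormedSpace ℝ E] [FiniteDimensional ℝ E]
    {S : Type*} [TopologicalSpace S] [T2Space S] [ChartedSpace E S] [IsManifold 𝓘(ℝ, E) ∞ S]
    [RiemannianBundle (fun x : S => TangentSpace 𝓘(ℝ, E) x)]
    [IsContMDiffRiemannianBundle 𝓘(ℝ, E) ∞ E (fun x : S => TangentSpace 𝓘(ℝ, E) x)]
    (K : Set S) (hK : IsCompact K) (t : ℝ) (ht : 0 ≤ t) :
    [IsCompact (Ultrastatic.closedNeighborhood (E := E) K t),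
      ∀ p ∈ K, Metric.closedBall (0 : TangentSpace 𝓘(ℝ, E) p) t ⊆ Ultrastatic.expDomain p,
      IsCompact (Ultrastatic.causalInfluence E (({0} : Set ℝ) ×ˢ K) ∩
        Ultrastatic.timeSlice S t)].TFAE ∧
    (IsCompact (Ultrastatic.closedNeighborhood (E := E) K t) →
      Ultrastatic.closedNeighborhood (E := E) K t =
          ⋃ p ∈ K, Ultrastatic.expMap p '' Metric.closedBall (0 : TangentSpace 𝓘(ℝ, E) p) t ∧
      ({t} : Set ℝ) ×ˢ Ultrastatic.closedNeighborhood (E := E) K t =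
          Ultrastatic.causalInfluence E (({0} : Set ℝ) ×ˢ K) ∩ Ultrastatic.timeSlice S t) := by
  have subset_of_isCompact (hC : IsCompact (Ultrastatic.closedNeighborhood (E := E) K t)) :
      ∀ p ∈ K, Metric.closedBall (0 : TangentSpace 𝓘(ℝ, E) p) t ⊆ Ultrastatic.expDomain p :=
    fun p hp => Ultrastatic.subset_expDomain_of_isCompact_closedNeighborhood hC hp
  refine ⟨?_, fun hC => ⟨Ultrastatic.closedNeighborhood_eq_iUnion hK ht (subset_of_isCompact hC),
    Ultrastatic.prod_closedNeighborhood_eq hK ht (subset_of_isCompact hC)⟩⟩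
  tfae_have 1 → 2 := subset_of_isCompact
  tfae_have 2 → 1 := Ultrastatic.isCompact_closedNeighborhood hK ht
  tfae_have 2 → 3 := by
    intro h
    rw [← Ultrastatic.prod_closedNeighborhood_eq hK ht h]
    exact isCompact_singleton.prod (Ultrastatic.isCompact_closedNeighborhood hK ht h)
  tfae_have 3 → 2 := fun hC p hp =>
    Ultrastatic.subset_expDomain_of_isCompact_causalInfluence hC hp
  tfae_finish
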